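/- For $f\in\mathcal S(\mathbb R^n)$ write $\widehat f(\xi)=\int_{\mathbb R^n}e^{-i\xi\cdot x}f(x)\,dx$, and fix a window $\varphi\in\mathcal S(\mathbb R^n)\setminus\{0\}$. For a tempered distribution $f\in\mathcal S'(\mathbb R^n)$ let $V_\varphi f(x,\xi)=(f,M_\xi T_x\varphi)$, where $M_\xi T_x\varphi(t)=e^{i\xi\cdot t}\varphi(t-x)$ and $(\cdot,\cdot)$ extends the inner product of $L^2(\mathbb R^n)$. For $1<p,q<\infty$ the modulation space $M^{p,q}(\mathbb R^n)$ consists of all $f\in\mathcal S'(\mathbb R^n)$ with \[ \|f\|_{M^{p,q}}=\left\{\int_{\mathbb R^n}\left(\int_{\mathbb R^n}|V_\varphi f(x,\xi)|^p\,dx\right)^{q/p}d\xi\right\}^{1/q}<\infty . \] For $0<\beta\le\alpha<n$ let $I_{\alpha,\beta}=I_\alpha+I_\beta$ be the Fourier multiplier operator \[ I_{\alpha,\beta}f=\mathcal F^{-1}\left[\left(|\xi|^{-\alpha}+|\xi|^{-\beta}\right)\widehat f\,\right],\qquad f\in\mathcal S(\mathbb R^n). \] It is called bounded from $M^{p_1,q_1}(\mathbb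 R^n)$ to $M^{p_2,q_2}(\mathbb R^n)$ if it extends from $\mathcal S(\mathbb R^n)$ to a bounded linear operator from $M^{p_1,q_1}(\mathbb R^n)$ to $M^{p_2,q_2}(\mathbb R^n)$. **Theorem 1.2.** Let $0<\beta\le\alpha<n$ and $1<p_1,p_2,q_1,q_2<\infty$. Then $I_{\alpha,\beta}$ is bounded from $M^{p_1,q_1}(\mathbb R^n)$ to $M^{p_2,q_2}(\mathbb R^n)$ if and only if \[ \frac1{p_2}\le\frac1{p_1}-\frac{\alpha}{n}\qquad\text{and}\qquad\frac1{q_2}<\frac1{q_1}+\frac{\beta}{n}. \] -/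

import Mathlib

open MeasureTheory SchwartzMap FourierTransform
open scoped ENNReal NNReal ComplexConjugate

noncomputable section

namespace ModulationSpaces

/-- Euclidean space `ℝⁿ`. -/
abbrev Rn (n : ℕ) : Type := EuclideanSpace ℝ (Fin n)

/-- The character `t ↦ e^{i ξ·t}`. -/
def character {n : ℕ} (ξ t : Rn n) : ℂ :=
  Complex.exp (Complex.I * ((inner ℝ ξ t : ℝ) : ℂ))

theorem hasTemperateGrowth_exp_I :
    Function.HasTemperateGrowth (fun s : ℝ => Complex.exp (Complex.I * (s : ℂ))) := by
  have key : ∀ k : ℕ, iteratedDeriv k (fun s : ℝ => Complex.exp (Complex.I * (s : ℂ)))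
      = fun s : ℝ => Complex.I ^ k * Complex.exp (Complex.I * (s : ℂ)) := by
    intro k
    induction k with
    | zero => simp
    | succ k ih =>
      rw [iteratedDeriv_succ, ih]
      funext s
      have h1 : HasDerivAt (fun s : ℝ => Complex.I * (s : ℂ)) Complex.I s := by
        simpa using (Complex.ofRealCLM.hasDerivAt (x := s)).const_mul Complex.I
      have h2 := (h1.cexp).const_mul (Complex.I ^ k)
      rw [h2.deriv]
      ring
  refine ⟨?_, ?_⟩
  · exact (contDiff_const.mul Complex.ofRealCLM.contDiff).cexp
  · intro k
    refine ⟨0, 1, fun s => ?_⟩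
    rw [norm_iteratedFDeriv_eq_norm_iteratedDeriv, key k]
    simp [mul_comm Complex.I, Complex.norm_exp_ofReal_mul_I]

theorem hasTemperateGrowth_character {n : ℕ} (ξ : Rn n) :
    Function.HasTemperateGrowth (character ξ) := by
  exact hasTemperateGrowth_exp_I.comp (Function.hasTemperateGrowth_inner_right ξ)

/-- Translation and modulation `M_ξ T_x φ`, that is `t ↦ e^{i ξ·t} φ(t - x)`. -/
def timeFrequencyShift {n : ℕ} (x ξ : Rn n) (φ : 𝓢(Rn n, ℂ)) : 𝓢(Rn n, ℂ) :=
  SchwartzMap.smulLeftCLM ℂ (character ξ) (SchwartzMap.compSubConstCLM ℂ x φ)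

theorem timeFrequencyShift_apply {n : ℕ} (x ξ : Rn n) (φ : 𝓢(Rn n, ℂ)) (t : Rn n) :
    timeFrequencyShift x ξ φ t = character ξ t * φ (t - x) := by
  simp [timeFrequencyShift,
    SchwartzMap.smulLeftCLM_apply_apply (hasTemperateGrowth_character ξ)]

/-- The pointwise complex conjugate of a Schwartz function. -/
def conjSchwartz {n : ℕ} (φ : 𝓢(Rn n, ℂ)) : 𝓢(Rn n, ℂ) :=
  SchwartzMap.postcompCLM (𝕜 := ℝ) (Complex.conjCLE : ℂ →L[ℝ] ℂ) φ

theorem conjSchwartz_apply {n : ℕ} (φ : 𝓢(Rn n, ℂ)) (t : Rn n) :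
    conjSchwartz φ t = conj (φ t) := by
  simp [conjSchwartz]

/-- The short-time Fourier transform `V_φ u (x, ξ) = (u, M_ξ T_x φ)` of a tempered distribution,
where `(u, g) = u (conj g)` extends the inner product of `L²`. -/
def stft {n : ℕ} (φ : 𝓢(Rn n, ℂ)) (u : 𝓢'(Rn n, ℂ)) (x ξ : Rn n) : ℂ :=
  u (conjSchwartz (timeFrequencyShift x ξ φ))

/-- The modulation space norm with window `φ`,
`(∫ (∫ |V_φ u (x, ξ)|^p dx)^{q/p} dξ)^{1/q}`, for finite exponents `p` and `q`
(with value `∞` when `u` is not in the space). -/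
def modulationNorm {n : ℕ} (φ : 𝓢(Rn n, ℂ)) (p q : ℝ) (u : 𝓢'(Rn n, ℂ)) : ℝ≥0∞ :=
  (∫⁻ ξ : Rn n, (∫⁻ x : Rn n, ‖stft φ u x ξ‖ₑ ^ p) ^ (q / p)) ^ (1 / q)

/-- The modulation space `M^{p,q}(ℝⁿ)`. -/
def modulationSpace {n : ℕ} (φ : 𝓢(Rn n, ℂ)) (p q : ℝ) : Set 𝓢'(Rn n, ℂ) :=
  {u | modulationNorm φ p q u < ∞}

/-- The operator `I_{α,β} = I_α + I_β` on Schwartz functions, i.e. the Fourier multiplier with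
symbol `|ξ|^{-α} + |ξ|^{-β}` with respect to the transform `∫ e^{-i ξ·x} f(x) dx`.  Since `𝓕` is
normalised with `e^{-2π i ξ·x}`, the symbol is evaluated at `2πξ`. -/
def fractionalIntegral {n : ℕ} (α β : ℝ) (f : 𝓢(Rn n, ℂ)) : Rn n → ℂ :=
  𝓕⁻ (fun ξ : Rn n =>
    (((2 * Real.pi * ‖ξ‖) ^ (-α) + (2 * Real.pi * ‖ξ‖) ^ (-β) : ℝ) : ℂ) * 𝓕 (f : Rn n → ℂ) ξ)

/-- The tempered distribution `u` is given by the function `F`. -/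
def IsGivenBy {n : ℕ} (u : 𝓢'(Rn n, ℂ)) (F : Rn n → ℂ) : Prop :=
  ∀ g : 𝓢(Rn n, ℂ), Integrable (fun x => g x * F x) ∧ u g = ∫ x, g x * F x

/-- `I_{α,β}` is bounded from `M^{p₁,q₁}` to `M^{p₂,q₂}`: there is a linear operator `T` with domain
exactly `M^{p₁,q₁}` that coincides with `I_{α,β}` on the (dense) subspace of Schwartz functions and
satisfies `‖T u‖_{M^{p₂,q₂}} ≤ C ‖u‖_{M^{p₁,q₁}}` for all `u ∈ M^{p₁,q₁}`. -/
def FractionalIntegralBounded {n : ℕ} (φ : 𝓢(Rn n, ℂ)) (α β p₁ q₁ p₂ q₂ : ℝ) : Prop :=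
  ∃ T : 𝓢'(Rn n, ℂ) →ₗ.[ℂ] 𝓢'(Rn n, ℂ),
    (T.domain : Set 𝓢'(Rn n, ℂ)) = modulationSpace φ p₁ q₁ ∧
    (∀ f : 𝓢(Rn n, ℂ), ∃ hf : (f : 𝓢'(Rn n, ℂ)) ∈ T.domain,
      IsGivenBy (T ⟨(f : 𝓢'(Rn n, ℂ)), hf⟩) (fractionalIntegral α β f)) ∧
    ∃ C : ℝ≥0, ∀ u : T.domain,
      modulationNorm φ p₂ q₂ (T u) ≤ C * modulationNorm φ p₁ q₁ (u : 𝓢'(Rn n, ℂ))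

end ModulationSpaces

end

/-! Sufficiency comes from an almost-diagonal estimate for the operator on time-frequency shifts.
The symbol of a Riesz potential is a superposition of dilated bumps, `(2π‖ζ‖)^(-α) = c ∫ e^(ατ)
bump(e^τ ζ) dτ` (`subordConst_mul_integral`). The multiplier `bump(t ·)` is convolution with a
Schwartz kernel spread over the length `t`, so its coefficients between two shifts of the window are
controlled by integration by parts at each scale. Integrating over scales bounds the coefficients of
`I_{α,β}` by `(1+‖ξ‖)^(-β) (1+‖ξ-η‖)^(-N) (1+‖x-y‖)^(-(n-α))`
(`exists_norm_fracForm_shift_shift_le`): small scales yield the frequency gain, whose worse exponent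
is `β`; large scales yield the spatial tail, whose worse exponent is `n-α`.

This kernel is a tensor product, so the two conditions decouple. In space, Hardy–Littlewood–Sobolev
applies exactly when `1/p₂ ≤ 1/p₁ - α/n`. In frequency, convolution with an integrable kernel
followed by the weight `(1+‖ξ‖)^(-β)` is bounded if `1/q₂ < 1/q₁ + β/n`, by Hölder when `q₂ < q₁`
and by embedding otherwise. `exists_mixedNorm_kernel_le` combines both. The operator on the whole
modulation space is defined weakly, by inserting the reproducing formula of the short-time Fourier
transform (`exists_extension`); that formula also shows that it agrees with `I_{α,β}` on Schwartz
functions.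

For necessity, duality of modulation spaces turns boundedness into a bilinear inequality for
Schwartz functions (`exists_enorm_fracForm_le`), tested on inverse Fourier transforms of nonnegative
sums of dilated bumps. Positivity lets everything but the diagonal terms of one potential be dropped
(`sum_le_norm_fracForm`). One bump, dilated by `J → ∞`, concentrates at low frequency and gives the
spatial condition by scaling. A normalised sum of `J` bumps spread dyadically towards high frequency
has norm at most of order `J^(1/q)`, while if the frequency condition fails the form is at least of
order `J`. Comparing powers of `J` excludes the endpoint as well. -/

noncomputable section

namespace ModulationSpaces

/-! ### Converse Hölder inequality and Minkowski's integral inequality -/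

section Duality

variable {X Y : Type*} [MeasurableSpace X] [MeasurableSpace Y] {μ : Measure X} {ν : Measure Y}

theorem lintegral_rpow_le_of_forall_lintegral_mul_le [SigmaFinite μ] {p q : ℝ}
    (hpq : p.HolderConjugate q) {H : X → ℝ≥0∞} (hH : Measurable H) {C : ℝ≥0∞}
    (h : ∀ g : X → ℝ≥0∞, Measurable g →
      ∫⁻ x, H x * g x ∂μ ≤ C * (∫⁻ x, g x ^ q ∂μ) ^ (1 / q)) :
    (∫⁻ x, H x ^ p ∂μ) ^ (1 / p) ≤ C := by
  have hp := hpq.pos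
  have hq := hpq.symm.pos
  set S := spanningSets μ
  -- Truncation in height and in support makes `∫ K^p` finite, so that it can be cancelled below;
  -- Fatou's lemma removes the truncation at the end.
  set K : ℕ → X → ℝ≥0∞ := fun m => (S m).indicator fun x => min (H x) m with hK
  have hKm : ∀ m, Measurable (K m) := fun m =>
    (hH.min measurable_const).indicator (measurableSet_spanningSets μ m)
  have hKle : ∀ m x, K m x ≤ H x := fun m x => by
    by_cases hx : x ∈ S m <;> simp [hK, hx]
  have hfin : ∀ m, ∫⁻ x, K m x ^ p ∂μ ≠ ∞ := by
    intro m
    have : ∀ x, K m x ^ p ≤ (S m).indicator (fun _ => (m : ℝ≥0∞) ^ p) x := by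
      intro x
      by_cases hx : x ∈ S m
      · simp only [hK, hx, Set.indicator_of_mem]
        exact ENNReal.rpow_le_rpow (min_le_right _ _) hp.le
      · simp [hK, hx, hp]
    refine ((lintegral_mono this).trans_lt ?_).ne
    rw [lintegral_indicator (measurableSet_spanningSets μ m), setLIntegral_const]
    exact ENNReal.mul_lt_top (ENNReal.rpow_lt_top_of_nonneg hp.le (ENNReal.natCast_ne_top m))
      (measure_spanningSets_lt_top μ m)
  have hbound : ∀ m, ∫⁻ x, K m x ^ p ∂μ ≤ C ^ p := by
    intro m
    set A := ∫⁻ x, K m x ^ p ∂μ with hA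
    by_cases hA0 : A = 0
    · simp [hA0]
    -- `K^(p-1)` is the extremal function in Hölder's inequality: its `q`-th power is `K^p`. Hence
    -- `A ≤ C A^(1/q)`, and dividing leaves `A^(1/p) ≤ C`.
    have h1 := h (fun x => K m x ^ (p - 1)) ((hKm m).pow_const _)
    have h2 : A ≤ C * A ^ (1 / q) := by
      calc A ≤ ∫⁻ x, H x * K m x ^ (p - 1) ∂μ := by
            refine lintegral_mono fun x => ?_
            calc K m x ^ p = K m x ^ (1 + (p - 1)) := by ring_nf
              _ = K m x ^ (1 : ℝ) * K m x ^ (p - 1) :=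
                ENNReal.rpow_add_of_nonneg _ _ (by norm_num) hpq.sub_one_pos.le
              _ ≤ _ := by rw [ENNReal.rpow_one]; gcongr; exact hKle m x
        _ ≤ _ := h1
        _ = C * A ^ (1 / q) := by
            simp_rw [← ENNReal.rpow_mul, hpq.sub_one_mul_conj, hA]
    have h3 : A = A ^ (1 / p) * A ^ (1 / q) := by
      rw [← ENNReal.rpow_add _ _ hA0 (hfin m)]
      simp only [one_div]
      rw [hpq.inv_add_inv_eq_one, ENNReal.rpow_one]
    have h4 : A ^ (1 / p) ≤ C := by
      have h5 : A ^ (1 / p) * A ^ (1 / q) ≤ C * A ^ (1 / q) := by rw [← h3]; exact h2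
      refine (ENNReal.mul_le_mul_iff_left ?_ ?_).1 h5
      · exact (ENNReal.rpow_pos (pos_iff_ne_zero.2 hA0) (hfin m)).ne'
      · exact (ENNReal.rpow_lt_top_of_nonneg (by positivity) (hfin m)).ne
    calc A = (A ^ (1 / p)) ^ p := by rw [← ENNReal.rpow_mul, one_div_mul_cancel hp.ne',
                                       ENNReal.rpow_one]
      _ ≤ C ^ p := by gcongr
  have hlim : ∀ x, Filter.Tendsto (fun m => K m x ^ p) Filter.atTop (nhds (H x ^ p)) := by
    intro x
    have h1 : Filter.Tendsto (fun m : ℕ => min (H x) (m : ℝ≥0∞)) Filter.atTop (nhds (H x)) := by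
      have := (tendsto_const_nhds (x := H x)).min ENNReal.tendsto_nat_nhds_top
      simpa using this
    refine ((ENNReal.continuous_rpow_const (y := p)).tendsto _).comp (h1.congr' ?_)
    filter_upwards [Filter.eventually_ge_atTop (spanningSetsIndex μ x)] with m hm
    have : x ∈ S m := monotone_spanningSets μ hm (mem_spanningSetsIndex μ x)
    simp [hK, this]
  have hfatou : ∫⁻ x, H x ^ p ∂μ ≤ C ^ p := by
    calc ∫⁻ x, H x ^ p ∂μ = ∫⁻ x, Filter.liminf (fun m => K m x ^ p) Filter.atTop ∂μ := by
          simp_rw [(hlim _).liminf_eq]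
      _ ≤ Filter.liminf (fun m => ∫⁻ x, K m x ^ p ∂μ) Filter.atTop :=
          lintegral_liminf_le fun m => (hKm m).pow_const _
      _ ≤ C ^ p := Filter.liminf_le_of_le (by isBoundedDefault) fun b hb => by
          obtain ⟨m, hm⟩ := hb.exists
          exact hm.trans (hbound m)
  calc (∫⁻ x, H x ^ p ∂μ) ^ (1 / p) ≤ (C ^ p) ^ (1 / p) := by gcongr
    _ = C := by rw [← ENNReal.rpow_mul, mul_one_div_cancel hp.ne', ENNReal.rpow_one]

/-- Minkowski's integral inequality. -/
theorem lintegral_lintegral_rpow_le [SigmaFinite μ] [SFinite ν] {p : ℝ} (hp : 1 < p)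
    {F : X → Y → ℝ≥0∞} (hF : Measurable (Function.uncurry F)) :
    (∫⁻ x, (∫⁻ y, F x y ∂ν) ^ p ∂μ) ^ (1 / p) ≤ ∫⁻ y, (∫⁻ x, F x y ^ p ∂μ) ^ (1 / p) ∂ν := by
  have hpq := Real.HolderConjugate.conjExponent hp
  -- Paired with `g`, the left side becomes an iterated integral; Tonelli exchanges the order, and
  -- Hölder in `x` is applied for each `y`.
  refine lintegral_rpow_le_of_forall_lintegral_mul_le hpq hF.lintegral_prod_right' fun g hg => ?_
  have hFy : ∀ y, Measurable fun x => F x y := fun y =>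
    hF.comp (measurable_id.prodMk measurable_const)
  have hFx : ∀ x, Measurable fun y => F x y := fun x =>
    hF.comp (measurable_const.prodMk measurable_id)
  calc ∫⁻ x, (∫⁻ y, F x y ∂ν) * g x ∂μ = ∫⁻ x, ∫⁻ y, F x y * g x ∂ν ∂μ := by
        refine lintegral_congr fun x => ?_
        rw [lintegral_mul_const _ (hFx x)]
    _ = ∫⁻ y, ∫⁻ x, F x y * g x ∂μ ∂ν := by
        refine lintegral_lintegral_swap ?_
        exact (hF.mul (hg.comp measurable_fst)).aemeasurable
    _ ≤ ∫⁻ y, (∫⁻ x, F x y ^ p ∂μ) ^ (1 / p) *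
          (∫⁻ x, g x ^ p.conjExponent ∂μ) ^ (1 / p.conjExponent) ∂ν := by
        refine lintegral_mono fun y => ?_
        exact ENNReal.lintegral_mul_le_Lp_mul_Lq μ hpq (hFy y).aemeasurable hg.aemeasurable
    _ = _ := by
        rw [lintegral_mul_const]
        refine Measurable.pow_const ?_ _
        exact (Measurable.lintegral_prod_left' (f := fun z : X × Y => F z.1 z.2 ^ p)
          (hF.pow_const p))

end Duality

/-! ### Mixed Lebesgue norms: Minkowski, Hölder, tensor products, Young -/

section Mixed

variable {n : ℕ}

/-- The mixed Lebesgue norm, with exponent `p` in the first and `q` in the second variable. -/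
def mixedNorm (p q : ℝ) (F : Rn n → Rn n → ℝ≥0∞) : ℝ≥0∞ :=
  (∫⁻ ξ : Rn n, (∫⁻ x : Rn n, F x ξ ^ p) ^ (q / p)) ^ (1 / q)

theorem modulationNorm_eq_mixedNorm (φ : 𝓢(Rn n, ℂ)) (p q : ℝ) (u : 𝓢'(Rn n, ℂ)) :
    modulationNorm φ p q u = mixedNorm p q fun x ξ => ‖stft φ u x ξ‖ₑ := rfl

theorem mixedNorm_eq (p q : ℝ) (F : Rn n → Rn n → ℝ≥0∞) :
    mixedNorm p q F = (∫⁻ ξ : Rn n, ((∫⁻ x : Rn n, F x ξ ^ p) ^ (1 / p)) ^ q) ^ (1 / q) := by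
  simp only [mixedNorm, ← ENNReal.rpow_mul]
  congr 2
  ext ξ
  congr 1
  ring

theorem mixedNorm_mono {p q : ℝ} (hp : 0 < p) (hq : 0 < q) {F G : Rn n → Rn n → ℝ≥0∞}
    (h : ∀ x ξ, F x ξ ≤ G x ξ) : mixedNorm p q F ≤ mixedNorm p q G := by
  unfold mixedNorm
  gcongr with ξ x
  exact h x ξ

theorem measurable_slice_rpow {F : Rn n → Rn n → ℝ≥0∞} (hF : Measurable (Function.uncurry F))
    (p r : ℝ) : Measurable fun ξ => (∫⁻ x : Rn n, F x ξ ^ p) ^ r :=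
  Measurable.pow_const (Measurable.lintegral_prod_left' (f := fun z : Rn n × Rn n => F z.1 z.2 ^ p)
    (hF.pow_const p)) _

theorem mixedNorm_const_mul {p q : ℝ} (hp : 0 < p) (hq : 0 < q) {F : Rn n → Rn n → ℝ≥0∞}
    (hF : Measurable (Function.uncurry F)) (c : ℝ≥0∞) :
    mixedNorm p q (fun x ξ => c * F x ξ) = c * mixedNorm p q F := by
  have hFy : ∀ y, Measurable fun x => F x y := fun y =>
    hF.comp (measurable_id.prodMk measurable_const)
  simp only [mixedNorm_eq, ENNReal.mul_rpow_of_nonneg _ _ hp.le]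
  have h1 : ∀ ξ, (∫⁻ x : Rn n, c ^ p * F x ξ ^ p) ^ (1 / p)
      = c * (∫⁻ x : Rn n, F x ξ ^ p) ^ (1 / p) := by
    intro ξ
    rw [lintegral_const_mul _ ((hFy ξ).pow_const _), ENNReal.mul_rpow_of_nonneg _ _ (by positivity),
      ← ENNReal.rpow_mul, mul_one_div_cancel hp.ne', ENNReal.rpow_one]
  simp only [h1, ENNReal.mul_rpow_of_nonneg _ _ hq.le]
  rw [lintegral_const_mul _ ((measurable_slice_rpow hF p (1 / p)).pow_const q),
    ENNReal.mul_rpow_of_nonneg _ _ (by positivity),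
    ← ENNReal.rpow_mul, mul_one_div_cancel hq.ne', ENNReal.rpow_one]

theorem mixedNorm_add_le {p q : ℝ} (hp : 1 ≤ p) (hq : 1 ≤ q) {F G : Rn n → Rn n → ℝ≥0∞}
    (hF : Measurable (Function.uncurry F)) (hG : Measurable (Function.uncurry G)) :
    mixedNorm p q (fun x ξ => F x ξ + G x ξ) ≤ mixedNorm p q F + mixedNorm p q G := by
  have hy : ∀ {F : Rn n → Rn n → ℝ≥0∞}, Measurable (Function.uncurry F) →
      ∀ y, Measurable fun x => F x y := fun hF y => hF.comp (measurable_id.prodMk measurable_const)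
  simp only [mixedNorm_eq]
  refine le_trans ?_ (ENNReal.lintegral_Lp_add_le (measurable_slice_rpow hF p (1 / p)).aemeasurable
    (measurable_slice_rpow hG p (1 / p)).aemeasurable hq)
  gcongr with ξ
  exact ENNReal.lintegral_Lp_add_le (hy hF ξ).aemeasurable (hy hG ξ).aemeasurable hp

theorem lintegral_lintegral_mul_le_mixedNorm {p q p' q' : ℝ} (hp : p.HolderConjugate p')
    (hq : q.HolderConjugate q') {F G : Rn n → Rn n → ℝ≥0∞}
    (hF : Measurable (Function.uncurry F)) (hG : Measurable (Function.uncurry G)) :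
    ∫⁻ ξ : Rn n, ∫⁻ x : Rn n, F x ξ * G x ξ ≤ mixedNorm p q F * mixedNorm p' q' G := by
  have hy : ∀ {F : Rn n → Rn n → ℝ≥0∞}, Measurable (Function.uncurry F) →
      ∀ y, Measurable fun x => F x y := fun hF y => hF.comp (measurable_id.prodMk measurable_const)
  simp only [mixedNorm_eq]
  refine le_trans ?_ (ENNReal.lintegral_mul_le_Lp_mul_Lq volume hq
    (measurable_slice_rpow hF p (1 / p)).aemeasurable
    (measurable_slice_rpow hG p' (1 / p')).aemeasurable)
  refine lintegral_mono fun ξ => ?_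
  exact ENNReal.lintegral_mul_le_Lp_mul_Lq volume hp (hy hF ξ).aemeasurable (hy hG ξ).aemeasurable

/-- The mixed norm of a tensor product. -/
theorem mixedNorm_tensor {p q : ℝ} (hp : 0 < p) (hq : 0 < q) {a b : Rn n → ℝ≥0∞}
    (ha : Measurable a) (hb : Measurable b) :
    mixedNorm p q (fun x ξ => a x * b ξ)
      = (∫⁻ x, a x ^ p) ^ (1 / p) * (∫⁻ ξ, b ξ ^ q) ^ (1 / q) := by
  simp only [mixedNorm_eq, ENNReal.mul_rpow_of_nonneg _ _ hp.le]
  have h1 : ∀ ξ, (∫⁻ x : Rn n, a x ^ p * b ξ ^ p) ^ (1 / p)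
      = (∫⁻ x : Rn n, a x ^ p) ^ (1 / p) * b ξ := by
    intro ξ
    rw [lintegral_mul_const _ (ha.pow_const _), ENNReal.mul_rpow_of_nonneg _ _ (by positivity),
      ← ENNReal.rpow_mul, mul_one_div_cancel hp.ne', ENNReal.rpow_one]
  simp only [h1, ENNReal.mul_rpow_of_nonneg _ _ hq.le]
  rw [lintegral_const_mul _ (hb.pow_const q),
    ENNReal.mul_rpow_of_nonneg _ _ (by positivity),
    ← ENNReal.rpow_mul, mul_one_div_cancel hq.ne', ENNReal.rpow_one]

/-- Young's inequality with a kernel in `L¹`. -/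
theorem lintegral_conv_rpow_le {q : ℝ} (hq : 1 < q) {G F : Rn n → ℝ≥0∞} (hG : Measurable G)
    (hF : Measurable F) :
    (∫⁻ ξ, (∫⁻ η, G (ξ - η) * F η) ^ q) ^ (1 / q) ≤ (∫⁻ ξ, G ξ) * (∫⁻ η, F η ^ q) ^ (1 / q) := by
  have hq0 : 0 < q := by linarith
  -- In this form the convolution is a superposition of translates of `F`, all of the same norm, and
  -- Minkowski's inequality finishes.
  have h1 : ∀ ξ, ∫⁻ η, G (ξ - η) * F η = ∫⁻ ζ, G ζ * F (ξ - ζ) := by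
    intro ξ
    rw [← lintegral_sub_left_eq_self (fun η => G (ξ - η) * F η) ξ]
    simp
  simp only [h1]
  refine (lintegral_lintegral_rpow_le hq (F := fun ξ ζ => G ζ * F (ξ - ζ)) ?_).trans ?_
  · exact (hG.comp measurable_snd).mul (hF.comp (measurable_fst.sub measurable_snd))
  · rw [← lintegral_mul_const _ hG]
    refine lintegral_mono fun ζ => le_of_eq ?_
    simp only [ENNReal.mul_rpow_of_nonneg _ _ hq0.le]
    rw [lintegral_const_mul _ (by fun_prop), ENNReal.mul_rpow_of_nonneg _ _ (by positivity),
      ← ENNReal.rpow_mul, mul_one_div_cancel hq0.ne', ENNReal.rpow_one,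
      lintegral_sub_right_eq_self (fun ξ => F ξ ^ q) ζ]

end Mixed

/-! ### Hardy–Littlewood–Sobolev for kernels with restricted bounds -/

section Kernel

/-- Shifting the index by `⌊x⌋` moves `x` into `[0, 1)`; replacing it by `0` costs at most the
factor `2^δ`, so the bound is uniform in `x`. This sums the off-diagonal decay between dyadic level
sets, and later between dyadic frequency scales. -/
theorem exists_tsum_two_rpow_le {δ : ℝ} (hδ : 0 < δ) :
    ∃ C : ℝ≥0∞, C ≠ ∞ ∧ ∀ x : ℝ, ∑' l : ℤ, (2 : ℝ≥0∞) ^ (-δ * |x - l|) ≤ C := by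
  have hs : Summable fun l : ℤ => (2 : ℝ) ^ (-δ * |(l : ℝ)|) := by
    have h0 : Summable fun m : ℕ => (2 : ℝ) ^ (-δ * (m : ℝ)) := by
      have : Summable fun m : ℕ => ((2 : ℝ) ^ (-δ)) ^ m :=
        summable_geometric_of_lt_one (by positivity)
          (Real.rpow_lt_one_of_one_lt_of_neg (by norm_num) (by linarith))
      refine this.congr fun m => ?_
      rw [← Real.rpow_natCast, ← Real.rpow_mul (by norm_num)]
    refine Summable.of_nat_of_neg ?_ ?_
    · simpa using h0
    · simpa using h0
  have hs' : ∑' l : ℤ, (2 : ℝ≥0∞) ^ (-δ * |(l : ℝ)|) ≠ ∞ := by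
    have := hs.tsum_ofReal_ne_top
    convert this using 3 with l
    rw [← ENNReal.ofReal_rpow_of_pos (by norm_num)]
    simp
  refine ⟨2 ^ δ * ∑' l : ℤ, (2 : ℝ≥0∞) ^ (-δ * |(l : ℝ)|),
    ENNReal.mul_ne_top (ENNReal.rpow_ne_top_of_nonneg hδ.le (by simp)) hs', fun x => ?_⟩
  rw [← ENNReal.tsum_mul_left, ← (Equiv.subLeft ⌊x⌋).tsum_eq]
  refine ENNReal.tsum_le_tsum fun l => ?_
  rw [← ENNReal.rpow_add _ _ (by norm_num) (by norm_num)]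
  refine ENNReal.rpow_le_rpow_of_exponent_le (by norm_num) ?_
  have h1 : (⌊x⌋ : ℝ) ≤ x := Int.floor_le x
  have h2 : x < ⌊x⌋ + 1 := Int.lt_floor_add_one x
  have h3 : |(l : ℝ)| ≤ |x - ((⌊x⌋ - l : ℤ) : ℝ)| + 1 := by
    push_cast
    have : (l : ℝ) = (x - (⌊x⌋ - l)) - (x - ⌊x⌋) := by ring
    calc |(l : ℝ)| = |(x - (⌊x⌋ - l)) - (x - ⌊x⌋)| := by rw [← this]
      _ ≤ |x - (⌊x⌋ - l)| + |x - ⌊x⌋| := abs_sub _ _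
      _ ≤ _ := by
        gcongr
        rw [abs_le]
        constructor <;> linarith
  simp only [Equiv.subLeft_apply]
  nlinarith

variable {X : Type*} [MeasurableSpace X] {μ : Measure X}

/-- The dyadic level set `{2^j ≤ f < 2^(j+1)}`. -/
def level {X : Type*} (f : X → ℝ≥0∞) (j : ℤ) : Set X :=
  {x | f x ∈ Set.Ico ((2 : ℝ≥0∞) ^ j) (2 ^ (j + 1))}

theorem measurableSet_level {f : X → ℝ≥0∞} (hf : Measurable f) (j : ℤ) :
    MeasurableSet (level f j) := hf measurableSet_Ico

theorem le_tsum_level {X : Type*} {f : X → ℝ≥0∞} {x : X} (hx : f x ≠ ∞) :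
    f x ≤ ∑' j : ℤ, (level f j).indicator (fun _ => (2 : ℝ≥0∞) ^ (j + 1)) x := by
  by_cases h0 : f x = 0
  · simp [h0]
  obtain ⟨j, hj⟩ := ENNReal.exists_mem_Ico_zpow h0 hx (y := 2) (by norm_num) (by norm_num)
  refine le_trans ?_ (ENNReal.le_tsum j)
  have : x ∈ level f j := hj
  simp [this, hj.2.le]

/-- The level sets are disjoint, so at most one term of the series is nonzero. -/
theorem tsum_level_le {X : Type*} {f : X → ℝ≥0∞} (p : ℝ) (hp : 0 < p) (x : X) :
    ∑' j : ℤ, (level f j).indicator (fun _ => (2 : ℝ≥0∞) ^ ((j : ℝ) * p)) x ≤ f x ^ p := by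
  by_cases h : ∃ j, x ∈ level f j
  · obtain ⟨j, hj⟩ := h
    rw [tsum_eq_single j]
    · simp only [hj, Set.indicator_of_mem]
      rw [ENNReal.rpow_mul, ENNReal.rpow_intCast]
      exact ENNReal.rpow_le_rpow hj.1 hp.le
    · intro i hi
      refine Set.indicator_of_notMem (fun hx => hi ?_) _
      have h1 : (2 : ℝ≥0∞) ^ i < 2 ^ (j + 1) := hx.1.trans_lt hj.2
      have h2 : (2 : ℝ≥0∞) ^ j < 2 ^ (i + 1) := hj.1.trans_lt hx.2
      have key : ∀ a b : ℤ, (2 : ℝ≥0∞) ^ a < 2 ^ b → a < b := fun a b hab => by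
        by_contra hcon
        exact absurd (ENNReal.zpow_le_of_le (by norm_num) (not_lt.1 hcon)) (not_le.2 hab)
      have := key _ _ h1
      have := key _ _ h2
      omega
  · push Not at h
    simp [Set.indicator_of_notMem (h _)]

theorem tsum_measure_level_le {f : X → ℝ≥0∞} (hf : Measurable f) {p : ℝ} (hp : 0 < p) :
    ∑' j : ℤ, (2 : ℝ≥0∞) ^ ((j : ℝ) * p) * μ (level f j) ≤ ∫⁻ x, f x ^ p ∂μ := by
  calc ∑' j : ℤ, (2 : ℝ≥0∞) ^ ((j : ℝ) * p) * μ (level f j)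
      = ∑' j : ℤ, ∫⁻ x, (level f j).indicator (fun _ => (2 : ℝ≥0∞) ^ ((j : ℝ) * p)) x ∂μ := by
        congr with j
        rw [lintegral_indicator (measurableSet_level hf j), setLIntegral_const]
    _ = ∫⁻ x, ∑' j : ℤ, (level f j).indicator (fun _ => (2 : ℝ≥0∞) ^ ((j : ℝ) * p)) x ∂μ := by
        rw [lintegral_tsum]
        exact fun j => (measurable_const.indicator (measurableSet_level hf j)).aemeasurable
    _ ≤ _ := lintegral_mono fun x => tsum_level_le p hp x

/-- The exponent bookkeeping behind the bilinear estimate on a pair of dyadic level sets. -/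
theorem two_rpow_mul_le {p r θ : ℝ} (hp : 1 < p) (hr : 1 < r)
    (hθ : θ = 1 / p + 1 / r - 1) (hθ0 : 0 < θ) (j l : ℤ) {A B D K : ℝ≥0∞}
    (hA : (2 : ℝ≥0∞) ^ ((j : ℝ) * p) * A ≤ 1) (hB : (2 : ℝ≥0∞) ^ ((l : ℝ) * r) * B ≤ 1)
    (h1 : K ≤ D * (A * B ^ θ)) (h2 : K ≤ D * (B * A ^ θ)) :
    (2 : ℝ≥0∞) ^ ((j : ℝ) + l) * K ≤ D *
      ((2 : ℝ≥0∞) ^ ((j : ℝ) * p) * A + (2 : ℝ≥0∞) ^ ((l : ℝ) * r) * B) *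
        2 ^ (-(min (1 - 1 / p) (1 - 1 / r)) * |(j : ℝ) * p - l * r|) := by
  -- The hypotheses are symmetric under exchanging `(p, j, A)` with `(r, l, B)`, so one ordering of
  -- `j p` and `l r` suffices.
  have key : ∀ {p r : ℝ} (_ : 1 < p) (_ : 1 < r) (_ : θ = 1 / p + 1 / r - 1) (j l : ℤ)
      {A B : ℝ≥0∞} (_ : (2 : ℝ≥0∞) ^ ((l : ℝ) * r) * B ≤ 1) (_ : K ≤ D * (A * B ^ θ))
      (_ : (l : ℝ) * r ≤ j * p),
      (2 : ℝ≥0∞) ^ ((j : ℝ) + l) * K ≤ D * ((2 : ℝ≥0∞) ^ ((j : ℝ) * p) * A) *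
        2 ^ (-(1 - 1 / p) * |(j : ℝ) * p - l * r|) := by
    intro p r hp hr hθ j l A B hB h1 hlj
    have hp0 : 0 < p := by linarith
    have hr0 : 0 < r := by linarith
    have hBθ : (2 : ℝ≥0∞) ^ ((l : ℝ) * r * θ) * B ^ θ ≤ 1 := by
      rw [ENNReal.rpow_mul, ← ENNReal.mul_rpow_of_nonneg _ _ hθ0.le]
      exact ENNReal.rpow_le_one hB hθ0.le
    -- This splitting of the exponent isolates `2^(j p) A`, the factor `(2^(l r) B)^θ ≤ 1` to be
    -- discarded, and a gain in the distance `j p - l r` which makes the double series converge.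
    have hexp : (j : ℝ) + l = j * p + (l : ℝ) * r * θ + (-(1 - 1 / p) * |(j : ℝ) * p - l * r|) := by
      rw [abs_of_nonneg (by linarith), hθ]
      field_simp
      ring
    calc (2 : ℝ≥0∞) ^ ((j : ℝ) + l) * K ≤ (2 : ℝ≥0∞) ^ ((j : ℝ) + l) * (D * (A * B ^ θ)) := by gcongr
      _ = D * ((2 : ℝ≥0∞) ^ ((j : ℝ) * p) * A) * 2 ^ (-(1 - 1 / p) * |(j : ℝ) * p - l * r|) *
          ((2 : ℝ≥0∞) ^ ((l : ℝ) * r * θ) * B ^ θ) := by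
        rw [hexp, ENNReal.rpow_add _ _ (by norm_num) (by norm_num),
          ENNReal.rpow_add _ _ (by norm_num) (by norm_num)]
        ring
      _ ≤ _ := mul_le_of_le_one_right' hBθ
  rcases le_total ((l : ℝ) * r) (j * p) with h | h
  · refine (key hp hr hθ j l hB h1 h).trans ?_
    gcongr
    · exact le_self_add
    · norm_num
    · exact min_le_left _ _
  · have := key hr hp (by rw [hθ]; ring) l j hA h2 h
    rw [add_comm (l : ℝ), abs_sub_comm] at this
    refine this.trans ?_
    gcongr
    · exact le_add_self
    · norm_num
    · exact min_le_right _ _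

variable [SFinite μ]

/-- Normalised bilinear Hardy–Littlewood–Sobolev estimate for a kernel which satisfies the
restricted bounds `∫_B K(x, y) dy ≤ D μ(B)^θ` and `∫_A K(x, y) dx ≤ D μ(A)^θ`. -/
theorem exists_bilinear_le {p r θ : ℝ} (hp : 1 < p) (hr : 1 < r)
    (hθ : θ = 1 / p + 1 / r - 1) (hθ0 : 0 < θ) {K : X → X → ℝ≥0∞}
    (hK : Measurable (Function.uncurry K)) {D : ℝ≥0∞} (hD : D ≠ ∞)
    (h1 : ∀ x B, MeasurableSet B → ∫⁻ y in B, K x y ∂μ ≤ D * μ B ^ θ)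
    (h2 : ∀ y A, MeasurableSet A → ∫⁻ x in A, K x y ∂μ ≤ D * μ A ^ θ) :
    ∃ C : ℝ≥0∞, C ≠ ∞ ∧ ∀ f g : X → ℝ≥0∞, Measurable f → Measurable g →
      ∫⁻ y, f y ^ p ∂μ ≤ 1 → ∫⁻ x, g x ^ r ∂μ ≤ 1 →
      ∫⁻ x, (∫⁻ y, K x y * f y ∂μ) * g x ∂μ ≤ C := by
  have hp0 : 0 < p := by linarith
  have hr0 : 0 < r := by linarith
  set δ := min (1 - 1 / p) (1 - 1 / r) with hδ
  have hδ0 : 0 < δ := by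
    rw [hδ, lt_min_iff, sub_pos, sub_pos, div_lt_one hp0, div_lt_one hr0]
    exact ⟨hp, hr⟩
  -- The rate is `δ r` because `|j p - l r| = r |j p / r - l|`: for fixed `j` the sum over `l` is
  -- taken around the real point `j p / r`. The sum over `j` is treated in the same way, with rate
  -- `δ p`.
  obtain ⟨C1, hC1, hs1⟩ := exists_tsum_two_rpow_le (mul_pos hδ0 hr0)
  obtain ⟨C2, hC2, hs2⟩ := exists_tsum_two_rpow_le (mul_pos hδ0 hp0)
  refine ⟨4 * D * (C1 + C2), by finiteness, fun f g hf hg hf1 hg1 => ?_⟩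
  set A := level f
  set B := level g
  have hAm : ∀ j, MeasurableSet (A j) := measurableSet_level hf
  have hBm : ∀ j, MeasurableSet (B j) := measurableSet_level hg
  have hA := (tsum_measure_level_le (μ := μ) hf hp0).trans hf1
  have hB := (tsum_measure_level_le (μ := μ) hg hr0).trans hg1
  have hftop : ∀ᵐ y ∂μ, f y ≠ ∞ := by
    have := ae_lt_top (hf.pow_const p) (hf1.trans_lt ENNReal.one_lt_top).ne
    filter_upwards [this] with y hy hy'
    simp [hy', hp0] at hy
  have hgtop : ∀ᵐ y ∂μ, g y ≠ ∞ := by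
    have := ae_lt_top (hg.pow_const r) (hg1.trans_lt ENNReal.one_lt_top).ne
    filter_upwards [this] with y hy hy'
    simp [hy', hr0] at hy
  set k : ℤ → ℤ → ℝ≥0∞ := fun j l => ∫⁻ x in B l, ∫⁻ y in A j, K x y ∂μ ∂μ with hk
  have hKx : ∀ x, Measurable (K x) := fun x => hK.comp (measurable_const.prodMk measurable_id)
  have hk1 : ∀ j l, k j l ≤ D * (μ (B l) * μ (A j) ^ θ) := fun j l => by
    calc k j l ≤ ∫⁻ x in B l, D * μ (A j) ^ θ ∂μ := by
          refine lintegral_mono fun x => h1 x _ (hAm j)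
      _ = _ := by rw [setLIntegral_const]; ring
  have hk2 : ∀ j l, k j l ≤ D * (μ (A j) * μ (B l) ^ θ) := fun j l => by
    calc k j l = ∫⁻ y in A j, ∫⁻ x in B l, K x y ∂μ ∂μ :=
          lintegral_lintegral_swap hK.aemeasurable
      _ ≤ ∫⁻ y in A j, D * μ (B l) ^ θ ∂μ := by
          refine lintegral_mono fun y => h2 y _ (hBm l)
      _ = _ := by rw [setLIntegral_const]; ring
  have hinner : ∀ x, ∫⁻ y, K x y * f y ∂μ ≤
      ∑' j : ℤ, (2 : ℝ≥0∞) ^ (j + 1) * ∫⁻ y in A j, K x y ∂μ := by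
    intro x
    calc ∫⁻ y, K x y * f y ∂μ
        ≤ ∫⁻ y, ∑' j : ℤ, (2 : ℝ≥0∞) ^ (j + 1) * (A j).indicator (K x) y ∂μ := by
          refine lintegral_mono_ae ?_
          filter_upwards [hftop] with y hy
          calc K x y * f y ≤ K x y * ∑' j : ℤ, (A j).indicator (fun _ => (2 : ℝ≥0∞) ^ (j + 1)) y :=
                mul_le_mul' le_rfl (le_tsum_level hy)
            _ = _ := by
              rw [← ENNReal.tsum_mul_left]
              congr with j
              by_cases hyj : y ∈ A j
              · simp [A, hyj, mul_comm]
              · simp [A, hyj]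
      _ = _ := by
          have hm : ∀ j : ℤ, Measurable fun y => (2 : ℝ≥0∞) ^ (j + 1) * (A j).indicator (K x) y :=
            fun j => measurable_const.mul ((hKx x).indicator (hAm j))
          rw [lintegral_tsum fun j => (hm j).aemeasurable]
          congr with j
          rw [lintegral_const_mul _ ((hKx x).indicator (hAm j)), lintegral_indicator (hAm j)]
  have hKA : ∀ j, Measurable fun x => ∫⁻ y in A j, K x y ∂μ := fun j => hK.lintegral_prod_right'
  have houter : ∫⁻ x, (∫⁻ y, K x y * f y ∂μ) * g x ∂μ ≤
      ∑' l : ℤ, ∑' j : ℤ, (2 : ℝ≥0∞) ^ (l + 1) * (2 ^ (j + 1) * k j l) := by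
    calc ∫⁻ x, (∫⁻ y, K x y * f y ∂μ) * g x ∂μ
        ≤ ∫⁻ x, ∑' l : ℤ, ∑' j : ℤ, (2 : ℝ≥0∞) ^ (l + 1) * (2 ^ (j + 1) *
            (B l).indicator (fun x => ∫⁻ y in A j, K x y ∂μ) x) ∂μ := by
          refine lintegral_mono_ae ?_
          filter_upwards [hgtop] with x hx
          calc (∫⁻ y, K x y * f y ∂μ) * g x ≤ _ * _ :=
                mul_le_mul' (hinner x) (le_tsum_level hx)
            _ = _ := by
              rw [← ENNReal.tsum_mul_left]
              congr with l
              rw [← ENNReal.tsum_mul_right]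
              congr with j
              by_cases hxl : x ∈ B l
              · simp only [B] at hxl ⊢
                simp only [hxl, Set.indicator_of_mem]
                ring
              · simp only [B] at hxl ⊢
                simp [hxl]
      _ = _ := by
          have hm : ∀ l j : ℤ, Measurable fun x => (2 : ℝ≥0∞) ^ (l + 1) * (2 ^ (j + 1) *
            (B l).indicator (fun x => ∫⁻ y in A j, K x y ∂μ) x) := fun l j =>
              measurable_const.mul (measurable_const.mul ((hKA j).indicator (hBm l)))
          rw [lintegral_tsum fun l => (Measurable.tsum (hm l)).aemeasurable]
          congr with l
          rw [lintegral_tsum fun j => (hm l j).aemeasurable]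
          congr with j
          have hm' : Measurable fun x => (2 : ℝ≥0∞) ^ (j + 1) *
            (B l).indicator (fun x => ∫⁻ y in A j, K x y ∂μ) x :=
              measurable_const.mul ((hKA j).indicator (hBm l))
          rw [lintegral_const_mul _ hm', lintegral_const_mul _ ((hKA j).indicator (hBm l)),
            lintegral_indicator (hBm l)]
  set a : ℤ → ℝ≥0∞ := fun j => (2 : ℝ≥0∞) ^ ((j : ℝ) * p) * μ (A j)
  set b : ℤ → ℝ≥0∞ := fun l => (2 : ℝ≥0∞) ^ ((l : ℝ) * r) * μ (B l)
  have hterm : ∀ l j : ℤ, (2 : ℝ≥0∞) ^ (l + 1) * (2 ^ (j + 1) * k j l) ≤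
      4 * D * (a j * 2 ^ (-(δ * r) * |(j : ℝ) * p / r - l|) +
        b l * 2 ^ (-(δ * p) * |(l : ℝ) * r / p - j|)) := by
    intro l j
    have h := two_rpow_mul_le hp hr hθ hθ0 j l ((ENNReal.le_tsum j).trans hA)
      ((ENNReal.le_tsum l).trans hB) (hk2 j l) (hk1 j l)
    have e1 : -(δ * r) * |(j : ℝ) * p / r - l| = -δ * |(j : ℝ) * p - l * r| := by
      have : (j : ℝ) * p - l * r = r * ((j : ℝ) * p / r - l) := by field_simp
      rw [this, abs_mul, abs_of_pos hr0]; ring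
    have e2 : -(δ * p) * |(l : ℝ) * r / p - j| = -δ * |(j : ℝ) * p - l * r| := by
      have : (j : ℝ) * p - l * r = p * -((l : ℝ) * r / p - j) := by field_simp; ring
      rw [this, abs_mul, abs_of_pos hp0, abs_neg]; ring
    have e3 : (2 : ℝ≥0∞) ^ (l + 1) * (2 ^ (j + 1) * k j l)
        = 4 * ((2 : ℝ≥0∞) ^ ((j : ℝ) + l) * k j l) := by
      have h4 : (4 : ℝ≥0∞) = 2 ^ (2 : ℝ) := by norm_num
      rw [← mul_assoc, ← mul_assoc, ← ENNReal.rpow_intCast, ← ENNReal.rpow_intCast, h4,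
        ← ENNReal.rpow_add _ _ (by norm_num) (by norm_num),
        ← ENNReal.rpow_add _ _ (by norm_num) (by norm_num)]
      congr 2
      push_cast
      ring
    rw [e1, e2, e3, ← add_mul]
    calc 4 * ((2 : ℝ≥0∞) ^ ((j : ℝ) + l) * k j l)
        ≤ 4 * (D * (a j + b l) * 2 ^ (-δ * |(j : ℝ) * p - l * r|)) := mul_le_mul' le_rfl h
      _ = _ := by ring
  calc ∫⁻ x, (∫⁻ y, K x y * f y ∂μ) * g x ∂μ
      ≤ ∑' l : ℤ, ∑' j : ℤ, 4 * D * (a j * 2 ^ (-(δ * r) * |(j : ℝ) * p / r - l|) +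
        b l * 2 ^ (-(δ * p) * |(l : ℝ) * r / p - j|)) :=
        houter.trans (ENNReal.tsum_le_tsum fun l => ENNReal.tsum_le_tsum fun j => hterm l j)
    _ = 4 * D * ((∑' j : ℤ, a j * ∑' l : ℤ, 2 ^ (-(δ * r) * |(j : ℝ) * p / r - l|)) +
        ∑' l : ℤ, b l * ∑' j : ℤ, 2 ^ (-(δ * p) * |(l : ℝ) * r / p - j|)) := by
        simp only [ENNReal.tsum_mul_left, ENNReal.tsum_add]
        rw [ENNReal.tsum_comm]
        simp only [ENNReal.tsum_mul_left]
    _ ≤ 4 * D * ((∑' j : ℤ, a j * C1) + ∑' l : ℤ, b l * C2) := by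
        gcongr with j l
        · exact hs1 _
        · exact hs2 _
    _ = 4 * D * ((∑' j : ℤ, a j) * C1 + (∑' l : ℤ, b l) * C2) := by
        simp only [ENNReal.tsum_mul_right]
    _ ≤ 4 * D * (1 * C1 + 1 * C2) := by gcongr
    _ = _ := by simp

/-- Hardy–Littlewood–Sobolev inequality for a kernel satisfying restricted bounds. -/
theorem exists_lintegral_kernel_rpow_le [SigmaFinite μ] {p q θ : ℝ} (hp : 1 < p) (hq : 1 < q)
    (hθ : θ = 1 / p - 1 / q) (hθ0 : 0 < θ) {K : X → X → ℝ≥0∞}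
    (hK : Measurable (Function.uncurry K)) {D : ℝ≥0∞} (hD : D ≠ ∞)
    (h1 : ∀ x B, MeasurableSet B → ∫⁻ y in B, K x y ∂μ ≤ D * μ B ^ θ)
    (h2 : ∀ y A, MeasurableSet A → ∫⁻ x in A, K x y ∂μ ≤ D * μ A ^ θ) :
    ∃ C : ℝ≥0∞, C ≠ ∞ ∧ ∀ f : X → ℝ≥0∞, Measurable f →
      (∫⁻ x, (∫⁻ y, K x y * f y ∂μ) ^ q ∂μ) ^ (1 / q) ≤ C * (∫⁻ y, f y ^ p ∂μ) ^ (1 / p) := by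
  have hp0 : 0 < p := by linarith
  have hqr := Real.HolderConjugate.conjExponent hq
  set r := q.conjExponent with hr
  have hr0 : 0 < r := hqr.symm.pos
  have hr1 : 1 < r := hqr.symm.lt
  -- With `r` conjugate to `q`, the exponent of the bilinear estimate is the one of the operator
  -- estimate.
  have hθ' : θ = 1 / p + 1 / r - 1 := by
    have := hqr.inv_add_inv_eq_one
    simp only [one_div] at *
    linarith
  obtain ⟨C, hC, hbil⟩ := exists_bilinear_le hp hr1 hθ' hθ0 hK hD h1 h2
  -- normalisation of a function with finite nonzero norm
  have hnorm : ∀ (s : ℝ) (_ : 0 < s) (f : X → ℝ≥0∞) (_ : Measurable f)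
      (_ : (∫⁻ y, f y ^ s ∂μ) ≠ 0) (_ : (∫⁻ y, f y ^ s ∂μ) ≠ ∞),
      ∫⁻ y, (((∫⁻ y, f y ^ s ∂μ) ^ (1 / s))⁻¹ * f y) ^ s ∂μ ≤ 1 := by
    intro s hs f hf h0 ht
    simp only [ENNReal.mul_rpow_of_nonneg _ _ hs.le]
    rw [lintegral_const_mul _ (hf.pow_const s), ENNReal.inv_rpow, ← ENNReal.rpow_mul,
      one_div_mul_cancel hs.ne', ENNReal.rpow_one, ENNReal.inv_mul_cancel h0 ht]
  have hnz : ∀ (s : ℝ) (_ : 0 < s) (f : X → ℝ≥0∞) (_ : Measurable f)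
      (_ : (∫⁻ y, f y ^ s ∂μ) = 0), f =ᵐ[μ] 0 := by
    intro s hs f hf h0
    rw [lintegral_eq_zero_iff (hf.pow_const s)] at h0
    filter_upwards [h0] with y hy
    simpa [hs.not_gt, hs, ENNReal.rpow_eq_zero_iff] using hy
  -- Adding `1` makes the constant nonzero, so that the right side is indeed `∞` when the test
  -- function has infinite norm.
  refine ⟨C + 1, by finiteness, fun f hf => ?_⟩
  set N := (∫⁻ y, f y ^ p ∂μ) with hN
  have hKf : Measurable fun z : X × X => K z.1 z.2 * f z.2 := hK.mul (hf.comp measurable_snd)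
  by_cases hN0 : N = 0
  · have : ∀ x, ∫⁻ y, K x y * f y ∂μ = 0 := fun x => by
      rw [lintegral_congr_ae (g := fun _ => 0) ?_, lintegral_zero]
      filter_upwards [hnz p hp0 f hf hN0] with y hy
      simp [hy]
    simp [this, show 0 < q by linarith]
  by_cases hNt : N = ∞
  · simp [hNt, hp0]
  refine lintegral_rpow_le_of_forall_lintegral_mul_le hqr hKf.lintegral_prod_right' fun g hg => ?_
  set M := (∫⁻ x, g x ^ r ∂μ) with hM
  have hN1 : N ^ (1 / p) ≠ 0 := by simp [ENNReal.rpow_eq_zero_iff, hN0, hNt]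
  have hN2 : N ^ (1 / p) ≠ ∞ := ENNReal.rpow_ne_top_of_nonneg (by positivity) hNt
  by_cases hM0 : M = 0
  · rw [lintegral_congr_ae (g := fun _ => 0) ?_, lintegral_zero]
    · simp
    filter_upwards [hnz r hr0 g hg hM0] with y hy
    simp [hy]
  by_cases hMt : M = ∞
  · rw [hMt, ENNReal.top_rpow_of_pos (by positivity), ENNReal.mul_top (mul_ne_zero (by simp) hN1)]
    exact le_top
  have hM1 : M ^ (1 / r) ≠ 0 := by simp [ENNReal.rpow_eq_zero_iff, hM0, hMt]
  have hM2 : M ^ (1 / r) ≠ ∞ := ENNReal.rpow_ne_top_of_nonneg (by positivity) hMt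
  have h := hbil _ _ (hf.const_mul (N ^ (1 / p))⁻¹) (hg.const_mul (M ^ (1 / r))⁻¹)
    (hnorm p hp0 f hf hN0 hNt) (hnorm r hr0 g hg hM0 hMt)
  have hH : Measurable fun x => (∫⁻ y, K x y * f y ∂μ) := hKf.lintegral_prod_right'
  have hpull : ∫⁻ x, (∫⁻ y, K x y * ((N ^ (1 / p))⁻¹ * f y) ∂μ) * ((M ^ (1 / r))⁻¹ * g x) ∂μ
      = (N ^ (1 / p))⁻¹ * (M ^ (1 / r))⁻¹ * ∫⁻ x, (∫⁻ y, K x y * f y ∂μ) * g x ∂μ := by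
    have hHg : Measurable fun x => (∫⁻ y, K x y * f y ∂μ) * g x := hH.mul hg
    rw [← lintegral_const_mul _ hHg]
    congr with x
    have : ∫⁻ y, K x y * ((N ^ (1 / p))⁻¹ * f y) ∂μ = (N ^ (1 / p))⁻¹ * ∫⁻ y, K x y * f y ∂μ := by
      have hx : Measurable fun y => K x y * f y := hKf.comp (measurable_const.prodMk measurable_id)
      rw [← lintegral_const_mul _ hx]
      congr with y
      ring
    rw [this]
    ring
  rw [hpull] at h
  calc ∫⁻ x, (∫⁻ y, K x y * f y ∂μ) * g x ∂μ
      = N ^ (1 / p) * M ^ (1 / r) * ((N ^ (1 / p))⁻¹ * (M ^ (1 / r))⁻¹ *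
        ∫⁻ x, (∫⁻ y, K x y * f y ∂μ) * g x ∂μ) := by
        calc _ = (N ^ (1 / p) * (N ^ (1 / p))⁻¹) * (M ^ (1 / r) * (M ^ (1 / r))⁻¹) *
              ∫⁻ x, (∫⁻ y, K x y * f y ∂μ) * g x ∂μ := by
                rw [ENNReal.mul_inv_cancel hN1 hN2, ENNReal.mul_inv_cancel hM1 hM2, one_mul, one_mul]
          _ = _ := by ring
    _ ≤ N ^ (1 / p) * M ^ (1 / r) * C := by gcongr
    _ = C * N ^ (1 / p) * M ^ (1 / r) := by ring
    _ ≤ _ := by gcongr; exact le_self_add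

end Kernel

/-! ### Polynomial weights: Hardy–Littlewood–Sobolev in space, a weighted Young inequality in
frequency -/

section Weights

variable {n : ℕ}

theorem lintegral_comp_smul {f : Rn n → ℝ≥0∞} (hf : Measurable f) {r : ℝ} (hr : 0 < r) :
    ∫⁻ x, f (r • x) = ENNReal.ofReal (r ^ (-(n : ℝ))) * ∫⁻ x, f x := by
  have h := Measure.map_addHaar_smul (volume : Measure (Rn n)) hr.ne'
  rw [← lintegral_map hf (measurable_const_smul r), h, lintegral_smul_measure, smul_eq_mul]
  congr 2
  rw [finrank_euclideanSpace, Fintype.card_fin, abs_of_pos (by positivity), Real.rpow_neg hr.le,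
    Real.rpow_natCast]

/-- The weight `(1 + ‖x‖)^(-r)` with values in `ℝ≥0∞`. -/
def wt (r : ℝ) (x : Rn n) : ℝ≥0∞ := ENNReal.ofReal ((1 + ‖x‖) ^ (-r))

@[fun_prop]
theorem measurable_wt (r : ℝ) : Measurable (wt (n := n) r) := by
  unfold wt; fun_prop

theorem wt_rpow (r : ℝ) {s : ℝ} (hs : 0 ≤ s) (x : Rn n) : wt r x ^ s = wt (r * s) x := by
  rw [wt, wt, ENNReal.ofReal_rpow_of_nonneg (by positivity) hs, ← Real.rpow_mul (by positivity)]
  ring_nf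

theorem lintegral_wt_ne_top {r : ℝ} (hr : n < r) : ∫⁻ x : Rn n, wt r x ≠ ∞ := by
  refine (finite_integral_one_add_norm (E := Rn n) (r := r) ?_).ne
  simpa using hr

theorem lintegral_wt_rpow_ne_top {r s : ℝ} (hs : 0 ≤ s) (hr : n < r * s) :
    ∫⁻ x : Rn n, wt r x ^ s ≠ ∞ := by
  simp only [wt_rpow r hs]
  exact lintegral_wt_ne_top hr

theorem wt_anti {r s : ℝ} (h : r ≤ s) (x : Rn n) : wt s x ≤ wt r x := by
  refine ENNReal.ofReal_le_ofReal (Real.rpow_le_rpow_of_exponent_le ?_ (by linarith))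
  linarith [norm_nonneg x]

theorem wt_le_one {r : ℝ} (h : 0 ≤ r) (x : Rn n) : wt r x ≤ 1 := by
  refine (wt_anti h x).trans (by simp [wt])

theorem wt_neg (r : ℝ) (x : Rn n) : wt r (-x) = wt r x := by simp [wt]

theorem wt_sub_comm (r : ℝ) (x y : Rn n) : wt r (x - y) = wt r (y - x) := by
  rw [← wt_neg, neg_sub]

theorem integrableOn_norm_rpow_ball {a : ℝ} (ha : 0 ≤ a) (han : a < n) (R : ℝ) :
    IntegrableOn (fun x : Rn n => ‖x‖ ^ (-a)) (Metric.ball 0 R) := by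
  have hn : 0 < n := by
    have : (0 : ℝ) < n := ha.trans_lt han
    exact_mod_cast this
  have : Nontrivial (Rn n) := by
    refine Module.nontrivial_of_finrank_pos (R := ℝ) ?_
    simpa using hn
  rw [integrableOn_fun_norm_addHaar volume (f := fun y : ℝ => y ^ (-a))]
  have h1 : IntegrableOn (fun y : ℝ => y ^ ((n : ℝ) - 1 - a)) (Set.Ioo 0 R) := by
    rcases le_or_gt R 0 with hR | hR
    · simp [Set.Ioo_eq_empty (not_lt.2 hR)]
    · rw [intervalIntegral.integrableOn_Ioo_rpow_iff hR]
      linarith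
  refine h1.congr_fun (fun y hy => ?_) measurableSet_Ioo
  simp only [finrank_euclideanSpace, Fintype.card_fin, smul_eq_mul]
  rw [← Real.rpow_natCast, ← Real.rpow_add hy.1, Nat.cast_sub hn]
  push_cast
  ring_nf

/-- Inside the unit ball the singularity `‖x‖^(-a)` is integrable since `a < n`; outside, `‖x‖ ≥ (1
+ ‖x‖) / 2` reduces to a weight of order `a + K > n` at the cost of `2^a`. -/
theorem integrable_norm_rpow_mul {a K : ℝ} (ha : 0 ≤ a) (han : a < n) (haK : n < a + K) :
    Integrable (fun x : Rn n => ‖x‖ ^ (-a) * (1 + ‖x‖) ^ (-K)) := by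
  rw [← integrableOn_univ, ← Set.union_compl_self (Metric.ball (0 : Rn n) 1)]
  have hm : AEStronglyMeasurable (fun x : Rn n => ‖x‖ ^ (-a) * (1 + ‖x‖) ^ (-K)) volume :=
    (Measurable.mul (by fun_prop) (by fun_prop)).aestronglyMeasurable
  refine IntegrableOn.union ?_ ?_
  · refine (integrableOn_norm_rpow_ball ha han 1).mono' hm.restrict ?_
    refine Filter.Eventually.of_forall fun x => ?_
    rw [Real.norm_of_nonneg (by positivity)]
    refine mul_le_of_le_one_right (by positivity) ?_
    exact Real.rpow_le_one_of_one_le_of_nonpos (by linarith [norm_nonneg x]) (by linarith)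
  · have h1 : Integrable (fun x : Rn n => (2 : ℝ) ^ a * (1 + ‖x‖) ^ (-(a + K))) :=
      (integrable_one_add_norm (by simpa using haK)).const_mul _
    refine h1.integrableOn.mono' hm.restrict ?_
    refine ae_restrict_of_forall_mem measurableSet_ball.compl fun x hx => ?_
    have hx1 : 1 ≤ ‖x‖ := by simpa using hx
    rw [Real.norm_of_nonneg (by positivity), neg_add, Real.rpow_add (by positivity), ← mul_assoc]
    gcongr
    rw [Real.rpow_neg (by positivity), Real.rpow_neg (by positivity), ← div_eq_mul_inv,
      inv_eq_one_div, div_le_div_iff₀ (by positivity) (by positivity), one_mul,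
      ← Real.mul_rpow (by norm_num) (by positivity)]
    gcongr
    linarith

/-- Restricted bound for the kernel `(1 + ‖x - y‖)^(-n(1-θ))`. -/
theorem exists_setLIntegral_wt_le (hn : 0 < n) {θ : ℝ} (hθ0 : 0 < θ) (hθ1 : θ ≤ 1) :
    ∃ D : ℝ≥0∞, D ≠ ∞ ∧ ∀ (x : Rn n) (B : Set (Rn n)), MeasurableSet B →
      ∫⁻ y in B, wt (n * (1 - θ)) (x - y) ≤ D * volume B ^ θ := by
  have hn' : (0 : ℝ) < n := by exact_mod_cast hn
  set lam := n * (1 - θ) with hlam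
  have hlam0 : 0 ≤ lam := mul_nonneg hn'.le (by linarith)
  set h : ℝ → Rn n → ℝ≥0∞ := fun R => (Metric.ball 0 R).indicator
    fun z => ENNReal.ofReal (‖z‖ ^ (-lam)) with hh
  have hhm : ∀ R, Measurable (h R) := fun R =>
    Measurable.indicator (by fun_prop) measurableSet_ball
  have hfin : ∫⁻ z, h 1 z ≠ ∞ := by
    rw [hh, lintegral_indicator measurableSet_ball]
    exact (integrableOn_norm_rpow_ball hlam0 (by rw [hlam]; nlinarith) 1).lintegral_lt_top.ne
  -- The integral is the contribution of the points within distance `R` of `x`, the `1` that of the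
  -- remaining points of `B`.
  refine ⟨(∫⁻ z, h 1 z) + 1, by finiteness, fun x B hB => ?_⟩
  by_cases hV0 : volume B = 0
  · rw [Measure.restrict_eq_zero.2 hV0]
    simp
  by_cases hVt : volume B = ∞
  · simp [hVt, hθ0, ENNReal.mul_top]
  set V := (volume B).toReal with hV
  have hVpos : 0 < V := ENNReal.toReal_pos hV0 hVt
  have hVe : volume B = ENNReal.ofReal V := (ENNReal.ofReal_toReal hVt).symm
  -- The radius balancing the two contributions: the near part scales like `R^(n-lam)`, the far part
  -- is at most `R^(-lam) V`, and both equal `V^θ` up to constants when `R^n = V`.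
  set R := V ^ (1 / (n : ℝ)) with hR
  have hRpos : 0 < R := by positivity
  have hscale : ∫⁻ z, h R z = ENNReal.ofReal (R ^ ((n : ℝ) - lam)) * ∫⁻ z, h 1 z := by
    have h1 := lintegral_comp_smul (hhm R) hRpos
    have h2 : ∀ z, h R (R • z) = ENNReal.ofReal (R ^ (-lam)) * h 1 z := by
      intro z
      have : R • z ∈ Metric.ball (0 : Rn n) R ↔ z ∈ Metric.ball (0 : Rn n) 1 := by
        simp only [mem_ball_zero_iff, norm_smul, Real.norm_of_nonneg hRpos.le]
        constructor
        · intro h; nlinarith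
        · intro h; nlinarith
      by_cases hz : z ∈ Metric.ball (0 : Rn n) 1
      · simp only [hh, Set.indicator_of_mem hz, Set.indicator_of_mem (this.2 hz)]
        rw [← ENNReal.ofReal_mul (by positivity), norm_smul, Real.norm_of_nonneg hRpos.le,
          Real.mul_rpow hRpos.le (norm_nonneg _)]
      · simp only [hh, Set.indicator_of_notMem hz, Set.indicator_of_notMem (mt this.1 hz),
          mul_zero]
    simp only [h2] at h1
    rw [lintegral_const_mul _ (hhm 1)] at h1
    have h3 : ENNReal.ofReal (R ^ (n : ℝ)) * ENNReal.ofReal (R ^ (-(n : ℝ))) = 1 := by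
      rw [← ENNReal.ofReal_mul (by positivity), ← Real.rpow_add hRpos]
      simp
    calc ∫⁻ z, h R z = ENNReal.ofReal (R ^ (n : ℝ)) *
          (ENNReal.ofReal (R ^ (-(n : ℝ))) * ∫⁻ z, h R z) := by rw [← mul_assoc, h3, one_mul]
      _ = _ := by
        rw [← h1, ← mul_assoc, ← ENNReal.ofReal_mul (by positivity), ← Real.rpow_add hRpos,
          ← sub_eq_add_neg]
  have hRV : ENNReal.ofReal (R ^ ((n : ℝ) - lam)) = volume B ^ θ := by
    rw [hVe, ENNReal.ofReal_rpow_of_nonneg hVpos.le hθ0.le, hR, ← Real.rpow_mul hVpos.le, hlam]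
    congr 2
    field_simp
    ring
  have : Nontrivial (Rn n) := by
    refine Module.nontrivial_of_finrank_pos (R := ℝ) ?_
    simpa using hn
  have hpt : ∀ᵐ y, wt lam (x - y) ≤ h R (x - y) + ENNReal.ofReal (R ^ (-lam)) := by
    filter_upwards [compl_mem_ae_iff.2 (measure_singleton x)] with y hy
    have hz0 : 0 < ‖x - y‖ := norm_pos_iff.2 (sub_ne_zero.2 fun h => hy h.symm)
    by_cases hz : x - y ∈ Metric.ball (0 : Rn n) R
    · refine le_trans ?_ le_self_add
      simp only [hh, Set.indicator_of_mem hz, wt]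
      refine ENNReal.ofReal_le_ofReal ?_
      exact Real.rpow_le_rpow_of_nonpos hz0 (by linarith) (by linarith)
    · refine le_trans ?_ le_add_self
      have : R ≤ ‖x - y‖ := by simpa using hz
      refine ENNReal.ofReal_le_ofReal ?_
      exact Real.rpow_le_rpow_of_nonpos hRpos (by linarith) (by linarith)
  calc ∫⁻ y in B, wt lam (x - y)
      ≤ ∫⁻ y in B, (h R (x - y) + ENNReal.ofReal (R ^ (-lam))) := 
        lintegral_mono_ae (ae_restrict_of_ae hpt)
    _ = (∫⁻ y in B, h R (x - y)) + ENNReal.ofReal (R ^ (-lam)) * volume B := by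
        rw [lintegral_add_right _ measurable_const, setLIntegral_const]
    _ ≤ (∫⁻ y, h R (x - y)) + ENNReal.ofReal (R ^ (-lam)) * volume B := by
        gcongr
        exact Measure.restrict_le_self
    _ = (∫⁻ y, h R y) + ENNReal.ofReal (R ^ ((n : ℝ) - lam)) := by
        rw [lintegral_sub_left_eq_self (h R) x, hVe, ← ENNReal.ofReal_mul (by positivity)]
        congr 2
        have : V = R ^ (n : ℝ) := by
          rw [hR, ← Real.rpow_mul hVpos.le, one_div_mul_cancel hn'.ne', Real.rpow_one]
        rw [this, ← Real.rpow_add hRpos]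
        ring_nf
    _ = _ := by rw [hscale, hRV]; ring

/-- Hardy–Littlewood–Sobolev inequality for the kernel `(1 + ‖x - y‖)^(-n(1-1/p+1/q))`. -/
theorem exists_hardyLittlewoodSobolev (hn : 0 < n) {p q : ℝ} (hp : 1 < p) (hpq : p < q) :
    ∃ C : ℝ≥0∞, C ≠ ∞ ∧ ∀ f : Rn n → ℝ≥0∞, Measurable f →
      (∫⁻ x, (∫⁻ y, wt (n * (1 - (1 / p - 1 / q))) (x - y) * f y) ^ q) ^ (1 / q)
        ≤ C * (∫⁻ y, f y ^ p) ^ (1 / p) := by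
  have hp0 : 0 < p := by linarith
  have hq0 : 0 < q := by linarith
  have hθ0 : 0 < 1 / p - 1 / q := by
    rw [sub_pos]; exact one_div_lt_one_div_of_lt hp0 hpq
  have hθ1 : 1 / p - 1 / q ≤ 1 := by
    have : 1 / p < 1 := by rw [div_lt_one hp0]; exact hp
    have : 0 < 1 / q := by positivity
    linarith
  obtain ⟨D, hD, h⟩ := exists_setLIntegral_wt_le hn hθ0 hθ1
  refine exists_lintegral_kernel_rpow_le hp (hp.trans hpq) rfl hθ0
    (K := fun x y => wt (n * (1 - (1 / p - 1 / q))) (x - y)) ?_ hD h ?_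
  · exact (measurable_wt _).comp (measurable_fst.sub measurable_snd)
  · intro y A hA
    simp only [fun x => wt_sub_comm (n * (1 - (1 / p - 1 / q))) x y]
    exact h y A hA

/-- Boundedness of the integral operator with kernel `(1+‖ξ‖)^(-β) (1+‖ξ-η‖)^(-N)` from `L^{q₁}` to
`L^{q₂}`. -/
theorem exists_frequency_bound (hn : 0 < n) {q₁ q₂ β N : ℝ} (hq₁ : 1 < q₁) (hq₂ : 1 < q₂)
    (hβ : 0 ≤ β) (hN : n < N) (h : 1 / q₂ < 1 / q₁ + β / n) :
    ∃ C : ℝ≥0∞, C ≠ ∞ ∧ ∀ F : Rn n → ℝ≥0∞, Measurable F →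
      (∫⁻ ξ, (∫⁻ η, wt β ξ * wt N (ξ - η) * F η) ^ q₂) ^ (1 / q₂)
        ≤ C * (∫⁻ η, F η ^ q₁) ^ (1 / q₁) := by
  have hn' : (0 : ℝ) < n := by exact_mod_cast hn
  have hq₁0 : 0 < q₁ := by linarith
  have hq₂0 : 0 < q₂ := by linarith
  have hW : ∫⁻ x : Rn n, wt N x ≠ ∞ := lintegral_wt_ne_top hN
  have hpull : ∀ F : Rn n → ℝ≥0∞, Measurable F → ∀ ξ, ∫⁻ η, wt β ξ * wt N (ξ - η) * F η
      = wt β ξ * ∫⁻ η, wt N (ξ - η) * F η := fun F hF ξ => by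
    rw [← lintegral_const_mul _ (by fun_prop)]
    simp only [mul_assoc]
  have hHm : ∀ F : Rn n → ℝ≥0∞, Measurable F →
      Measurable fun ξ => ∫⁻ η, wt N (ξ - η) * F η := fun F hF => by
    refine Measurable.lintegral_prod_right' (f := fun z : Rn n × Rn n => wt N (z.1 - z.2) * F z.2) ?_
    fun_prop
  rcases lt_or_ge q₂ q₁ with hlt | hge
  -- Integrability must be gained: Young keeps the convolution in `L^{q₁}`, and Hölder with exponent
  -- `q₁/q₂` spends the decay of the weight to reach `L^{q₂}`.
  · have hs1 : 1 < q₁ / q₂ := by rwa [one_lt_div hq₂0]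
    have hs := Real.HolderConjugate.conjExponent hs1
    set t := (q₁ / q₂).conjExponent with ht
    have ht0 : 0 < t := hs.symm.pos
    -- The weight has to lie in `L^{q₂ t}` with `1/(q₂ t) = 1/q₂ - 1/q₁`; this is where the strict
    -- inequality is used.
    have hβt : n < β * (q₂ * t) := by
      have e1 : 1 / (q₂ * t) = 1 / q₂ - 1 / q₁ := by
        have := hs.inv_add_inv_eq_one
        have e : t⁻¹ = 1 - q₂ / q₁ := by
          rw [inv_div] at this; linarith
        rw [one_div, mul_inv, e]
        field_simp
      have e2 : 1 / (q₂ * t) < β / n := by rw [e1]; linarith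
      rw [div_lt_div_iff₀ (by positivity) hn'] at e2
      linarith
    refine ⟨((∫⁻ ξ : Rn n, wt β ξ ^ (q₂ * t)) ^ (1 / t)) ^ (1 / q₂) * ∫⁻ x : Rn n, wt N x, ?_,
      fun F hF => ?_⟩
    · have : ∫⁻ ξ : Rn n, wt β ξ ^ (q₂ * t) ≠ ∞ := lintegral_wt_rpow_ne_top (by positivity) hβt
      finiteness
    set H : Rn n → ℝ≥0∞ := fun ξ => ∫⁻ η, wt N (ξ - η) * F η with hH
    have hY := lintegral_conv_rpow_le hq₁ (measurable_wt N) hF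
    have hHol := ENNReal.lintegral_mul_le_Lp_mul_Lq volume hs
      (f := fun ξ => H ξ ^ q₂) (g := fun ξ : Rn n => wt β ξ ^ q₂)
      ((hHm F hF).pow_const _).aemeasurable (by fun_prop)
    calc (∫⁻ ξ, (∫⁻ η, wt β ξ * wt N (ξ - η) * F η) ^ q₂) ^ (1 / q₂)
        = (∫⁻ ξ, H ξ ^ q₂ * wt β ξ ^ q₂) ^ (1 / q₂) := by
          congr 2 with ξ
          rw [hpull F hF, mul_comm, ENNReal.mul_rpow_of_nonneg _ _ hq₂0.le]
      _ ≤ ((∫⁻ ξ, (H ξ ^ q₂) ^ (q₁ / q₂)) ^ (1 / (q₁ / q₂)) *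
          (∫⁻ ξ : Rn n, (wt β ξ ^ q₂) ^ t) ^ (1 / t)) ^ (1 / q₂) :=
          ENNReal.rpow_le_rpow hHol (by positivity)
      _ = ((∫⁻ ξ : Rn n, wt β ξ ^ (q₂ * t)) ^ (1 / t)) ^ (1 / q₂) * (∫⁻ ξ, H ξ ^ q₁) ^ (1 / q₁) := by
          rw [ENNReal.mul_rpow_of_nonneg _ _ (by positivity), mul_comm]
          have e1 : q₂ * (q₁ / q₂) = q₁ := by field_simp
          have e2 : 1 / (q₁ / q₂) * (1 / q₂) = 1 / q₁ := by field_simp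
          simp only [← ENNReal.rpow_mul, e1, e2]
      _ ≤ _ := by
          rw [mul_assoc]
          gcongr
  -- Here the weight is simply bounded by `1`. The convolution lies in `L^{q₁}` and in `L^∞`, hence
  -- in `L^{q₂}`.
  · have hc := Real.HolderConjugate.conjExponent hq₁
    set t := q₁.conjExponent with ht
    have ht0 : 0 < t := hc.symm.pos
    set K := (∫⁻ x : Rn n, wt N x ^ t) ^ (1 / t) with hK
    have hKt : K ≠ ∞ := by
      have : ∫⁻ ξ : Rn n, wt N ξ ^ t ≠ ∞ :=
        lintegral_wt_rpow_ne_top (by positivity) (by nlinarith [hc.symm.lt])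
      rw [hK]
      finiteness
    set D := max K (∫⁻ x : Rn n, wt N x) with hD
    refine ⟨D, by simp [hD, hKt, hW], fun F hF => ?_⟩
    set H : Rn n → ℝ≥0∞ := fun ξ => ∫⁻ η, wt N (ξ - η) * F η with hH
    set M := (∫⁻ η, F η ^ q₁) ^ (1 / q₁) with hM
    have hY : (∫⁻ ξ, H ξ ^ q₁) ^ (1 / q₁) ≤ D * M :=
      (lintegral_conv_rpow_le hq₁ (measurable_wt N) hF).trans
        (mul_le_mul' (le_max_right _ _) le_rfl)
    have hY' : ∫⁻ ξ, H ξ ^ q₁ ≤ (D * M) ^ q₁ := by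
      calc ∫⁻ ξ, H ξ ^ q₁ = ((∫⁻ ξ, H ξ ^ q₁) ^ (1 / q₁)) ^ q₁ := by
            rw [← ENNReal.rpow_mul, one_div_mul_cancel hq₁0.ne', ENNReal.rpow_one]
        _ ≤ _ := ENNReal.rpow_le_rpow hY hq₁0.le
    have hsup : ∀ ξ, H ξ ≤ D * M := fun ξ => by
      have hHol := ENNReal.lintegral_mul_le_Lp_mul_Lq volume hc.symm
        (f := fun η : Rn n => wt N (ξ - η)) (g := F) (by fun_prop) hF.aemeasurable
      refine hHol.trans ?_
      have : ∫⁻ η, wt N (ξ - η) ^ t = ∫⁻ η : Rn n, wt N η ^ t :=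
        lintegral_sub_left_eq_self (fun η : Rn n => wt N η ^ t) ξ
      rw [this]
      exact mul_le_mul' (le_max_left _ _) le_rfl
    have h2 : ∫⁻ ξ, (∫⁻ η, wt β ξ * wt N (ξ - η) * F η) ^ q₂ ≤ (D * M) ^ q₂ := by
      calc ∫⁻ ξ, (∫⁻ η, wt β ξ * wt N (ξ - η) * F η) ^ q₂
          ≤ ∫⁻ ξ, (D * M) ^ (q₂ - q₁) * H ξ ^ q₁ := by
            refine lintegral_mono fun ξ => ?_
            rw [hpull F hF]
            calc (wt β ξ * H ξ) ^ q₂ ≤ (1 * H ξ) ^ q₂ := by gcongr; exact wt_le_one hβ ξ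
              _ = H ξ ^ (q₂ - q₁) * H ξ ^ q₁ := by
                rw [one_mul, ← ENNReal.rpow_add_of_nonneg _ _ (by linarith) hq₁0.le,
                  sub_add_cancel]
              _ ≤ _ := by gcongr; exact hsup ξ
        _ = (D * M) ^ (q₂ - q₁) * ∫⁻ ξ, H ξ ^ q₁ :=
            lintegral_const_mul _ ((hHm F hF).pow_const _)
        _ ≤ (D * M) ^ (q₂ - q₁) * (D * M) ^ q₁ := by gcongr
        _ = _ := by
            rw [← ENNReal.rpow_add_of_nonneg _ _ (by linarith) hq₁0.le, sub_add_cancel]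
    calc _ ≤ ((D * M) ^ q₂) ^ (1 / q₂) := ENNReal.rpow_le_rpow h2 (by positivity)
      _ = _ := by rw [← ENNReal.rpow_mul, mul_one_div_cancel hq₂0.ne', ENNReal.rpow_one]

end Weights

/-! ### The tensor product kernel on mixed Lebesgue spaces -/

section MixedKernel

variable {n : ℕ}

/-- Boundedness on mixed Lebesgue spaces of the tensor product of a Hardy–Littlewood–Sobolev kernel
in the first variable and a weighted convolution kernel in the second one. -/
theorem exists_mixedNorm_kernel_le (hn : 0 < n) {p₁ p₂ q₁ q₂ β N : ℝ} (hp₁ : 1 < p₁)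
    (hp : p₁ < p₂) (hq₁ : 1 < q₁) (hq₂ : 1 < q₂) (hβ : 0 ≤ β) (hN : n < N)
    (h : 1 / q₂ < 1 / q₁ + β / n) :
    ∃ C : ℝ≥0∞, C ≠ ∞ ∧ ∀ F : Rn n → Rn n → ℝ≥0∞, Measurable (Function.uncurry F) →
      mixedNorm p₂ q₂ (fun x ξ => ∫⁻ η, ∫⁻ y, wt β ξ * wt N (ξ - η) *
        (wt (n * (1 - (1 / p₁ - 1 / p₂))) (x - y) * F y η)) ≤ C * mixedNorm p₁ q₁ F := by
  obtain ⟨C₁, hC₁, h₁⟩ := exists_hardyLittlewoodSobolev hn hp₁ hp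
  obtain ⟨C₂, hC₂, h₂⟩ := exists_frequency_bound hn hq₁ hq₂ hβ hN h
  set lam := n * (1 - (1 / p₁ - 1 / p₂)) with hlam
  have hp₂ : 1 < p₂ := hp₁.trans hp
  refine ⟨C₂ * C₁, by finiteness, fun F hF => ?_⟩
  have hFη : ∀ η, Measurable fun y => F y η := fun η =>
    hF.comp (measurable_id.prodMk measurable_const)
  have hin : Measurable fun z : Rn n × Rn n => ∫⁻ y, wt lam (z.1 - y) * F y z.2 := by
    refine Measurable.lintegral_prod_right'
      (f := fun w : (Rn n × Rn n) × Rn n => wt lam (w.1.1 - w.2) * F w.2 w.1.2) ?_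
    have : Measurable fun w : (Rn n × Rn n) × Rn n => F w.2 w.1.2 :=
      hF.comp (measurable_snd.prodMk (measurable_snd.comp measurable_fst))
    fun_prop
  -- Minkowski moves the spatial norm inside the frequency integral, so that the spatial operator
  -- acts at each fixed `η`.
  have hslice : ∀ ξ, (∫⁻ x, (∫⁻ η, ∫⁻ y, wt β ξ * wt N (ξ - η) *
      (wt lam (x - y) * F y η)) ^ p₂) ^ (1 / p₂) ≤
      ∫⁻ η, wt β ξ * wt N (ξ - η) * (C₁ * (∫⁻ y, F y η ^ p₁) ^ (1 / p₁)) := by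
    intro ξ
    have e1 : ∀ x η, ∫⁻ y, wt β ξ * wt N (ξ - η) * (wt lam (x - y) * F y η)
        = wt β ξ * wt N (ξ - η) * ∫⁻ y, wt lam (x - y) * F y η := fun x η => by
      have := hFη η
      rw [lintegral_const_mul _ (by fun_prop)]
    simp only [e1]
    refine (lintegral_lintegral_rpow_le hp₂ (F := fun x η => wt β ξ * wt N (ξ - η) *
      ∫⁻ y, wt lam (x - y) * F y η) ?_).trans ?_
    · exact Measurable.mul (by fun_prop) hin
    · refine lintegral_mono fun η => ?_
      have hm : Measurable fun x => (∫⁻ y, wt lam (x - y) * F y η) ^ p₂ :=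
        (hin.comp (measurable_id.prodMk measurable_const)).pow_const _
      simp only [ENNReal.mul_rpow_of_nonneg _ _ (by linarith : 0 ≤ p₂)]
      rw [lintegral_const_mul _ hm, ENNReal.mul_rpow_of_nonneg _ _ (by positivity),
        ← ENNReal.mul_rpow_of_nonneg _ _ (by linarith : 0 ≤ p₂), ← ENNReal.rpow_mul,
        mul_one_div_cancel (by linarith), ENNReal.rpow_one]
      gcongr
      exact h₁ _ (hFη η)
  rw [mixedNorm_eq, mixedNorm_eq]
  calc _ ≤ (∫⁻ ξ, (∫⁻ η, wt β ξ * wt N (ξ - η) *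
          (C₁ * (∫⁻ y, F y η ^ p₁) ^ (1 / p₁))) ^ q₂) ^ (1 / q₂) := by
        gcongr with ξ
        exact hslice ξ
    _ ≤ C₂ * (∫⁻ η, (C₁ * (∫⁻ y, F y η ^ p₁) ^ (1 / p₁)) ^ q₁) ^ (1 / q₁) :=
        h₂ _ ((measurable_slice_rpow hF p₁ (1 / p₁)).const_mul _)
    _ = _ := by
        simp only [ENNReal.mul_rpow_of_nonneg _ _ (by linarith : 0 ≤ q₁)]
        rw [lintegral_const_mul _ ((measurable_slice_rpow hF p₁ (1 / p₁)).pow_const q₁),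
          ENNReal.mul_rpow_of_nonneg _ _ (by positivity), ← ENNReal.rpow_mul C₁,
          mul_one_div_cancel (by linarith), ENNReal.rpow_one, mul_assoc]

end MixedKernel

/-! ### Decay of oscillatory integrals of Schwartz functions -/

section FourierDecay

variable {n : ℕ}

/-- Peetre's inequality: decay at `x + y` is exchanged for decay at `x` at the price of growth in
`y`. -/
theorem one_add_norm_rpow_neg_add_le {r : ℝ} (hr : 0 ≤ r) (x y : Rn n) :
    (1 + ‖x + y‖) ^ (-r) ≤ (1 + ‖x‖) ^ (-r) * (1 + ‖y‖) ^ r := by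
  have h1 : 1 + ‖x‖ ≤ (1 + ‖x + y‖) * (1 + ‖y‖) := by
    have : ‖x‖ ≤ ‖x + y‖ + ‖y‖ := by simpa using norm_sub_le (x + y) y
    nlinarith [norm_nonneg (x + y), norm_nonneg y]
  rw [Real.rpow_neg (by positivity), Real.rpow_neg (by positivity), ← div_eq_inv_mul,
    inv_eq_one_div, div_le_div_iff₀ (by positivity) (by positivity), one_mul, mul_comm,
    ← Real.mul_rpow (by positivity) (by positivity)]
  gcongr

theorem one_add_norm_smul_le {s : ℝ} (hs : |s| ≤ 1) (x : Rn n) : 1 + ‖s • x‖ ≤ 1 + ‖x‖ := by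
  rw [norm_smul, Real.norm_eq_abs]
  gcongr
  exact mul_le_of_le_one_left (norm_nonneg _) hs

theorem integrable_weight {r : ℝ} (hr : n < r) : Integrable fun x : Rn n => (1 + ‖x‖) ^ (-r) :=
  integrable_one_add_norm (by simpa using hr)

/-- The maximum of the Schwartz seminorms of order at most `k`. -/
def schwartzNorm (k : ℕ) : Seminorm ℂ 𝓢(Rn n, ℂ) :=
  (Finset.Iic (k, k)).sup (schwartzSeminormFamily ℂ (Rn n) ℂ)

theorem norm_iteratedFDeriv_le_schwartzNorm (f : 𝓢(Rn n, ℂ)) {j M k : ℕ} (hj : j ≤ k) (hM : M ≤ k)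
    (x : Rn n) :
    ‖iteratedFDeriv ℝ j f x‖ ≤ 2 ^ k * schwartzNorm k f * (1 + ‖x‖) ^ (-(M : ℝ)) := by
  have h := one_add_le_sup_seminorm_apply (𝕜 := ℂ) (m := (k, k)) hM hj f x
  rw [Real.rpow_neg (by positivity), Real.rpow_natCast, ← div_eq_mul_inv, le_div_iff₀ (by positivity),
    mul_comm]
  exact h

theorem norm_le_schwartzNorm (f : 𝓢(Rn n, ℂ)) (k : ℕ) (x : Rn n) :
    ‖f x‖ ≤ 2 ^ k * schwartzNorm k f * (1 + ‖x‖) ^ (-(k : ℝ)) := by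
  simpa using norm_iteratedFDeriv_le_schwartzNorm f (Nat.zero_le k) le_rfl x

theorem exists_norm_le_weight (f : 𝓢(Rn n, ℂ)) (r : ℝ) :
    ∃ C : ℝ, 0 ≤ C ∧ ∀ x, ‖f x‖ ≤ C * (1 + ‖x‖) ^ (-r) := by
  obtain ⟨k, hk⟩ := exists_nat_ge r
  refine ⟨2 ^ k * schwartzNorm k f, by positivity, fun x => ?_⟩
  refine (norm_le_schwartzNorm f k x).trans ?_
  gcongr
  linarith [norm_nonneg x]

theorem character_neg_mul_integral_eq_fourier (F : Rn n → ℂ) (ω : Rn n) :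
    ∫ z, character (-ω) z * F z = 𝓕 F ((2 * Real.pi)⁻¹ • ω) := by
  rw [Real.fourier_eq']
  congr with z
  rw [character, smul_eq_mul, real_inner_smul_right, inner_neg_left, real_inner_comm]
  congr 2
  push_cast
  have : (Real.pi : ℂ) ≠ 0 := by exact_mod_cast Real.pi_ne_zero
  field_simp

/-- Leibniz' rule, with Peetre's inequality moving the decay of `χ` from `x + s z` to `x`. The order
`N + n + 1` lets `ψ` absorb the loss `(1 + ‖z‖)^N` and still be integrable. Since `|s| ≤ 1`, neither
the chain rule nor Peetre's inequality costs anything depending on `s`. -/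
theorem norm_iteratedFDeriv_mul_comp_affine_le (ψ χ : 𝓢(Rn n, ℂ)) (N j : ℕ) (hj : j ≤ N) {s : ℝ}
    (hs : |s| ≤ 1) (x z : Rn n) :
    ‖iteratedFDeriv ℝ j (fun z => ψ z * χ (x + s • z)) z‖ ≤
      2 ^ N * (2 ^ (N + n + 1) * schwartzNorm (N + n + 1) ψ) *
        (2 ^ (N + n + 1) * schwartzNorm (N + n + 1) χ) *
        (1 + ‖x‖) ^ (-(N : ℝ)) * (1 + ‖z‖) ^ (-((n : ℝ) + 1)) := by
  set k := N + n + 1 with hk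
  have hχ : ContDiff ℝ (⊤ : ℕ∞) fun y => χ (x + y) := (χ.smooth ⊤).comp (contDiff_const.add contDiff_id)
  have hχs : ContDiff ℝ (⊤ : ℕ∞) fun z => χ (x + s • z) := hχ.comp (contDiff_const_smul s)
  have hle : ∀ m : ℕ, (m : WithTop ℕ∞) ≤ ((⊤ : ℕ∞) : WithTop ℕ∞) := fun m => mod_cast le_top
  refine (norm_iteratedFDeriv_mul_le (ψ.smooth ⊤) hχs z (n := j)
    (mod_cast le_top)).trans ?_
  have hterm : ∀ i ∈ Finset.range (j + 1), (j.choose i : ℝ) * ‖iteratedFDeriv ℝ i ψ z‖ *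
      ‖iteratedFDeriv ℝ (j - i) (fun z => χ (x + s • z)) z‖ ≤ (j.choose i : ℝ) *
      ((2 ^ k * schwartzNorm k ψ) * (2 ^ k * schwartzNorm k χ) *
        (1 + ‖x‖) ^ (-(N : ℝ)) * (1 + ‖z‖) ^ (-((n : ℝ) + 1))) := by
    intro i hi
    rw [Finset.mem_range] at hi
    have h1 := norm_iteratedFDeriv_le_schwartzNorm ψ (j := i) (M := N + n + 1) (k := k)
      (by omega) (by omega) z
    have h2 : ‖iteratedFDeriv ℝ (j - i) (fun z => χ (x + s • z)) z‖ ≤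
        2 ^ k * schwartzNorm k χ * ((1 + ‖x‖) ^ (-(N : ℝ)) * (1 + ‖z‖) ^ (N : ℝ)) := by
      have e := congrFun (iteratedFDeriv_comp_const_smul (i := j - i) s
        (hχ.of_le (hle _))) z
      rw [e, iteratedFDeriv_comp_add_left, norm_smul, norm_pow, Real.norm_eq_abs]
      calc |s| ^ (j - i) * ‖iteratedFDeriv ℝ (j - i) χ (x + s • z)‖
          ≤ 1 * (2 ^ k * schwartzNorm k χ * (1 + ‖x + s • z‖) ^ (-(N : ℝ))) := by
            gcongr
            · exact pow_le_one₀ (abs_nonneg _) hs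
            · exact norm_iteratedFDeriv_le_schwartzNorm χ (by omega) (by omega) _
        _ ≤ _ := by
            rw [one_mul]
            gcongr
            refine (one_add_norm_rpow_neg_add_le (by positivity) _ _).trans ?_
            gcongr 2
            exact one_add_norm_smul_le hs z
    calc (j.choose i : ℝ) * ‖iteratedFDeriv ℝ i ψ z‖ *
        ‖iteratedFDeriv ℝ (j - i) (fun z => χ (x + s • z)) z‖
        ≤ (j.choose i : ℝ) * (2 ^ k * schwartzNorm k ψ * (1 + ‖z‖) ^ (-((N + n + 1 : ℕ) : ℝ))) *
          (2 ^ k * schwartzNorm k χ * ((1 + ‖x‖) ^ (-(N : ℝ)) * (1 + ‖z‖) ^ (N : ℝ))) := by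
          gcongr
      _ = (j.choose i : ℝ) * ((2 ^ k * schwartzNorm k ψ) * (2 ^ k * schwartzNorm k χ) *
        (1 + ‖x‖) ^ (-(N : ℝ)) *
          ((1 + ‖z‖) ^ (-((N + n + 1 : ℕ) : ℝ)) * (1 + ‖z‖) ^ (N : ℝ))) := by ring
      _ = _ := by
          rw [← Real.rpow_add (by positivity)]
          push_cast
          ring_nf
  refine (Finset.sum_le_sum hterm).trans ?_
  rw [← Finset.sum_mul]
  have hsum : ∑ i ∈ Finset.range (j + 1), (j.choose i : ℝ) = 2 ^ j := by
    exact_mod_cast Nat.sum_range_choose j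
  rw [hsum]
  calc (2 : ℝ) ^ j * ((2 ^ k * schwartzNorm k ψ) * (2 ^ k * schwartzNorm k χ) *
        (1 + ‖x‖) ^ (-(N : ℝ)) * (1 + ‖z‖) ^ (-((n : ℝ) + 1)))
      ≤ (2 : ℝ) ^ N * ((2 ^ k * schwartzNorm k ψ) * (2 ^ k * schwartzNorm k χ) *
        (1 + ‖x‖) ^ (-(N : ℝ)) * (1 + ‖z‖) ^ (-((n : ℝ) + 1))) := by
        gcongr
        norm_num
    _ = _ := by ring

/-- Joint decay of short-time Fourier transforms of Schwartz functions, uniformly with respect to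
contractions. -/
theorem exists_norm_integral_character_le (ψ : 𝓢(Rn n, ℂ)) (N : ℕ) :
    ∃ C : ℝ, 0 ≤ C ∧ ∃ k : ℕ, ∀ (χ : 𝓢(Rn n, ℂ)) (s : ℝ), |s| ≤ 1 → ∀ x ω : Rn n,
      ‖∫ z, character (-ω) z * (ψ z * χ (x + s • z))‖ ≤
        C * schwartzNorm k χ * (1 + ‖ω‖) ^ (-(N : ℝ)) * (1 + ‖x‖) ^ (-(N : ℝ)) := by
  set k := N + n + 1 with hk
  set J := ∫ z : Rn n, (1 + ‖z‖) ^ (-((n : ℝ) + 1)) with hJ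
  have hJ0 : 0 ≤ J := integral_nonneg fun z => by positivity
  set A := 2 ^ N * (2 ^ k * schwartzNorm k ψ) * 2 ^ k * J with hA
  have hA0 : 0 ≤ A := by positivity
  refine ⟨(2 * Real.pi) ^ N * 2 ^ N * (1 + 2 ^ N * (N + 1)) * A, by positivity, k,
    fun χ s hs x ω => ?_⟩
  set F : Rn n → ℂ := fun z => ψ z * χ (x + s • z) with hF
  have hFs : ContDiff ℝ (⊤ : ℕ∞) F :=
    (ψ.smooth ⊤).mul ((χ.smooth ⊤).comp (contDiff_const.add (contDiff_const_smul s)))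
  have hIw : Integrable fun z : Rn n => (1 + ‖z‖) ^ (-((n : ℝ) + 1)) :=
    integrable_weight (by linarith)
  have hFint : ∀ j ≤ N, Integrable fun z => ‖iteratedFDeriv ℝ j F z‖ := by
    intro j hj
    refine (hIw.const_mul (2 ^ N * (2 ^ k * schwartzNorm k ψ) *
        (2 ^ k * schwartzNorm k χ) * (1 + ‖x‖) ^ (-(N : ℝ)))).mono' ?_ ?_
    · exact ((hFs.continuous_iteratedFDeriv (mod_cast le_top)).norm).aestronglyMeasurable
    · refine Filter.Eventually.of_forall fun z => ?_
      rw [norm_norm]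
      exact norm_iteratedFDeriv_mul_comp_affine_le ψ χ N j hj hs x z
  have hFle : ∀ j ≤ N, ∫ z, ‖iteratedFDeriv ℝ j F z‖ ≤
      A * schwartzNorm k χ * (1 + ‖x‖) ^ (-(N : ℝ)) := by
    intro j hj
    calc ∫ z, ‖iteratedFDeriv ℝ j F z‖ ≤ ∫ z, 2 ^ N * (2 ^ k * schwartzNorm k ψ) *
        (2 ^ k * schwartzNorm k χ) * (1 + ‖x‖) ^ (-(N : ℝ)) * (1 + ‖z‖) ^ (-((n : ℝ) + 1)) :=
          integral_mono (hFint j hj) (hIw.const_mul _)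
            fun z => norm_iteratedFDeriv_mul_comp_affine_le ψ χ N j hj hs x z
      _ = _ := by
          rw [integral_const_mul, hA]
          ring
  set v := (2 * Real.pi)⁻¹ • ω with hv
  set Q := A * schwartzNorm k χ * (1 + ‖x‖) ^ (-(N : ℝ)) with hQ
  have hQ0 : 0 ≤ Q := by positivity
  have key : ∀ m ≤ N, ‖v‖ ^ m * ‖𝓕 F v‖ ≤ 2 ^ m * ((m + 1) * Q) := by
    intro m hm
    have h := Real.pow_mul_norm_iteratedFDeriv_fourier_le (f := F) (K := 0) (N := N)
      (hFs.of_le (mod_cast le_top)) (fun k' j hk' hj => by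
        have : k' = 0 := by simpa using hk'
        subst this
        simpa using hFint j (by exact_mod_cast hj)) (k := 0) (n := m) le_rfl (by exact_mod_cast hm) v
    simp only [norm_iteratedFDeriv_zero, pow_zero, one_mul, Nat.cast_zero, mul_zero, zero_add] at h
    refine h.trans ?_
    gcongr
    rw [Finset.sum_product]
    simp only [Finset.range_one, Finset.sum_singleton, pow_zero, one_mul]
    calc ∑ j ∈ Finset.range (m + 1), ∫ z, ‖iteratedFDeriv ℝ j F z‖
        ≤ ∑ j ∈ Finset.range (m + 1), Q := by
          refine Finset.sum_le_sum fun j hj => hFle j ?_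
          rw [Finset.mem_range] at hj
          omega
      _ = _ := by simp
  rw [character_neg_mul_integral_eq_fourier]
  have hω : 1 + ‖ω‖ ≤ 2 * Real.pi * (1 + ‖v‖) := by
    have : ‖ω‖ = 2 * Real.pi * ‖v‖ := by
      rw [hv, norm_smul, norm_inv, Real.norm_of_nonneg (by positivity)]
      field_simp
    rw [this]
    nlinarith [Real.pi_gt_three]
  -- Since `(1 + ‖v‖)^N ≤ 2^N (1 + ‖v‖^N)`, only the orders `0` and `N` of the Fourier bound are
  -- needed.
  have h1 := key 0 (Nat.zero_le _)
  have h2 := key N le_rfl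
  simp only [pow_zero, one_mul, Nat.cast_zero, zero_add] at h1
  have hpow : (1 + ‖v‖) ^ N ≤ 2 ^ N * (1 + ‖v‖ ^ N) := by
    have hmax : 1 + ‖v‖ ≤ 2 * max 1 ‖v‖ := by
      linarith [le_max_left 1 ‖v‖, le_max_right 1 ‖v‖]
    calc (1 + ‖v‖) ^ N ≤ (2 * max 1 ‖v‖) ^ N := by gcongr
      _ = 2 ^ N * (max 1 ‖v‖) ^ N := mul_pow _ _ _
      _ ≤ _ := by
        gcongr
        rcases max_choice 1 ‖v‖ with h | h <;> rw [h]
        · simp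
        · simp
  have h3 : (1 + ‖ω‖) ^ N * ‖𝓕 F v‖ ≤
      (2 * Real.pi) ^ N * 2 ^ N * (1 + 2 ^ N * (N + 1)) * Q := by
    calc (1 + ‖ω‖) ^ N * ‖𝓕 F v‖ ≤ (2 * Real.pi * (1 + ‖v‖)) ^ N * ‖𝓕 F v‖ := by gcongr
      _ = (2 * Real.pi) ^ N * ((1 + ‖v‖) ^ N * ‖𝓕 F v‖) := by rw [mul_pow]; ring
      _ ≤ (2 * Real.pi) ^ N * (2 ^ N * (1 + ‖v‖ ^ N) * ‖𝓕 F v‖) := by gcongr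
      _ = (2 * Real.pi) ^ N * 2 ^ N * (‖𝓕 F v‖ + ‖v‖ ^ N * ‖𝓕 F v‖) := by ring
      _ ≤ (2 * Real.pi) ^ N * 2 ^ N * (Q + 2 ^ N * ((N + 1) * Q)) := by gcongr
      _ = _ := by ring
  rw [Real.rpow_neg (by positivity) (N : ℝ), Real.rpow_natCast]
  calc ‖𝓕 F v‖ = ((1 + ‖ω‖) ^ N)⁻¹ * ((1 + ‖ω‖) ^ N * ‖𝓕 F v‖) := by field_simp
    _ ≤ ((1 + ‖ω‖) ^ N)⁻¹ * ((2 * Real.pi) ^ N * 2 ^ N * (1 + 2 ^ N * (N + 1)) * Q) := by gcongr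
    _ = _ := by rw [hQ]; ring

end FourierDecay

/-! ### Characters -/

section Character

variable {n : ℕ}

theorem norm_character (ξ t : Rn n) : ‖character ξ t‖ = 1 := by
  rw [character, mul_comm, Complex.norm_exp_ofReal_mul_I]

theorem character_add_right (ξ s t : Rn n) :
    character ξ (s + t) = character ξ s * character ξ t := by
  rw [character, character, character, ← Complex.exp_add, inner_add_right]
  push_cast
  ring_nf

theorem character_add_left (ξ η t : Rn n) :
    character (ξ + η) t = character ξ t * character η t := by
  rw [character, character, character, ← Complex.exp_add, inner_add_left]
  push_cast
  ring_nf

theorem character_smul_left (r : ℝ) (ξ t : Rn n) : character (r • ξ) t = character ξ (r • t) := by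
  rw [character, character, real_inner_smul_left, real_inner_smul_right]

theorem conj_character (ξ t : Rn n) : conj (character ξ t) = character (-ξ) t := by
  rw [character, character, ← Complex.exp_conj]
  simp

@[fun_prop]
theorem continuous_character : Continuous fun z : Rn n × Rn n => character z.1 z.2 := by
  unfold character
  fun_prop

end Character

/-! ### Oscillatory integrals at an arbitrary scale -/

section Scaling

variable {n : ℕ}

/-- The weight which bounds averages over the scale `t`. -/
def scaleWt (M t : ℝ) (a : Rn n) : ℝ :=
  if t ≤ 1 then (1 + ‖a‖) ^ (-M) else t ^ (-(n : ℝ)) * (1 + ‖t⁻¹ • a‖) ^ (-M)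

theorem scaleWt_nonneg {M t : ℝ} (ht : 0 < t) (a : Rn n) : 0 ≤ scaleWt M t a := by
  unfold scaleWt
  split_ifs <;> positivity

theorem scaleWt_add_le {M t : ℝ} (hM : 0 ≤ M) (ht : 0 < t) (a z : Rn n) :
    scaleWt M t (a + z) ≤ scaleWt M t a * (1 + ‖z‖) ^ M := by
  unfold scaleWt
  split_ifs with h
  · exact one_add_norm_rpow_neg_add_le hM a z
  · rw [smul_add, mul_assoc]
    gcongr
    refine (one_add_norm_rpow_neg_add_le hM _ _).trans ?_
    gcongr 2
    refine one_add_norm_smul_le ?_ z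
    rw [abs_of_pos (by positivity)]
    exact inv_le_one_of_one_le₀ (by linarith)

theorem integral_comp_smul_eq (f : Rn n → ℂ) {t : ℝ} (ht : 0 < t) :
    ∫ v, f (t • v) = ((t ^ (-(n : ℝ)) : ℝ) : ℂ) * ∫ v, f v := by
  rw [Measure.integral_comp_smul, finrank_euclideanSpace, Fintype.card_fin,
    abs_of_pos (by positivity), Complex.real_smul, Real.rpow_neg ht.le, Real.rpow_natCast]

/-- For `t ≤ 1` the dilation is a contraction and the uniform decay estimate applies directly. For
`t > 1` the variable `a + t v` puts the contraction `t⁻¹` on `ψ` instead: the roles are swapped, the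
Jacobian is `t^(-n)`, and the frequency becomes `ξ` rather than `t ξ`. -/
theorem exists_norm_scaled_integral_le (ψ χ : 𝓢(Rn n, ℂ)) (N : ℕ) :
    ∃ C : ℝ, 0 ≤ C ∧ ∀ t : ℝ, 0 < t → ∀ ξ a : Rn n,
      ‖∫ v, character (-(t • ξ)) v * (ψ v * χ (a + t • v))‖ ≤
        C * (1 + ‖min t 1 • ξ‖) ^ (-(N : ℝ)) * scaleWt N t a := by
  obtain ⟨C₁, hC₁, k₁, h₁⟩ := exists_norm_integral_character_le ψ N
  obtain ⟨C₂, hC₂, k₂, h₂⟩ := exists_norm_integral_character_le χ N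
  refine ⟨max (C₁ * schwartzNorm k₁ χ) (C₂ * schwartzNorm k₂ ψ), by positivity,
    fun t ht ξ a => ?_⟩
  rcases le_or_gt t 1 with h | h
  · rw [min_eq_left h, scaleWt, if_pos h]
    refine (h₁ χ t (by rwa [abs_of_pos ht]) a (t • ξ)).trans ?_
    gcongr
    exact le_max_left _ _
  · rw [min_eq_right h.le, scaleWt, if_neg (not_le.2 h), one_smul]
    have hti : |t⁻¹| ≤ 1 := by
      rw [abs_of_pos (by positivity)]
      exact inv_le_one_of_one_le₀ h.le
    have h3 := h₂ ψ t⁻¹ hti (-(t⁻¹ • a)) ξ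
    set G : Rn n → ℂ := fun z =>
      character (-ξ) (-a) * (character (-ξ) z * (χ z * ψ (-(t⁻¹ • a) + t⁻¹ • z))) with hG
    have e1 : ∀ v, character (-(t • ξ)) v * (ψ v * χ (a + t • v)) = G (a + t • v) := by
      intro v
      have e : -(t⁻¹ • a) + t⁻¹ • (a + t • v) = v := by
        rw [smul_add, smul_smul, inv_mul_cancel₀ ht.ne']
        simp
      simp only [hG, e]
      have e' : character (-ξ) (-a) * character (-ξ) (a + t • v) = character (-ξ) (t • v) := by
        rw [← character_add_right, neg_add_cancel_left]
      rw [← smul_neg, character_smul_left, ← e']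
      ring
    simp only [e1]
    rw [integral_comp_smul_eq (fun y => G (a + y)) ht, integral_add_left_eq_self G a, norm_mul,
      Complex.norm_real, Real.norm_of_nonneg (by positivity), hG, integral_const_mul, norm_mul,
      norm_character, one_mul]
    rw [norm_neg] at h3
    calc t ^ (-(n : ℝ)) * ‖∫ z, character (-ξ) z * (χ z * ψ (-(t⁻¹ • a) + t⁻¹ • z))‖
        ≤ t ^ (-(n : ℝ)) * (max (C₁ * schwartzNorm k₁ χ) (C₂ * schwartzNorm k₂ ψ) *
          (1 + ‖ξ‖) ^ (-(N : ℝ)) * (1 + ‖t⁻¹ • a‖) ^ (-(N : ℝ))) := by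
          gcongr
          refine h3.trans ?_
          gcongr
          exact le_max_right _ _
      _ = _ := by ring

end Scaling

/-! ### Continuity and measurability of the short-time Fourier transform -/

section Continuity

variable {n : ℕ}

theorem continuous_compSubConstCLM (φ : 𝓢(Rn n, ℂ)) :
    Continuous fun x : Rn n => SchwartzMap.compSubConstCLM ℂ x φ := by
  rw [continuous_iff_continuousAt]
  intro x₀
  rw [ContinuousAt, (schwartz_withSeminorms ℂ (Rn n) ℂ).tendsto_nhds]
  rintro ⟨k, l⟩ ε hε
  set m := max k (l + 1) with hm
  set A := 2 ^ m * schwartzNorm m φ with hA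
  set R := 1 + ‖x₀‖ with hR
  have hR1 : 0 ≤ R := by positivity
  have key : ∀ x, ‖x - x₀‖ < 1 →
      SchwartzMap.seminorm ℂ k l (SchwartzMap.compSubConstCLM ℂ x φ -
        SchwartzMap.compSubConstCLM ℂ x₀ φ) ≤ A * (1 + R) ^ (k : ℝ) * ‖x - x₀‖ := by
    intro x hx
    refine SchwartzMap.seminorm_le_bound ℂ k l _ (by positivity) fun t => ?_
    have hD : ∀ y, iteratedFDeriv ℝ l (SchwartzMap.compSubConstCLM ℂ y φ) t
        = iteratedFDeriv ℝ l φ (t - y) := by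
      intro y
      have : (SchwartzMap.compSubConstCLM ℂ y φ : Rn n → ℂ) = fun s => φ (s - y) := by
        ext s; simp
      rw [this, iteratedFDeriv_comp_sub]
    have hsub : iteratedFDeriv ℝ l (SchwartzMap.compSubConstCLM ℂ x φ -
        SchwartzMap.compSubConstCLM ℂ x₀ φ : 𝓢(Rn n, ℂ)) t
        = iteratedFDeriv ℝ l φ (t - x) - iteratedFDeriv ℝ l φ (t - x₀) := by
      rw [← hD, ← hD, ← iteratedFDeriv_sub_apply]
      · rfl
      · exact ((SchwartzMap.compSubConstCLM ℂ x φ).smooth l).contDiffAt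
      · exact ((SchwartzMap.compSubConstCLM ℂ x₀ φ).smooth l).contDiffAt
    have hxR : ‖x‖ ≤ R := by
      have := norm_sub_norm_le x x₀
      linarith
    have hmv : ‖iteratedFDeriv ℝ l φ (t - x) - iteratedFDeriv ℝ l φ (t - x₀)‖ ≤
        A * ((1 + ‖t‖) ^ (-(k : ℝ)) * (1 + R) ^ (k : ℝ)) * ‖(t - x) - (t - x₀)‖ := by
      -- Both `t - x` and `t - x₀` lie in this ball as soon as `‖x - x₀‖ < 1`, and on it the decay
      -- of the next derivative is comparable to that at `t`.
      refine Convex.norm_image_sub_le_of_norm_fderiv_le (𝕜 := ℝ) (s := Metric.closedBall t R)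
        (fun y _ => ?_) (fun y hy => ?_) (convex_closedBall t R) ?_ ?_
      · exact ((φ.smooth ⊤).differentiable_iteratedFDeriv (mod_cast ENat.natCast_lt_top l)) y
      · rw [norm_fderiv_iteratedFDeriv]
        refine (norm_iteratedFDeriv_le_schwartzNorm φ (M := k) (le_max_right k (l + 1))
          (le_max_left _ _) y).trans ?_
        gcongr
        have h := one_add_norm_rpow_neg_add_le (r := k) (by positivity) t (y - t)
        rw [add_sub_cancel] at h
        refine h.trans ?_
        gcongr
        exact mem_closedBall_iff_norm.1 hy
      · rw [mem_closedBall_iff_norm]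
        simp only [sub_sub_cancel_left, norm_neg]
        rw [hR]; linarith
      · rw [mem_closedBall_iff_norm]
        simpa using hxR
    rw [hsub]
    calc ‖t‖ ^ k * ‖iteratedFDeriv ℝ l φ (t - x) - iteratedFDeriv ℝ l φ (t - x₀)‖
        ≤ (1 + ‖t‖) ^ k *
          (A * ((1 + ‖t‖) ^ (-(k : ℝ)) * (1 + R) ^ (k : ℝ)) * ‖(t - x) - (t - x₀)‖) := by
          gcongr
          linarith
      _ = ((1 + ‖t‖) ^ (k : ℝ) * (1 + ‖t‖) ^ (-(k : ℝ))) *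
          (A * (1 + R) ^ (k : ℝ) * ‖x - x₀‖) := by
          rw [Real.rpow_natCast (1 + ‖t‖)]
          have : (t - x) - (t - x₀) = -(x - x₀) := by abel
          rw [this, norm_neg]
          ring
      _ = _ := by
          rw [← Real.rpow_add (by positivity)]
          simp
  have hcont : Filter.Tendsto (fun x => A * (1 + R) ^ (k : ℝ) * ‖x - x₀‖) (nhds x₀) (nhds 0) := by
    have : Continuous fun x => A * (1 + R) ^ (k : ℝ) * ‖x - x₀‖ := by fun_prop
    simpa using this.tendsto x₀
  filter_upwards [hcont.eventually (gt_mem_nhds hε), Metric.ball_mem_nhds x₀ one_pos]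
    with x hx hx1
  exact (key x (by simpa [dist_eq_norm] using hx1)).trans_lt hx

/-- Fourier conjugation turns modulations into translations, so continuity in `ξ` is inherited from
continuity of translations. -/
theorem smulLeftCLM_character_eq (ξ : Rn n) (ψ : 𝓢(Rn n, ℂ)) :
    SchwartzMap.smulLeftCLM ℂ (character ξ) ψ =
      𝓕⁻ (SchwartzMap.compSubConstCLM ℂ ((2 * Real.pi)⁻¹ • ξ) (𝓕 ψ)) := by
  rw [← FourierTransform.fourierInv_fourier_eq (F := 𝓢(Rn n, ℂ))
    (SchwartzMap.smulLeftCLM ℂ (character ξ) ψ)]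
  congr 1
  ext w
  rw [SchwartzMap.compSubConstCLM_apply, SchwartzMap.fourier_coe, SchwartzMap.fourier_coe,
    Real.fourier_eq', Real.fourier_eq']
  congr with v
  rw [SchwartzMap.smulLeftCLM_apply_apply (hasTemperateGrowth_character ξ), smul_eq_mul,
    smul_eq_mul, smul_eq_mul, ← mul_assoc, character, ← Complex.exp_add, inner_sub_right,
    real_inner_smul_right, real_inner_comm]
  congr 2
  push_cast
  have : (Real.pi : ℂ) ≠ 0 := by exact_mod_cast Real.pi_ne_zero
  field_simp
  rw [real_inner_comm v ξ]
  ring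

theorem continuous_smulLeftCLM_character (ψ : 𝓢(Rn n, ℂ)) :
    Continuous fun ξ : Rn n => SchwartzMap.smulLeftCLM ℂ (character ξ) ψ := by
  simp only [smulLeftCLM_character_eq]
  have h : Continuous fun f : 𝓢(Rn n, ℂ) => 𝓕⁻ f :=
    FourierTransform.continuous_fourierInv
  exact h.comp ((continuous_compSubConstCLM (𝓕 ψ)).comp (continuous_const_smul _))

theorem continuous_conjSchwartz : Continuous (conjSchwartz (n := n)) :=
  (SchwartzMap.postcompCLM (𝕜 := ℝ) (E := Rn n) (Complex.conjCLE : ℂ →L[ℝ] ℂ)).continuous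

theorem continuous_stft_right (φ : 𝓢(Rn n, ℂ)) (u : 𝓢'(Rn n, ℂ)) (x : Rn n) :
    Continuous fun ξ => stft φ u x ξ :=
  (map_continuous u).comp (continuous_conjSchwartz.comp (continuous_smulLeftCLM_character _))

theorem continuous_stft_left (φ : 𝓢(Rn n, ℂ)) (u : 𝓢'(Rn n, ℂ)) (ξ : Rn n) :
    Continuous fun x => stft φ u x ξ :=
  (map_continuous u).comp (continuous_conjSchwartz.comp
    ((SchwartzMap.smulLeftCLM ℂ (character ξ)).continuous.comp (continuous_compSubConstCLM φ)))

/-- Separate continuity is enough: a function continuous in one variable and measurable in the other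
is jointly measurable. -/
theorem measurable_stft (φ : 𝓢(Rn n, ℂ)) (u : 𝓢'(Rn n, ℂ)) :
    Measurable (Function.uncurry (stft φ u)) :=
  measurable_uncurry_of_continuous_of_measurable (continuous_stft_left φ u)
    fun x => (continuous_stft_right φ u x).measurable

end Continuity

/-! ### Reproducing formula of the short-time Fourier transform -/

section Reproducing

variable {n : ℕ}

theorem stft_coe_apply (φ f : 𝓢(Rn n, ℂ)) (y η : Rn n) :
    stft φ (f : 𝓢'(Rn n, ℂ)) y η = ∫ t, character (-η) t * (f t * conjSchwartz φ (-y + t)) := by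
  rw [stft, SchwartzMap.coe_apply]
  congr with t
  rw [conjSchwartz_apply, timeFrequencyShift_apply, map_mul, conj_character, smul_eq_mul,
    conjSchwartz_apply, neg_add_eq_sub]
  ring

theorem exists_norm_stft_le (φ f : 𝓢(Rn n, ℂ)) (N : ℕ) :
    ∃ C : ℝ, 0 ≤ C ∧ ∀ y η : Rn n, ‖stft φ (f : 𝓢'(Rn n, ℂ)) y η‖ ≤
      C * (1 + ‖η‖) ^ (-(N : ℝ)) * (1 + ‖y‖) ^ (-(N : ℝ)) := by
  obtain ⟨C, hC, k, h⟩ := exists_norm_integral_character_le f N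
  refine ⟨C * schwartzNorm k (conjSchwartz φ), by positivity, fun y η => ?_⟩
  have := h (conjSchwartz φ) 1 (by simp) (-y) η
  simpa only [one_smul, norm_neg, ← stft_coe_apply] using this

/-- The pointwise product of two Schwartz functions. -/
def mulSchwartz (f g : 𝓢(Rn n, ℂ)) : 𝓢(Rn n, ℂ) := SchwartzMap.smulLeftCLM ℂ f g

theorem mulSchwartz_apply (f g : 𝓢(Rn n, ℂ)) (x : Rn n) : mulSchwartz f g x = f x * g x := by
  rw [mulSchwartz, SchwartzMap.smulLeftCLM_apply_apply f.hasTemperateGrowth, smul_eq_mul]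

theorem integral_fourier_character (F : 𝓢(Rn n, ℂ)) (s : Rn n) :
    ∫ η, 𝓕 (F : Rn n → ℂ) ((2 * Real.pi)⁻¹ • η) * character η s
      = (((2 * Real.pi) ^ (n : ℝ) : ℝ) : ℂ) * F s := by
  have hpi : (0 : ℝ) < 2 * Real.pi := by positivity
  have e1 : ∀ η : Rn n, 𝓕 (F : Rn n → ℂ) ((2 * Real.pi)⁻¹ • η) * character η s
      = (fun ζ => 𝓕 (F : Rn n → ℂ) ζ * character ((2 * Real.pi) • ζ) s) ((2 * Real.pi)⁻¹ • η) := by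
    intro η
    simp only [smul_smul, mul_inv_cancel₀ hpi.ne', one_smul]
  rw [integral_congr_ae (Filter.Eventually.of_forall e1),
    integral_comp_smul_eq (fun ζ => 𝓕 (F : Rn n → ℂ) ζ * character ((2 * Real.pi) • ζ) s)
      (inv_pos.2 hpi), Real.inv_rpow hpi.le, ← Real.rpow_neg hpi.le, neg_neg]
  congr 1
  have e2 : F s = 𝓕⁻ (𝓕 (F : Rn n → ℂ)) s := by
    rw [← SchwartzMap.fourier_coe, ← SchwartzMap.fourierInv_coe]
    exact congrArg (fun g : 𝓢(Rn n, ℂ) => g s) (FourierTransform.fourierInv_fourier_eq F).symm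
  rw [e2, Real.fourierInv_eq']
  congr with ζ
  rw [smul_eq_mul, mul_comm, character, real_inner_smul_left]
  congr 2
  push_cast
  ring

/-- For fixed `y` the transform is the Fourier transform of `f` times the conjugate of the
translated window; this is Fourier inversion, the factor `(2π)^n` coming from the normalisation. -/
theorem integral_stft_mul_character (φ f : 𝓢(Rn n, ℂ)) (y s : Rn n) :
    ∫ η, stft φ (f : 𝓢'(Rn n, ℂ)) y η * character η s
      = (((2 * Real.pi) ^ (n : ℝ) : ℝ) : ℂ) * (f s * conj (φ (s - y))) := by
  have h := integral_fourier_character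
    (mulSchwartz f (conjSchwartz (SchwartzMap.compSubConstCLM ℂ y φ))) s
  rw [mulSchwartz_apply, conjSchwartz_apply, SchwartzMap.compSubConstCLM_apply] at h
  rw [← h]
  congr with η
  rw [stft_coe_apply, ← character_neg_mul_integral_eq_fourier]
  congr 2 with t
  rw [mulSchwartz_apply, conjSchwartz_apply, conjSchwartz_apply,
    SchwartzMap.compSubConstCLM_apply, neg_add_eq_sub]

/-- The constant `(2π)ⁿ ‖φ‖²` of the reproducing formula. -/
def reproConst (φ : 𝓢(Rn n, ℂ)) : ℝ := (2 * Real.pi) ^ (n : ℝ) * ∫ y, ‖φ y‖ ^ 2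

theorem integrable_norm_sq (φ : 𝓢(Rn n, ℂ)) : Integrable fun y => ‖φ y‖ ^ 2 := by
  have := (mulSchwartz φ (conjSchwartz φ)).integrable (μ := volume)
  refine this.norm.congr (Filter.Eventually.of_forall fun y => ?_)
  simp [mulSchwartz_apply, conjSchwartz_apply, sq]

theorem reproConst_pos {φ : 𝓢(Rn n, ℂ)} (hφ : φ ≠ 0) : 0 < reproConst φ := by
  refine mul_pos (by positivity) ?_
  obtain ⟨x, hx⟩ : ∃ x, φ x ≠ 0 := by
    by_contra! h
    exact hφ (SchwartzMap.ext h)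
  refine (integral_pos_iff_support_of_nonneg (fun y => by positivity) (integrable_norm_sq φ)).2 ?_
  refine IsOpen.measure_pos _ (by fun_prop : Continuous fun y => ‖φ y‖ ^ 2).isOpen_support
    ⟨x, by simpa using hx⟩

theorem integrable_reproducing (φ f : 𝓢(Rn n, ℂ)) {h : Rn n → ℂ} (hc : Continuous h) {B : ℝ}
    (hB : ∀ x, ‖h x‖ ≤ B) :
    Integrable (fun w : (Rn n × Rn n) × Rn n => stft φ (f : 𝓢'(Rn n, ℂ)) w.1.1 w.1.2 *
      (timeFrequencyShift w.1.1 w.1.2 φ w.2 * h w.2)) := by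
  have hB0 : 0 ≤ B := (norm_nonneg _).trans (hB 0)
  -- One half of the decay in `y` pays for Peetre's inequality, which converts decay in `s - y` into
  -- decay in `s`; the other half gives integrability.
  obtain ⟨C₁, hC₁, h₁⟩ := exists_norm_stft_le φ f (n + 1 + (n + 1))
  obtain ⟨C₂, hC₂, h₂⟩ := exists_norm_le_weight φ (n + 1)
  have hI : Integrable fun x : Rn n => (1 + ‖x‖) ^ (-((n : ℝ) + 1)) :=
    integrable_weight (by linarith)
  have hdom := ((hI.mul_prod hI).mul_prod hI).const_mul (C₁ * C₂ * B)
  refine hdom.mono' ?_ (Filter.Eventually.of_forall fun w => ?_)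
  · refine AEStronglyMeasurable.mul ?_ ?_
    · exact ((measurable_stft φ f).comp measurable_fst).aestronglyMeasurable
    · simp only [timeFrequencyShift_apply]
      exact (by fun_prop : Continuous fun w : (Rn n × Rn n) × Rn n =>
        character w.1.2 w.2 * φ (w.2 - w.1.1) * h w.2).aestronglyMeasurable
  · obtain ⟨⟨y, η⟩, s⟩ := w
    simp only [norm_mul, timeFrequencyShift_apply, norm_character, one_mul]
    have e1 : (1 + ‖η‖) ^ (-((n + 1 + (n + 1) : ℕ) : ℝ)) ≤ (1 + ‖η‖) ^ (-((n : ℝ) + 1)) := by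
      refine Real.rpow_le_rpow_of_exponent_le (by linarith [norm_nonneg η]) ?_
      push_cast
      linarith [(Nat.cast_nonneg n : (0 : ℝ) ≤ n)]
    have e2 : (1 + ‖s - y‖) ^ (-((n : ℝ) + 1)) ≤
        (1 + ‖s‖) ^ (-((n : ℝ) + 1)) * (1 + ‖y‖) ^ ((n : ℝ) + 1) := by
      have := one_add_norm_rpow_neg_add_le (r := (n : ℝ) + 1) (by positivity) s (-y)
      rwa [norm_neg, ← sub_eq_add_neg] at this
    calc ‖stft φ (f : 𝓢'(Rn n, ℂ)) y η‖ * (‖φ (s - y)‖ * ‖h s‖)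
        ≤ (C₁ * (1 + ‖η‖) ^ (-((n : ℝ) + 1)) * (1 + ‖y‖) ^ (-((n + 1 + (n + 1) : ℕ) : ℝ))) *
          ((C₂ * ((1 + ‖s‖) ^ (-((n : ℝ) + 1)) * (1 + ‖y‖) ^ ((n : ℝ) + 1))) * B) := by
          gcongr
          · refine (h₁ y η).trans ?_
            gcongr
          · refine (h₂ _).trans ?_
            gcongr
          · exact hB s
      _ = C₁ * C₂ * B * (((1 + ‖y‖) ^ (-((n + 1 + (n + 1) : ℕ) : ℝ)) * (1 + ‖y‖) ^ ((n : ℝ) + 1)) *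
          (1 + ‖η‖) ^ (-((n : ℝ) + 1)) * (1 + ‖s‖) ^ (-((n : ℝ) + 1))) := by ring
      _ = _ := by
          rw [← Real.rpow_add (by positivity)]
          push_cast
          ring_nf

/-- The reproducing formula for the short-time Fourier transform of a Schwartz function, tested
against a bounded continuous function. -/
theorem integral_stft_mul_eq (φ f : 𝓢(Rn n, ℂ)) {h : Rn n → ℂ} (hc : Continuous h) {B : ℝ}
    (hB : ∀ x, ‖h x‖ ≤ B) :
    ∫ z : Rn n × Rn n, stft φ (f : 𝓢'(Rn n, ℂ)) z.1 z.2 *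
      (∫ s, timeFrequencyShift z.1 z.2 φ s * h s) = reproConst φ * ∫ s, f s * h s := by
  have hint := integrable_reproducing φ f hc hB
  have hs : ∀ s : Rn n, Integrable fun z : Rn n × Rn n => stft φ (f : 𝓢'(Rn n, ℂ)) z.1 z.2 *
      (timeFrequencyShift z.1 z.2 φ s * h s) := by
    intro s
    obtain ⟨C₁, hC₁, h₁⟩ := exists_norm_stft_le φ f (n + 1)
    obtain ⟨C₂, hC₂, h₂⟩ := exists_norm_le_weight φ 0
    have hI : Integrable fun x : Rn n => (1 + ‖x‖) ^ (-((n : ℝ) + 1)) :=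
      integrable_weight (by linarith)
    refine ((hI.mul_prod hI).const_mul (C₁ * (C₂ * ‖h s‖))).mono' ?_
      (Filter.Eventually.of_forall fun z => ?_)
    · refine AEStronglyMeasurable.mul ?_ ?_
      · exact (measurable_stft φ f).aestronglyMeasurable
      · simp only [timeFrequencyShift_apply]
        exact (by fun_prop : Continuous fun z : Rn n × Rn n =>
          character z.2 s * φ (s - z.1) * h s).aestronglyMeasurable
    · simp only [norm_mul, timeFrequencyShift_apply, norm_character, one_mul]
      calc ‖stft φ (f : 𝓢'(Rn n, ℂ)) z.1 z.2‖ * (‖φ (s - z.1)‖ * ‖h s‖)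
          ≤ (C₁ * (1 + ‖z.2‖) ^ (-((n + 1 : ℕ) : ℝ)) * (1 + ‖z.1‖) ^ (-((n + 1 : ℕ) : ℝ))) *
            (C₂ * ‖h s‖) := by
            gcongr
            · exact h₁ _ _
            · simpa using h₂ (s - z.1)
        _ = _ := by push_cast; ring
  calc ∫ z : Rn n × Rn n, stft φ (f : 𝓢'(Rn n, ℂ)) z.1 z.2 *
        (∫ s, timeFrequencyShift z.1 z.2 φ s * h s)
      = ∫ z : Rn n × Rn n, ∫ s, stft φ (f : 𝓢'(Rn n, ℂ)) z.1 z.2 *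
        (timeFrequencyShift z.1 z.2 φ s * h s) := by
        simp only [integral_const_mul]
    _ = ∫ s, ∫ z : Rn n × Rn n, stft φ (f : 𝓢'(Rn n, ℂ)) z.1 z.2 *
        (timeFrequencyShift z.1 z.2 φ s * h s) := integral_integral_swap hint
    -- For fixed `s`, the `η` integral is Fourier inversion and leaves `|φ(s - y)|²`, whose `y`
    -- integral is the squared norm of the window.
    _ = ∫ s, reproConst φ * (f s * h s) := by
        congr with s
        rw [Measure.volume_eq_prod, integral_prod _ (hs s)]
        simp only [timeFrequencyShift_apply]
        have e1 : ∀ y, ∫ η, stft φ (f : 𝓢'(Rn n, ℂ)) y η * (character η s * φ (s - y) * h s)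
            = (((2 * Real.pi) ^ (n : ℝ) : ℝ) : ℂ) * f s * h s * ((‖φ (s - y)‖ ^ 2 : ℝ) : ℂ) := by
          intro y
          have : ∀ η, stft φ (f : 𝓢'(Rn n, ℂ)) y η * (character η s * φ (s - y) * h s)
              = stft φ (f : 𝓢'(Rn n, ℂ)) y η * character η s * (φ (s - y) * h s) := fun η => by
            ring
          simp only [this]
          rw [integral_mul_const, integral_stft_mul_character]
          have e : ((‖φ (s - y)‖ ^ 2 : ℝ) : ℂ) = φ (s - y) * conj (φ (s - y)) := by
            rw [Complex.mul_conj, Complex.normSq_eq_norm_sq]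
          rw [e]
          ring
        simp only [e1]
        rw [integral_const_mul, integral_sub_left_eq_self (fun y => ((‖φ y‖ ^ 2 : ℝ) : ℂ)) volume s,
          integral_complex_ofReal, reproConst]
        push_cast
        ring
    _ = _ := integral_const_mul _ _

end Reproducing

/-! ### Riesz potentials as superpositions of dilated bumps -/

section Subordination

variable {n : ℕ}

theorem hasCompactSupport_smoothTransition :
    HasCompactSupport fun ζ : Rn n => ((Real.smoothTransition (2 - ‖ζ‖ ^ 2) : ℝ) : ℂ) := by
  refine HasCompactSupport.intro (isCompact_closedBall (0 : Rn n) 2) fun ζ hζ => ?_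
  have h : 2 < ‖ζ‖ := by simpa using hζ
  rw [Real.smoothTransition.zero_of_nonpos (by nlinarith), Complex.ofReal_zero]

theorem contDiff_smoothTransition :
    ContDiff ℝ (⊤ : ℕ∞) fun ζ : Rn n => ((Real.smoothTransition (2 - ‖ζ‖ ^ 2) : ℝ) : ℂ) :=
  Complex.ofRealCLM.contDiff.comp
    (Real.smoothTransition.contDiff.comp (contDiff_const.sub (contDiff_norm_sq ℝ)))

/-- A radial bump function, equal to `1` on the unit ball. -/
def bump : 𝓢(Rn n, ℂ) :=
  hasCompactSupport_smoothTransition.toSchwartzMap contDiff_smoothTransition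

theorem bump_apply (ζ : Rn n) : bump ζ = ((Real.smoothTransition (2 - ‖ζ‖ ^ 2) : ℝ) : ℂ) := rfl

/-- The radial profile of `bump` in the logarithmic variable. -/
def bumpLog (τ : ℝ) : ℝ := Real.smoothTransition (2 - Real.exp τ ^ 2)

theorem bumpLog_nonneg (τ : ℝ) : 0 ≤ bumpLog τ := Real.smoothTransition.nonneg _

theorem continuous_bumpLog : Continuous bumpLog :=
  Real.smoothTransition.continuous.comp (by fun_prop)

theorem bump_exp_smul {ζ : Rn n} (hζ : ζ ≠ 0) (τ : ℝ) :
    bump (Real.exp τ • ζ) = ((bumpLog (τ + Real.log ‖ζ‖) : ℝ) : ℂ) := by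
  rw [bump_apply, bumpLog, norm_smul, Real.norm_eq_abs, Real.abs_exp, Real.exp_add,
    Real.exp_log (norm_pos_iff.2 hζ)]

theorem integrable_exp_mul_bumpLog {α : ℝ} (hα : 0 < α) :
    Integrable fun τ => Real.exp (α * τ) * bumpLog τ := by
  have h := (integrable_indicator_iff measurableSet_Iic).2 (integrableOn_exp_mul_Iic hα 1)
  refine h.mono' ((by fun_prop : Continuous fun τ => Real.exp (α * τ)).mul
    continuous_bumpLog).aestronglyMeasurable (Filter.Eventually.of_forall fun τ => ?_)
  rw [Real.norm_of_nonneg (mul_nonneg (Real.exp_pos _).le (bumpLog_nonneg _))]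
  by_cases hτ : τ ≤ 1
  · rw [Set.indicator_of_mem (Set.mem_Iic.2 hτ)]
    exact mul_le_of_le_one_right (Real.exp_pos _).le (Real.smoothTransition.le_one _)
  · rw [Set.indicator_of_notMem (by simpa using hτ), bumpLog,
      Real.smoothTransition.zero_of_nonpos, mul_zero]
    have : τ + 1 ≤ Real.exp τ := Real.add_one_le_exp τ
    nlinarith [not_le.1 hτ]

/-- The normalising constant in the representation of `(2π‖ζ‖)^{-α}` as a superposition of
dilated bumps. -/
def subordConst (α : ℝ) : ℝ := (2 * Real.pi) ^ (-α) / ∫ τ, Real.exp (α * τ) * bumpLog τ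

theorem integral_exp_mul_bumpLog_pos {α : ℝ} (hα : 0 < α) :
    0 < ∫ τ, Real.exp (α * τ) * bumpLog τ := by
  refine (integral_pos_iff_support_of_nonneg (fun τ => mul_nonneg (Real.exp_pos _).le
    (bumpLog_nonneg _)) (integrable_exp_mul_bumpLog hα)).2 ?_
  refine IsOpen.measure_pos _ ((by fun_prop : Continuous fun τ => Real.exp (α * τ)).mul
    continuous_bumpLog).isOpen_support ⟨0, ?_⟩
  simp [bumpLog, Real.smoothTransition.one_of_one_le (show (1 : ℝ) ≤ 2 - 1 by norm_num)]

theorem subordConst_pos {α : ℝ} (hα : 0 < α) : 0 < subordConst α :=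
  div_pos (by positivity) (integral_exp_mul_bumpLog_pos hα)

theorem exp_mul_bumpLog_add (α τ : ℝ) {r : ℝ} (hr : 0 < r) :
    Real.exp (α * τ) * bumpLog (τ + Real.log r)
      = r ^ (-α) * (Real.exp (α * (τ + Real.log r)) * bumpLog (τ + Real.log r)) := by
  rw [Real.rpow_def_of_pos hr, ← mul_assoc, ← Real.exp_add]
  ring_nf

theorem integrable_exp_mul_bumpLog_add {α : ℝ} (hα : 0 < α) {r : ℝ} (hr : 0 < r) :
    Integrable fun τ => Real.exp (α * τ) * bumpLog (τ + Real.log r) := by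
  simp only [exp_mul_bumpLog_add α _ hr]
  exact ((integrable_exp_mul_bumpLog hα).comp_add_right (Real.log r)).const_mul _

/-- In the logarithmic scale, dilation by `r` is a translation of `τ`; the weight `e^(ατ)` turns it
into the factor `r^(-α)`. -/
theorem subordConst_mul_integral {α : ℝ} (hα : 0 < α) {r : ℝ} (hr : 0 < r) :
    subordConst α * ∫ τ, Real.exp (α * τ) * bumpLog (τ + Real.log r)
      = (2 * Real.pi * r) ^ (-α) := by
  simp only [exp_mul_bumpLog_add α _ hr]
  rw [integral_const_mul, integral_add_right_eq_self (fun τ => Real.exp (α * τ) * bumpLog τ),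
    Real.mul_rpow (by positivity) hr.le, subordConst]
  field_simp [(integral_exp_mul_bumpLog_pos hα).ne']

/-- The bilinear form of the Riesz potential of order `α`. -/
def rieszForm (α : ℝ) (f g : 𝓢(Rn n, ℂ)) : ℂ :=
  ∫ ζ, (((2 * Real.pi * ‖ζ‖) ^ (-α) : ℝ) : ℂ) * (𝓕 f ζ * 𝓕⁻ g ζ)

theorem integrable_rpow_mul_schwartz {α : ℝ} (hα : 0 ≤ α) (hαn : α < n) (f : 𝓢(Rn n, ℂ)) :
    Integrable fun ζ : Rn n => (((2 * Real.pi * ‖ζ‖) ^ (-α) : ℝ) : ℂ) * f ζ := by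
  obtain ⟨C, hC, h⟩ := exists_norm_le_weight f (n + 1)
  have hdom := (integrable_norm_rpow_mul (K := n + 1) hα hαn (by linarith)).const_mul
    ((2 * Real.pi) ^ (-α) * C)
  refine hdom.mono' ?_ (Filter.Eventually.of_forall fun ζ => ?_)
  · refine AEStronglyMeasurable.mul ?_ f.continuous.aestronglyMeasurable
    exact (by fun_prop : Measurable fun ζ : Rn n =>
      (((2 * Real.pi * ‖ζ‖) ^ (-α) : ℝ) : ℂ)).aestronglyMeasurable
  · rw [norm_mul, Complex.norm_real, Real.norm_of_nonneg (by positivity),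
      Real.mul_rpow (by positivity) (norm_nonneg _)]
    calc (2 * Real.pi) ^ (-α) * ‖ζ‖ ^ (-α) * ‖f ζ‖
        ≤ (2 * Real.pi) ^ (-α) * ‖ζ‖ ^ (-α) * (C * (1 + ‖ζ‖) ^ (-((n : ℝ) + 1))) := by
          gcongr; exact h ζ
      _ = _ := by ring

/-- The bilinear form of the Fourier multiplier with symbol `bump (t · )`. -/
def bumpForm (t : ℝ) (f g : 𝓢(Rn n, ℂ)) : ℂ := ∫ ζ, bump (t • ζ) * (𝓕 f ζ * 𝓕⁻ g ζ)

/-- The subordination formula integrated against `𝓕 f · 𝓕⁻ g`. Applied to absolute values it also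
justifies Fubini, since the singularity `‖ζ‖^(-α)` is integrable for `α < n`. -/
theorem rieszForm_eq_integral_bumpForm {α : ℝ} (hα : 0 < α) (hαn : α < n) (f g : 𝓢(Rn n, ℂ)) :
    rieszForm α f g
      = subordConst α * ∫ τ : ℝ, ((Real.exp (α * τ) : ℝ) : ℂ) * bumpForm (Real.exp τ) f g := by
  have hn : 0 < n := by exact_mod_cast hα.trans hαn
  have : Nonempty (Fin n) := ⟨⟨0, hn⟩⟩
  have hae : ∀ᵐ ζ : Rn n, ζ ≠ 0 := by
    simp [ae_iff]
  set G : 𝓢(Rn n, ℂ) := mulSchwartz (𝓕 f) (𝓕⁻ g) with hG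
  have hGa : ∀ ζ, 𝓕 f ζ * 𝓕⁻ g ζ = G ζ := fun ζ => (mulSchwartz_apply _ _ _).symm
  simp only [rieszForm, bumpForm, hGa]
  have hint : Integrable (fun z : Rn n × ℝ => ((Real.exp (α * z.2) : ℝ) : ℂ) *
      (bump (Real.exp z.2 • z.1) * G z.1)) := by
    have hm : AEStronglyMeasurable (fun z : Rn n × ℝ => ((Real.exp (α * z.2) : ℝ) : ℂ) *
      (bump (Real.exp z.2 • z.1) * G z.1)) :=
      (by fun_prop : Continuous _).aestronglyMeasurable
    have e : ∀ ζ : Rn n, ζ ≠ 0 → ∀ τ, ((Real.exp (α * τ) : ℝ) : ℂ) *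
        (bump (Real.exp τ • ζ) * G ζ)
        = ((Real.exp (α * τ) * bumpLog (τ + Real.log ‖ζ‖) : ℝ) : ℂ) * G ζ := by
      intro ζ hζ τ
      rw [bump_exp_smul hζ]
      push_cast
      ring
    refine (integrable_prod_iff hm).2 ⟨?_, ?_⟩
    · filter_upwards [hae] with ζ hζ
      simp only [e ζ hζ]
      exact ((integrable_exp_mul_bumpLog_add hα (norm_pos_iff.2 hζ)).ofReal).mul_const _
    · refine ((integrable_rpow_mul_schwartz hα.le hαn G).norm.const_mul (subordConst α)⁻¹).congr ?_
      filter_upwards [hae] with ζ hζ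
      have e2 : ∀ τ, ‖((Real.exp (α * τ) * bumpLog (τ + Real.log ‖ζ‖) : ℝ) : ℂ) * G ζ‖
          = Real.exp (α * τ) * bumpLog (τ + Real.log ‖ζ‖) * ‖G ζ‖ := by
        intro τ
        rw [norm_mul, Complex.norm_real, Real.norm_of_nonneg
          (mul_nonneg (Real.exp_pos _).le (bumpLog_nonneg _))]
      simp only [e ζ hζ, e2]
      rw [integral_mul_const, norm_mul, Complex.norm_real, Real.norm_of_nonneg (by positivity),
        ← subordConst_mul_integral hα (norm_pos_iff.2 hζ)]
      field_simp [(subordConst_pos hα).ne']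
  have e3 : ∀ τ : ℝ, ((Real.exp (α * τ) : ℝ) : ℂ) * ∫ ζ, bump (Real.exp τ • ζ) * G ζ
      = ∫ ζ, ((Real.exp (α * τ) : ℝ) : ℂ) * (bump (Real.exp τ • ζ) * G ζ) := fun τ =>
    (integral_const_mul _ _).symm
  simp only [e3]
  rw [← integral_integral_swap (f := fun (ζ : Rn n) (τ : ℝ) => ((Real.exp (α * τ) : ℝ) : ℂ) *
    (bump (Real.exp τ • ζ) * G ζ)) hint, ← integral_const_mul]
  refine integral_congr_ae ?_
  filter_upwards [hae] with ζ hζ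
  rw [← subordConst_mul_integral hα (norm_pos_iff.2 hζ)]
  have e4 : ∀ τ : ℝ, ((Real.exp (α * τ) : ℝ) : ℂ) * (bump (Real.exp τ • ζ) * G ζ)
        = ((Real.exp (α * τ) * bumpLog (τ + Real.log ‖ζ‖) : ℝ) : ℂ) * G ζ := by
    intro τ
    rw [bump_exp_smul hζ]
    push_cast
    ring
  simp only [e4]
  rw [integral_mul_const, integral_complex_ofReal]
  push_cast
  ring

/-- The inverse Fourier transform of `bump`. -/
def bumpKernel : 𝓢(Rn n, ℂ) := 𝓕⁻ (bump : 𝓢(Rn n, ℂ))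

/-- The multiplier acts by convolution with a rescaled Schwartz kernel, so the form is an average of
the correlation of `f` and `g` over translations of length about `t`. -/
theorem bumpForm_eq (t : ℝ) (f g : 𝓢(Rn n, ℂ)) :
    bumpForm t f g = ∫ v, bumpKernel v * ∫ z, f z * g (z + t • v) := by
  have hker : ∀ ζ : Rn n, bump ζ = ∫ v, character (-((2 * Real.pi) • ζ)) v * bumpKernel v := by
    intro ζ
    rw [character_neg_mul_integral_eq_fourier, smul_smul, inv_mul_cancel₀ (by positivity), one_smul,
      ← SchwartzMap.fourier_coe, bumpKernel, FourierTransform.fourier_fourierInv_eq]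
  have hchar : ∀ v ζ : Rn n, character (-((2 * Real.pi) • (t • ζ))) v
      = character (-((2 * Real.pi) • (t • v))) ζ := by
    intro v ζ
    simp only [character, inner_neg_left, real_inner_smul_left, real_inner_comm v ζ]
  set H : Rn n → 𝓢(Rn n, ℂ) := fun v =>
    SchwartzMap.smulLeftCLM ℂ (character (-((2 * Real.pi) • (t • v)))) (𝓕⁻ g) with hH
  have hHa : ∀ v ζ, H v ζ = character (-((2 * Real.pi) • (t • v))) ζ * 𝓕⁻ g ζ := fun v ζ => by
    simp only [hH, SchwartzMap.smulLeftCLM_apply_apply (hasTemperateGrowth_character _),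
      smul_eq_mul]
  have hg : ∀ v z : Rn n, g (z + t • v) = 𝓕 (H v) z := by
    intro v z
    have e1 := character_neg_mul_integral_eq_fourier (H v) ((2 * Real.pi) • z)
    have e2 := character_neg_mul_integral_eq_fourier (𝓕⁻ g : 𝓢(Rn n, ℂ))
      ((2 * Real.pi) • (z + t • v))
    rw [smul_smul, inv_mul_cancel₀ (by positivity), one_smul, ← SchwartzMap.fourier_coe] at e1 e2
    rw [FourierTransform.fourier_fourierInv_eq] at e2
    rw [← e1, ← e2]
    congr with ζ
    rw [hHa, smul_add, neg_add, character_add_left, mul_assoc]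
  have hW : ∀ v, ∫ z, f z * g (z + t • v) = ∫ ζ, 𝓕 f ζ * H v ζ := by
    intro v
    rw [SchwartzMap.integral_fourier_mul_eq]
    simp only [hg]
  simp only [hW]
  have e1 : ∀ v, bumpKernel v * ∫ ζ, 𝓕 f ζ * H v ζ
      = ∫ ζ, bumpKernel v * (character (-((2 * Real.pi) • (t • ζ))) v * (𝓕 f ζ * 𝓕⁻ g ζ)) := by
    intro v
    rw [← integral_const_mul]
    congr with ζ
    rw [hHa, hchar]
    ring
  simp only [e1]
  rw [integral_integral_swap, bumpForm]
  · congr with ζ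
    rw [hker, ← integral_mul_const]
    congr with v
    ring
  · have hG := (mulSchwartz (𝓕 f) (𝓕⁻ g)).integrable (μ := volume)
    refine ((bumpKernel (n := n)).integrable (μ := volume)).norm.mul_prod hG.norm |>.mono' ?_
      (Filter.Eventually.of_forall fun z => ?_)
    · have h1 : Continuous fun z : Rn n × Rn n => (-((2 * Real.pi) • (t • z.2)), z.1) := by fun_prop
      exact ((bumpKernel.continuous.comp continuous_fst).mul
        ((continuous_character.comp h1).mul (by fun_prop))).aestronglyMeasurable
    · simp only [Function.uncurry, norm_mul, norm_character, one_mul, mulSchwartz_apply, le_refl]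

end Subordination

/-! ### Integration over scales -/

section TimeIntegral

variable {n : ℕ}

theorem integrable_exp_mul_max {γ K : ℝ} (hγ : 0 < γ) (hK : γ < K) :
    Integrable fun τ => Real.exp (γ * τ) * max 1 (Real.exp τ) ^ (-K) := by
  rw [← integrableOn_univ, ← Set.Iic_union_Ioi (a := (0 : ℝ))]
  refine IntegrableOn.union ?_ ?_
  · refine (integrableOn_exp_mul_Iic hγ 0).congr_fun (fun τ hτ => ?_) measurableSet_Iic
    simp [max_eq_left (Real.exp_le_one_iff.2 hτ)]
  · refine (integrableOn_exp_mul_Ioi (a := γ - K) (by linarith) 0).congr_fun (fun τ hτ => ?_)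
      measurableSet_Ioi
    have : (1 : ℝ) ≤ Real.exp τ := Real.one_le_exp (Set.mem_Ioi.1 hτ).le
    simp only [max_eq_right this, ← Real.exp_mul, ← Real.exp_add]
    ring_nf

theorem exp_mul_max_eq (γ K τ : ℝ) {W : ℝ} (hW : 0 < W) :
    Real.exp (γ * τ) * max 1 (Real.exp τ * W) ^ (-K) = W ^ (-γ) *
      (Real.exp (γ * (τ + Real.log W)) * max 1 (Real.exp (τ + Real.log W)) ^ (-K)) := by
  rw [Real.rpow_def_of_pos hW, ← mul_assoc, ← Real.exp_add, Real.exp_add τ, Real.exp_log hW]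
  ring_nf

theorem integrable_exp_mul_max_mul {γ K : ℝ} (hγ : 0 < γ) (hK : γ < K) {W : ℝ} (hW : 0 < W) :
    Integrable fun τ => Real.exp (γ * τ) * max 1 (Real.exp τ * W) ^ (-K) := by
  simp only [exp_mul_max_eq γ K _ hW]
  exact ((integrable_exp_mul_max hγ hK).comp_add_right (Real.log W)).const_mul _

theorem integral_exp_mul_max_mul (γ K : ℝ) {W : ℝ} (hW : 0 < W) :
    ∫ τ, Real.exp (γ * τ) * max 1 (Real.exp τ * W) ^ (-K)
      = W ^ (-γ) * ∫ τ, Real.exp (γ * τ) * max 1 (Real.exp τ) ^ (-K) := by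
  simp only [exp_mul_max_eq γ K _ hW]
  rw [integral_const_mul, integral_add_right_eq_self
    (fun τ => Real.exp (γ * τ) * max 1 (Real.exp τ) ^ (-K))]

theorem one_add_norm_smul_rpow_le {s K : ℝ} (hs : 0 ≤ s) (hs1 : s ≤ 1) (hK : 0 ≤ K) (x : Rn n) :
    (1 + ‖s • x‖) ^ (-K) ≤ max 1 (s * (1 + ‖x‖)) ^ (-K) := by
  refine Real.rpow_le_rpow_of_nonpos (by positivity) ?_ (by linarith)
  rw [norm_smul, Real.norm_of_nonneg hs]
  refine max_le ?_ ?_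
  · nlinarith [norm_nonneg x, mul_nonneg hs (norm_nonneg x)]
  · nlinarith [norm_nonneg x]

/-- Scales below `1` have frequency cutoff at `e^(-τ)`, and integrating `e^(ατ)` up to there gives
`(1+‖ξ‖)^(-α)` with full decay in `a`. Scales above `1` carry `e^((α-n)τ)` and matter only beyond
`e^τ ~ 1+‖a‖`, which gives `(1+‖a‖)^(-(n-α))` with full decay in `ξ`. The assumption `N > n` covers
both `N > α` and `N > n - α`. -/
theorem exists_norm_integral_exp_le {α : ℝ} (hα : 0 < α) (hαn : α < n) {N : ℝ} (hN : n < N) :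
    ∃ C : ℝ, 0 ≤ C ∧ ∀ (ξ a : Rn n) (A : ℝ) (b : ℝ → ℂ), 0 ≤ A →
      (∀ τ, ‖b τ‖ ≤ A * (1 + ‖min (Real.exp τ) 1 • ξ‖) ^ (-N) * scaleWt N (Real.exp τ) a) →
      ‖∫ τ, ((Real.exp (α * τ) : ℝ) : ℂ) * b τ‖ ≤
        C * A * (1 + ‖ξ‖) ^ (-α) * (1 + ‖a‖) ^ (-(n - α)) := by
  set D : ℝ → ℝ := fun γ => ∫ τ, Real.exp (γ * τ) * max 1 (Real.exp τ) ^ (-N) with hD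
  have hD0 : ∀ γ, 0 ≤ D γ := fun γ => integral_nonneg fun τ => by positivity
  refine ⟨D α + D (n - α), add_nonneg (hD0 _) (hD0 _), fun ξ a A b hA hb => ?_⟩
  have hN0 : 0 ≤ N := (Nat.cast_nonneg n).trans hN.le
  have hξ : 0 < 1 + ‖ξ‖ := by positivity
  have ha : 0 < 1 + ‖a‖ := by positivity
  have hi₁ := (integrable_exp_mul_max_mul hα (hαn.trans hN) hξ).const_mul ((1 + ‖a‖) ^ (-N))
  have hi₂ := ((integrable_exp_mul_max_mul (sub_pos.2 hαn)
    (by linarith : n - α < N) ha).comp_neg).const_mul ((1 + ‖ξ‖) ^ (-N))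
  have hle := norm_integral_le_of_norm_le (f := fun τ => ((Real.exp (α * τ) : ℝ) : ℂ) * b τ)
    ((hi₁.add hi₂).const_mul A) (Filter.Eventually.of_forall fun τ => ?_)
  · refine hle.trans ?_
    simp only [Pi.add_apply]
    rw [integral_const_mul, integral_add hi₁ hi₂, integral_const_mul, integral_const_mul,
      integral_neg_eq_self (fun τ => Real.exp ((n - α) * τ) * max 1 (Real.exp τ * (1 + ‖a‖)) ^ (-N)),
      integral_exp_mul_max_mul _ _ hξ, integral_exp_mul_max_mul _ _ ha]
    have h1 : (1 + ‖a‖) ^ (-N) ≤ (1 + ‖a‖) ^ (-(n - α)) :=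
      Real.rpow_le_rpow_of_exponent_le (by linarith [norm_nonneg a]) (by linarith)
    have h2 : (1 + ‖ξ‖) ^ (-N) ≤ (1 + ‖ξ‖) ^ (-α) :=
      Real.rpow_le_rpow_of_exponent_le (by linarith [norm_nonneg ξ]) (by linarith)
    calc A * ((1 + ‖a‖) ^ (-N) * ((1 + ‖ξ‖) ^ (-α) * D α) +
          (1 + ‖ξ‖) ^ (-N) * ((1 + ‖a‖) ^ (-(n - α)) * D (n - α)))
        ≤ A * ((1 + ‖a‖) ^ (-(n - α)) * ((1 + ‖ξ‖) ^ (-α) * D α) +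
          (1 + ‖ξ‖) ^ (-α) * ((1 + ‖a‖) ^ (-(n - α)) * D (n - α))) := by
          have := hD0 α
          have := hD0 (n - α)
          gcongr
      _ = _ := by ring
  · rw [norm_mul, Complex.norm_real, Real.norm_of_nonneg (Real.exp_pos _).le]
    refine (mul_le_mul_of_nonneg_left (hb τ) (Real.exp_pos _).le).trans ?_
    have key : Real.exp (α * τ) * ((1 + ‖min (Real.exp τ) 1 • ξ‖) ^ (-N) *
        scaleWt N (Real.exp τ) a) ≤
        (1 + ‖a‖) ^ (-N) * (Real.exp (α * τ) * max 1 (Real.exp τ * (1 + ‖ξ‖)) ^ (-N)) +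
        (1 + ‖ξ‖) ^ (-N) *
          (Real.exp ((n - α) * -τ) * max 1 (Real.exp (-τ) * (1 + ‖a‖)) ^ (-N)) := by
      by_cases hτ : τ ≤ 0
      · have h1 : Real.exp τ ≤ 1 := Real.exp_le_one_iff.2 hτ
        rw [scaleWt, if_pos h1, min_eq_left h1]
        have := one_add_norm_smul_rpow_le (Real.exp_pos τ).le h1 hN0 ξ
        refine le_add_of_le_of_nonneg ?_ (by positivity)
        calc Real.exp (α * τ) * ((1 + ‖Real.exp τ • ξ‖) ^ (-N) * (1 + ‖a‖) ^ (-N))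
            ≤ Real.exp (α * τ) * (max 1 (Real.exp τ * (1 + ‖ξ‖)) ^ (-N) * (1 + ‖a‖) ^ (-N)) := by
              gcongr
          _ = _ := by ring
      · have h1 : ¬ Real.exp τ ≤ 1 := by rwa [Real.exp_le_one_iff]
        rw [scaleWt, if_neg h1, min_eq_right (not_le.1 h1).le, one_smul, ← Real.exp_neg,
          ← Real.exp_mul]
        have h2 : Real.exp (-τ) ≤ 1 := Real.exp_le_one_iff.2 (by linarith)
        have := one_add_norm_smul_rpow_le (Real.exp_pos (-τ)).le h2 hN0 a
        refine le_add_of_nonneg_of_le (by positivity) ?_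
        calc Real.exp (α * τ) * ((1 + ‖ξ‖) ^ (-N) *
              (Real.exp (τ * -(n : ℝ)) * (1 + ‖Real.exp (-τ) • a‖) ^ (-N)))
            ≤ Real.exp (α * τ) * ((1 + ‖ξ‖) ^ (-N) *
              (Real.exp (τ * -(n : ℝ)) * max 1 (Real.exp (-τ) * (1 + ‖a‖)) ^ (-N))) := by
              gcongr
          _ = (1 + ‖ξ‖) ^ (-N) * ((Real.exp (α * τ) * Real.exp (τ * -(n : ℝ))) *
              max 1 (Real.exp (-τ) * (1 + ‖a‖)) ^ (-N)) := by ring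
          _ = _ := by rw [← Real.exp_add]; ring_nf
    simp only [Pi.add_apply]
    calc _ = A * (Real.exp (α * τ) * ((1 + ‖min (Real.exp τ) 1 • ξ‖) ^ (-N) *
        scaleWt N (Real.exp τ) a)) := by ring
      _ ≤ _ := by gcongr

end TimeIntegral

/-! ### Bump forms with localised correlation -/

section FormBounds

variable {n : ℕ}

/-- For `t ≤ 1` the displacement `t v` is absorbed by the decay of `ψ`, which also supplies
integrability in `v`. For `t > 1` the decay of `ψ` is used at `v = -t⁻¹ a + t⁻¹ (a + t v)`, and
integrability comes from the variable `a + t v`, with Jacobian `t^(-n)`. -/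
theorem exists_integral_kernel_le (ψ : 𝓢(Rn n, ℂ)) {N : ℝ} (hN : 0 ≤ N) :
    ∃ C : ℝ, 0 ≤ C ∧ ∀ t, 0 < t → ∀ a : Rn n,
      Integrable (fun v => ‖ψ v‖ * (1 + ‖a + t • v‖) ^ (-(N + n + 1))) ∧
      ∫ v, ‖ψ v‖ * (1 + ‖a + t • v‖) ^ (-(N + n + 1)) ≤ C * scaleWt N t a := by
  obtain ⟨C₁, hC₁, h₁⟩ := exists_norm_le_weight ψ N
  obtain ⟨C₂, hC₂, h₂⟩ := exists_norm_le_weight ψ (N + N + n + 1)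
  have hI : Integrable fun x : Rn n => (1 + ‖x‖) ^ (-((n : ℝ) + 1)) :=
    integrable_weight (by linarith)
  set I := ∫ x : Rn n, (1 + ‖x‖) ^ (-((n : ℝ) + 1)) with hIdef
  have hI0 : 0 ≤ I := integral_nonneg fun x => by positivity
  have hn0 : (0 : ℝ) ≤ n := Nat.cast_nonneg n
  refine ⟨(C₁ + C₂) * I, by positivity, fun t ht a => ?_⟩
  have hint : Integrable (fun v => ‖ψ v‖ * (1 + ‖a + t • v‖) ^ (-(N + n + 1))) := by
    refine (ψ.integrable (μ := volume)).norm.mono' ?_ (Filter.Eventually.of_forall fun v => ?_)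
    · exact (by fun_prop : Measurable fun v : Rn n => ‖ψ v‖ *
        (1 + ‖a + t • v‖) ^ (-(N + n + 1))).aestronglyMeasurable
    · rw [Real.norm_of_nonneg (by positivity)]
      exact mul_le_of_le_one_right (norm_nonneg _) (Real.rpow_le_one_of_one_le_of_nonpos
        (by linarith [norm_nonneg (a + t • v)]) (by linarith))
  refine ⟨hint, ?_⟩
  by_cases h : t ≤ 1
  · rw [scaleWt, if_pos h]
    have hle : ∀ v, ‖ψ v‖ * (1 + ‖a + t • v‖) ^ (-(N + n + 1)) ≤
        C₂ * (1 + ‖a‖) ^ (-N) * (1 + ‖v‖) ^ (-((n : ℝ) + 1)) := by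
      intro v
      calc ‖ψ v‖ * (1 + ‖a + t • v‖) ^ (-(N + n + 1))
          ≤ (C₂ * (1 + ‖v‖) ^ (-(N + N + n + 1))) * ((1 + ‖a‖) ^ (-N) * (1 + ‖v‖) ^ N) := by
            gcongr
            · exact h₂ v
            · calc (1 + ‖a + t • v‖) ^ (-(N + n + 1)) ≤ (1 + ‖a + t • v‖) ^ (-N) :=
                    Real.rpow_le_rpow_of_exponent_le (by linarith [norm_nonneg (a + t • v)])
                      (by linarith)
                _ ≤ (1 + ‖a‖) ^ (-N) * (1 + ‖t • v‖) ^ N := one_add_norm_rpow_neg_add_le hN _ _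
                _ ≤ _ := by
                    gcongr (1 + ‖a‖) ^ (-N) * ?_ ^ N
                    exact one_add_norm_smul_le (by rwa [abs_of_pos ht]) v
        _ = C₂ * (1 + ‖a‖) ^ (-N) * ((1 + ‖v‖) ^ (-(N + N + n + 1)) * (1 + ‖v‖) ^ N) := by ring
        _ = C₂ * (1 + ‖a‖) ^ (-N) * (1 + ‖v‖) ^ (-(N + n + 1)) := by
            rw [← Real.rpow_add (by positivity)]; ring_nf
        _ ≤ _ := by
            gcongr _ * ?_
            exact Real.rpow_le_rpow_of_exponent_le (by linarith [norm_nonneg v]) (by linarith)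
    refine (integral_mono hint (hI.const_mul _) hle).trans ?_
    rw [integral_const_mul]
    calc C₂ * (1 + ‖a‖) ^ (-N) * I ≤ (C₁ + C₂) * (1 + ‖a‖) ^ (-N) * I := by
          gcongr; linarith
      _ = _ := by ring
  · rw [scaleWt, if_neg h]
    have ht1 : 1 < t := not_le.1 h
    have hle : ∀ v, ‖ψ v‖ * (1 + ‖a + t • v‖) ^ (-(N + n + 1)) ≤
        C₁ * (1 + ‖t⁻¹ • a‖) ^ (-N) * (1 + ‖a + t • v‖) ^ (-((n : ℝ) + 1)) := by
      intro v
      have e : v = -(t⁻¹ • a) + t⁻¹ • (a + t • v) := by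
        rw [smul_add, smul_smul, inv_mul_cancel₀ ht.ne', one_smul]; abel
      have hp : (1 + ‖v‖) ^ (-N) ≤ (1 + ‖t⁻¹ • a‖) ^ (-N) * (1 + ‖a + t • v‖) ^ N := by
        calc (1 + ‖v‖) ^ (-N) = (1 + ‖-(t⁻¹ • a) + t⁻¹ • (a + t • v)‖) ^ (-N) := by rw [← e]
          _ ≤ (1 + ‖-(t⁻¹ • a)‖) ^ (-N) * (1 + ‖t⁻¹ • (a + t • v)‖) ^ N :=
            one_add_norm_rpow_neg_add_le hN _ _
          _ ≤ _ := by
            rw [norm_neg]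
            gcongr (1 + ‖t⁻¹ • a‖) ^ (-N) * ?_ ^ N
            refine one_add_norm_smul_le ?_ _
            rw [abs_of_pos (inv_pos.2 ht)]
            exact inv_le_one_of_one_le₀ ht1.le
      calc ‖ψ v‖ * (1 + ‖a + t • v‖) ^ (-(N + n + 1))
          ≤ (C₁ * ((1 + ‖t⁻¹ • a‖) ^ (-N) * (1 + ‖a + t • v‖) ^ N)) *
            (1 + ‖a + t • v‖) ^ (-(N + n + 1)) := by
            gcongr
            exact (h₁ v).trans (by gcongr)
        _ = C₁ * (1 + ‖t⁻¹ • a‖) ^ (-N) * ((1 + ‖a + t • v‖) ^ N *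
            (1 + ‖a + t • v‖) ^ (-(N + n + 1))) := by ring
        _ = _ := by rw [← Real.rpow_add (by positivity)]; ring_nf
    have hI' : Integrable fun v : Rn n => (1 + ‖a + t • v‖) ^ (-((n : ℝ) + 1)) :=
      (hI.comp_add_left a).comp_smul ht.ne'
    have hval : ∫ v : Rn n, (1 + ‖a + t • v‖) ^ (-((n : ℝ) + 1)) = t ^ (-(n : ℝ)) * I := by
      rw [Measure.integral_comp_smul volume (fun v : Rn n => (1 + ‖a + v‖) ^ (-((n : ℝ) + 1))) t,
        integral_add_left_eq_self (fun v : Rn n => (1 + ‖v‖) ^ (-((n : ℝ) + 1))) a,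
        finrank_euclideanSpace_fin, abs_of_pos (by positivity), Real.rpow_neg ht.le,
        Real.rpow_natCast, smul_eq_mul]
    refine (integral_mono hint (hI'.const_mul _) hle).trans ?_
    rw [integral_const_mul, hval]
    calc C₁ * (1 + ‖t⁻¹ • a‖) ^ (-N) * (t ^ (-(n : ℝ)) * I)
        ≤ (C₁ + C₂) * (1 + ‖t⁻¹ • a‖) ^ (-N) * (t ^ (-(n : ℝ)) * I) := by gcongr; linarith
      _ = _ := by ring

theorem exists_norm_bumpForm_le {N : ℝ} (hN : 0 ≤ N) :
    ∃ C : ℝ, 0 ≤ C ∧ ∀ (f g : 𝓢(Rn n, ℂ)) (a : Rn n) (A : ℝ), 0 ≤ A →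
      (∀ w, ‖∫ z, f z * g (z + w)‖ ≤ A * (1 + ‖a + w‖) ^ (-(N + n + 1))) →
      ∀ t, 0 < t → ‖bumpForm t f g‖ ≤ C * A * scaleWt N t a := by
  obtain ⟨C, hC, h⟩ := exists_integral_kernel_le (bumpKernel (n := n)) hN
  refine ⟨C, hC, fun f g a A hA hW t ht => ?_⟩
  rw [bumpForm_eq]
  refine (norm_integral_le_of_norm_le ((h t ht a).1.const_mul A)
    (Filter.Eventually.of_forall fun v => ?_)).trans ?_
  · rw [norm_mul]
    calc ‖bumpKernel v‖ * ‖∫ z, f z * g (z + t • v)‖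
        ≤ ‖bumpKernel v‖ * (A * (1 + ‖a + t • v‖) ^ (-(N + n + 1))) := by
          gcongr; exact hW _
      _ = _ := by ring
  · rw [integral_const_mul]
    calc _ ≤ A * (C * scaleWt N t a) := by gcongr; exact (h t ht a).2
      _ = _ := by ring

end FormBounds

/-! ### Riesz potentials between time-frequency shifts -/

section RieszBounds

variable {n : ℕ}

theorem norm_integral_timeFrequencyShift_mul (φ : 𝓢(Rn n, ℂ)) (G : Rn n → ℂ) (y η : Rn n) :
    ‖∫ z, timeFrequencyShift y η φ z * G z‖
      = ‖∫ z, character η z * (φ z * G (y + z))‖ := by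
  have e : ∫ z, timeFrequencyShift y η φ z * G z
      = character η y * ∫ z, character η z * (φ z * G (y + z)) := by
    rw [← integral_add_left_eq_self _ y, ← integral_const_mul]
    congr with z
    rw [timeFrequencyShift_apply, character_add_right, add_sub_cancel_left]
    ring
  rw [e, norm_mul, norm_character, one_mul]

theorem exists_norm_integral_shift_mul_le (φ : 𝓢(Rn n, ℂ)) (N : ℕ) :
    ∃ C : ℝ, 0 ≤ C ∧ ∃ k, ∀ (g : 𝓢(Rn n, ℂ)) (y η w : Rn n),
      ‖∫ z, timeFrequencyShift y η φ z * g (z + w)‖ ≤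
        C * schwartzNorm k g * (1 + ‖η‖) ^ (-(N : ℝ)) * (1 + ‖y + w‖) ^ (-(N : ℝ)) := by
  obtain ⟨C, hC, k, h⟩ := exists_norm_integral_character_le φ N
  refine ⟨C, hC, k, fun g y η w => ?_⟩
  have := h g 1 (by simp) (y + w) (-η)
  rw [norm_neg, neg_neg] at this
  rw [norm_integral_timeFrequencyShift_mul φ (fun z => g (z + w))]
  refine le_trans (le_of_eq ?_) this
  congr 2 with z
  rw [one_smul, add_right_comm]

theorem exists_norm_integral_shift_mul_shift_le (φ : 𝓢(Rn n, ℂ)) (N : ℕ) :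
    ∃ C : ℝ, 0 ≤ C ∧ ∀ x ξ y η w : Rn n,
      ‖∫ z, timeFrequencyShift y η φ z * conjSchwartz (timeFrequencyShift x ξ φ) (z + w)‖ ≤
        C * (1 + ‖ξ - η‖) ^ (-(N : ℝ)) * (1 + ‖y - x + w‖) ^ (-(N : ℝ)) := by
  obtain ⟨C, hC, k, h⟩ := exists_norm_integral_character_le φ N
  refine ⟨C * schwartzNorm k (conjSchwartz φ), by positivity, fun x ξ y η w => ?_⟩
  have := h (conjSchwartz φ) 1 (by simp) (y - x + w) (ξ - η)
  refine le_trans (le_of_eq ?_) this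
  rw [norm_integral_timeFrequencyShift_mul φ
    (fun z => conjSchwartz (timeFrequencyShift x ξ φ) (z + w))]
  have e : ∫ z, character η z * (φ z * conjSchwartz (timeFrequencyShift x ξ φ) (y + z + w))
      = character (-ξ) (y + w) * ∫ z, character (-(ξ - η)) z *
        (φ z * conjSchwartz φ (y - x + w + (1 : ℝ) • z)) := by
    rw [← integral_const_mul]
    congr with z
    rw [conjSchwartz_apply, timeFrequencyShift_apply, map_mul, conj_character, conjSchwartz_apply,
      show y + z + w - x = y - x + w + (1 : ℝ) • z by rw [one_smul]; abel,
      show y + z + w = y + w + z by abel, character_add_right, neg_sub, sub_eq_add_neg η ξ,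
      character_add_left]
    ring
  rw [e, norm_mul, norm_character, one_mul]

/-- One atom against a fixed Schwartz function, with the dependence on `g` through a single
seminorm: this will make the extended operator take values in tempered distributions. -/
theorem exists_norm_rieszForm_shift_le (φ : 𝓢(Rn n, ℂ)) {α : ℝ} (hα : 0 < α) (hαn : α < n)
    (N : ℕ) :
    ∃ C : ℝ, 0 ≤ C ∧ ∃ k, ∀ (g : 𝓢(Rn n, ℂ)) (y η : Rn n),
      ‖rieszForm α (timeFrequencyShift y η φ) g‖ ≤
        C * schwartzNorm k g * (1 + ‖η‖) ^ (-(N : ℝ)) * (1 + ‖y‖) ^ (-(n - α)) := by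
  obtain ⟨C₁, hC₁, k, h₁⟩ := exists_norm_integral_shift_mul_le φ (N + n + 1 + n + 1)
  obtain ⟨C₂, hC₂, h₂⟩ := exists_norm_bumpForm_le (n := n) (N := N + n + 1) (by positivity)
  obtain ⟨C₃, hC₃, h₃⟩ := exists_norm_integral_exp_le hα hαn (N := N + n + 1)
    (by linarith [(Nat.cast_nonneg N : (0 : ℝ) ≤ N)])
  have hc := (subordConst_pos hα).le
  refine ⟨subordConst α * (C₃ * (C₂ * C₁)), by positivity, k, fun g y η => ?_⟩
  rw [rieszForm_eq_integral_bumpForm hα hαn, norm_mul, Complex.norm_real, Real.norm_of_nonneg hc]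
  have hA : (0 : ℝ) ≤ C₁ * schwartzNorm k g * (1 + ‖η‖) ^ (-(N : ℝ)) := by positivity
  have hb : ∀ t, 0 < t → ‖bumpForm t (timeFrequencyShift y η φ) g‖ ≤
      C₂ * (C₁ * schwartzNorm k g * (1 + ‖η‖) ^ (-(N : ℝ))) * scaleWt (N + n + 1) t y := by
    refine h₂ _ _ _ _ hA fun w => ?_
    refine (h₁ g y η w).trans ?_
    push_cast
    gcongr
    · linarith [norm_nonneg η]
    · linarith [(Nat.cast_nonneg n : (0 : ℝ) ≤ n)]
  -- Taking the frequency parameter to be `0` asks for spatial decay only; the decay in `η` sits in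
  -- the constant.
  have := h₃ 0 y _ (fun τ => bumpForm (Real.exp τ) (timeFrequencyShift y η φ) g)
    (mul_nonneg hC₂ hA) (fun τ => by
      simpa only [smul_zero, norm_zero, add_zero, Real.one_rpow, mul_one] using
        hb (Real.exp τ) (Real.exp_pos τ))
  simp only [norm_zero, add_zero, Real.one_rpow, mul_one] at this
  calc _ ≤ subordConst α * (C₃ * (C₂ * (C₁ * schwartzNorm k g * (1 + ‖η‖) ^ (-(N : ℝ)))) *
        (1 + ‖y‖) ^ (-(n - α))) := by gcongr
    _ = _ := by ring

theorem bumpForm_eq_swap (t : ℝ) (f g : 𝓢(Rn n, ℂ)) :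
    bumpForm t f g = ∫ z, f z * ∫ v, bumpKernel v * g (z + t • v) := by
  rw [bumpForm_eq]
  have e1 : ∀ v, bumpKernel v * ∫ z, f z * g (z + t • v)
      = ∫ z, bumpKernel v * (f z * g (z + t • v)) := fun v => (integral_const_mul _ _).symm
  have e2 : ∀ z, f z * ∫ v, bumpKernel v * g (z + t • v)
      = ∫ v, bumpKernel v * (f z * g (z + t • v)) := fun z => by
    rw [← integral_const_mul]
    congr with v
    ring
  simp only [e1, e2]
  refine integral_integral_swap ?_
  obtain ⟨C, hC, h⟩ := exists_norm_le_weight g 0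
  refine ((((bumpKernel (n := n)).integrable (μ := volume)).norm.mul_prod
    (f.integrable (μ := volume)).norm).const_mul C).mono' ?_
      (Filter.Eventually.of_forall fun z => ?_)
  · exact (by fun_prop : Continuous fun z : Rn n × Rn n =>
      bumpKernel z.1 * (f z.2 * g (z.2 + t • z.1))).aestronglyMeasurable
  · simp only [Function.uncurry, norm_mul]
    have := h (z.2 + t • z.1)
    rw [neg_zero, Real.rpow_zero, mul_one] at this
    calc ‖bumpKernel z.1‖ * (‖f z.2‖ * ‖g (z.2 + t • z.1)‖)
        ≤ ‖bumpKernel z.1‖ * (‖f z.2‖ * C) := by gcongr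
      _ = _ := by ring

/-- Averaging the second atom over the kernel first exposes the oscillation at frequency `t ξ`, and
hence the decay in `min(t, 1) ξ`; the modulation `η` of the first atom is estimated trivially. -/
theorem exists_norm_bumpForm_shift_le (φ : 𝓢(Rn n, ℂ)) (N : ℕ) :
    ∃ C : ℝ, 0 ≤ C ∧ ∀ t, 0 < t → ∀ x ξ y η : Rn n,
      ‖bumpForm t (timeFrequencyShift y η φ) (conjSchwartz (timeFrequencyShift x ξ φ))‖ ≤
        C * (1 + ‖min t 1 • ξ‖) ^ (-(N : ℝ)) * scaleWt N t (y - x) := by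
  obtain ⟨C₁, hC₁, h₁⟩ := exists_norm_scaled_integral_le (bumpKernel (n := n)) (conjSchwartz φ) N
  obtain ⟨C₂, hC₂, h₂⟩ := exists_norm_le_weight φ (N + n + 1)
  have hI : Integrable fun x : Rn n => (1 + ‖x‖) ^ (-((n : ℝ) + 1)) :=
    integrable_weight (by linarith)
  set I := ∫ x : Rn n, (1 + ‖x‖) ^ (-((n : ℝ) + 1)) with hIdef
  have hI0 : 0 ≤ I := integral_nonneg fun x => by positivity
  refine ⟨C₁ * C₂ * I, by positivity, fun t ht x ξ y η => ?_⟩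
  have hs := scaleWt_nonneg (M := N) ht (y - x)
  have hin : ∀ z, ‖∫ v, bumpKernel v * conjSchwartz (timeFrequencyShift x ξ φ) (z + t • v)‖ ≤
      C₁ * (1 + ‖min t 1 • ξ‖) ^ (-(N : ℝ)) * scaleWt N t (z - x) := by
    intro z
    have e : ∫ v, bumpKernel v * conjSchwartz (timeFrequencyShift x ξ φ) (z + t • v)
        = character (-ξ) z * ∫ v, character (-(t • ξ)) v *
          (bumpKernel v * conjSchwartz φ (z - x + t • v)) := by
      rw [← integral_const_mul]
      congr with v
      rw [conjSchwartz_apply, timeFrequencyShift_apply, map_mul, conj_character,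
        conjSchwartz_apply, character_add_right, ← smul_neg, character_smul_left,
        show z + t • v - x = z - x + t • v by abel]
      ring
    rw [e, norm_mul, norm_character, one_mul]
    exact h₁ t ht ξ (z - x)
  rw [bumpForm_eq_swap, norm_integral_timeFrequencyShift_mul φ (fun z => ∫ v, bumpKernel v *
    conjSchwartz (timeFrequencyShift x ξ φ) (z + t • v))]
  refine (norm_integral_le_of_norm_le (hI.const_mul (C₂ * (C₁ * (1 + ‖min t 1 • ξ‖) ^ (-(N : ℝ)) *
    scaleWt N t (y - x)))) (Filter.Eventually.of_forall fun z => ?_)).trans_eq ?_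
  · rw [norm_mul, norm_character, one_mul, norm_mul]
    have hz := hin (y + z)
    have hz2 := scaleWt_add_le (M := N) (by positivity) ht (y - x) z
    rw [show y - x + z = y + z - x by abel] at hz2
    calc _ ≤ (C₂ * (1 + ‖z‖) ^ (-((N : ℝ) + n + 1))) * (C₁ * (1 + ‖min t 1 • ξ‖) ^ (-(N : ℝ)) *
          (scaleWt N t (y - x) * (1 + ‖z‖) ^ (N : ℝ))) := by
          gcongr
          · exact h₂ z
          · exact hz.trans (by gcongr)
      _ = (C₂ * (C₁ * (1 + ‖min t 1 • ξ‖) ^ (-(N : ℝ)) * scaleWt N t (y - x))) *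
          ((1 + ‖z‖) ^ (-((N : ℝ) + n + 1)) * (1 + ‖z‖) ^ (N : ℝ)) := by ring
      _ = _ := by rw [← Real.rpow_add (by positivity)]; ring_nf
  · rw [integral_const_mul]
    ring

/-- At each scale there are two bounds, one with decay in `ξ - η` and one with decay in `min(t, 1)
ξ`. Proving each to order `2K` and taking the geometric mean gives both to order `K = N + n + 1`,
enough for the wanted `N` and for the integration over scales. -/
theorem exists_norm_rieszForm_shift_shift_le (φ : 𝓢(Rn n, ℂ)) {α : ℝ} (hα : 0 < α) (hαn : α < n)
    (N : ℕ) :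
    ∃ C : ℝ, 0 ≤ C ∧ ∀ x ξ y η : Rn n,
      ‖rieszForm α (timeFrequencyShift y η φ) (conjSchwartz (timeFrequencyShift x ξ φ))‖ ≤
        C * (1 + ‖ξ - η‖) ^ (-(N : ℝ)) * (1 + ‖ξ‖) ^ (-α) * (1 + ‖x - y‖) ^ (-(n - α)) := by
  set K := N + n + 1 with hK
  have hKr : ((K : ℕ) : ℝ) = N + n + 1 := by simp [hK]
  have hN0 : (0 : ℝ) ≤ N := Nat.cast_nonneg N
  have hn0 : (0 : ℝ) ≤ n := Nat.cast_nonneg n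
  obtain ⟨C₁, hC₁, h₁⟩ := exists_norm_integral_shift_mul_shift_le φ (K + K + n + 1)
  obtain ⟨C₂, hC₂, h₂⟩ := exists_norm_bumpForm_le (n := n) (N := ((K + K : ℕ) : ℝ)) (by positivity)
  obtain ⟨C₃, hC₃, h₃⟩ := exists_norm_integral_exp_le hα hαn (N := (K : ℝ)) (by linarith)
  obtain ⟨C₄, hC₄, h₄⟩ := exists_norm_bumpForm_shift_le φ (K + K)
  have hc := (subordConst_pos hα).le
  refine ⟨subordConst α * (C₃ * (C₂ * C₁ + C₄)), by positivity, fun x ξ y η => ?_⟩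
  rw [rieszForm_eq_integral_bumpForm hα hαn, norm_mul, Complex.norm_real, Real.norm_of_nonneg hc]
  have hsq : ∀ r : ℝ, 0 < r → r ^ (-((K + K : ℕ) : ℝ)) = (r ^ (-(K : ℝ))) ^ 2 := by
    intro r hr
    rw [sq, ← Real.rpow_add hr]
    push_cast
    ring_nf
  have hb : ∀ t, 0 < t → ‖bumpForm t (timeFrequencyShift y η φ)
      (conjSchwartz (timeFrequencyShift x ξ φ))‖ ≤ (C₂ * C₁ + C₄) * (1 + ‖ξ - η‖) ^ (-(N : ℝ)) *
        (1 + ‖min t 1 • ξ‖) ^ (-(K : ℝ)) * scaleWt K t (y - x) := by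
    intro t ht
    have hA : (0 : ℝ) ≤ C₁ * (1 + ‖ξ - η‖) ^ (-((K + K : ℕ) : ℝ)) := by positivity
    have b₁ := h₂ (timeFrequencyShift y η φ) (conjSchwartz (timeFrequencyShift x ξ φ)) (y - x) _ hA
      (fun w => by
        refine (h₁ x ξ y η w).trans ?_
        rw [show (((K + K + n + 1 : ℕ) : ℝ)) = ((K + K : ℕ) : ℝ) + n + 1 by push_cast; ring]
        gcongr ?_ * _
        gcongr C₁ * ?_
        exact Real.rpow_le_rpow_of_exponent_le (by linarith [norm_nonneg (ξ - η)])
          (by linarith)) t ht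
    have b₂ := h₄ t ht x ξ y η
    rw [hsq _ (by positivity)] at b₁ b₂
    set P := (1 + ‖ξ - η‖) ^ (-(K : ℝ)) with hP
    set Q := (1 + ‖min t 1 • ξ‖) ^ (-(K : ℝ)) with hQ
    set S := scaleWt ((K + K : ℕ) : ℝ) t (y - x) with hS
    have hS0 : 0 ≤ S := scaleWt_nonneg ht _
    have hP0 : 0 ≤ P := by positivity
    have hQ0 : 0 ≤ Q := by positivity
    set b := ‖bumpForm t (timeFrequencyShift y η φ) (conjSchwartz (timeFrequencyShift x ξ φ))‖
    -- The geometric mean, obtained by comparing squares.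
    have hgeo : b ≤ (C₂ * C₁ + C₄) * P * Q * S := by
      refine abs_le_of_sq_le_sq' ?_ (by positivity) |>.2
      have b₁' : b ≤ (C₂ * C₁ + C₄) * P ^ 2 * S := b₁.trans (by
        rw [← mul_assoc]; gcongr; linarith)
      have b₂' : b ≤ (C₂ * C₁ + C₄) * Q ^ 2 * S := b₂.trans (by
        gcongr; nlinarith [mul_nonneg hC₂ hC₁])
      calc b ^ 2 = b * b := sq b
        _ ≤ ((C₂ * C₁ + C₄) * P ^ 2 * S) * ((C₂ * C₁ + C₄) * Q ^ 2 * S) := by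
          gcongr
        _ = _ := by ring
    have hPN : P ≤ (1 + ‖ξ - η‖) ^ (-(N : ℝ)) :=
      Real.rpow_le_rpow_of_exponent_le (by linarith [norm_nonneg (ξ - η)]) (by linarith)
    have hSK : S ≤ scaleWt K t (y - x) := by
      have hKK : -((K + K : ℕ) : ℝ) ≤ -(K : ℝ) := by push_cast; linarith
      simp only [hS, scaleWt]
      split_ifs
      · exact Real.rpow_le_rpow_of_exponent_le (by linarith [norm_nonneg (y - x)]) hKK
      · gcongr ?_ * ?_
        exact Real.rpow_le_rpow_of_exponent_le (by linarith [norm_nonneg (t⁻¹ • (y - x))]) hKK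
    exact hgeo.trans (by gcongr)
  have := h₃ ξ (y - x) ((C₂ * C₁ + C₄) * (1 + ‖ξ - η‖) ^ (-(N : ℝ)))
    (fun τ => bumpForm (Real.exp τ) (timeFrequencyShift y η φ)
      (conjSchwartz (timeFrequencyShift x ξ φ))) (by positivity)
    (fun τ => hb (Real.exp τ) (Real.exp_pos τ))
  rw [norm_sub_rev x y]
  calc _ ≤ subordConst α * (C₃ * ((C₂ * C₁ + C₄) * (1 + ‖ξ - η‖) ^ (-(N : ℝ))) *
        (1 + ‖ξ‖) ^ (-α) * (1 + ‖y - x‖) ^ (-(n - α))) := by gcongr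
    _ = _ := by ring

end RieszBounds

/-! ### The operator on Schwartz functions and its bilinear form -/

section FractionalIntegral

variable {n : ℕ}

theorem continuous_fourier_of_integrable {H : Rn n → ℂ} (hH : Integrable H) :
    Continuous (𝓕 H) :=
  VectorFourier.fourierIntegral_continuous Real.continuous_fourierChar
    (L := innerₗ (Rn n)) continuous_inner hH

theorem norm_fourier_le_integral_norm (H : Rn n → ℂ) (x : Rn n) : ‖𝓕 H x‖ ≤ ∫ ζ, ‖H ζ‖ :=
  VectorFourier.norm_fourierIntegral_le_integral_norm _ _ _ _ _

theorem integral_fourier_mul_eq_of_integrable {H G : Rn n → ℂ} (hH : Integrable H)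
    (hG : Integrable G) : ∫ x, 𝓕 H x * G x = ∫ ζ, H ζ * 𝓕 G ζ := by
  simpa using! VectorFourier.integral_fourierIntegral_smul_eq_flip (L := innerₗ (Rn n))
    Real.continuous_fourierChar continuous_inner hH hG

theorem integral_fourierInv_mul_eq_of_integrable {H G : Rn n → ℂ} (hH : Integrable H)
    (hG : Integrable G) : ∫ x, 𝓕⁻ H x * G x = ∫ ζ, H ζ * 𝓕⁻ G ζ := by
  have h := integral_fourier_mul_eq_of_integrable hH hG.comp_neg
  rw [Real.fourierInv_eq_fourier_comp_neg G, ← h,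
    ← integral_neg_eq_self (fun x => 𝓕 H x * G (-x))]
  simp only [Real.fourierInv_eq_fourier_neg, neg_neg]

/-- The bilinear form `(f, g) ↦ ∫ g · I_{α,β} f`. -/
def fracForm (α β : ℝ) (f g : 𝓢(Rn n, ℂ)) : ℂ := rieszForm α f g + rieszForm β f g

theorem integrable_symbol_mul {α β : ℝ} (hβ : 0 < β) (hβα : β ≤ α) (hα : α < n)
    (f : 𝓢(Rn n, ℂ)) : Integrable fun ζ : Rn n =>
      (((2 * Real.pi * ‖ζ‖) ^ (-α) + (2 * Real.pi * ‖ζ‖) ^ (-β) : ℝ) : ℂ) * f ζ := by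
  refine ((integrable_rpow_mul_schwartz (hβ.le.trans hβα) hα f).add
    (integrable_rpow_mul_schwartz hβ.le (hβα.trans_lt hα) f)).congr
      (Filter.Eventually.of_forall fun ζ => ?_)
  simp only [Pi.add_apply]
  push_cast
  ring

theorem fracForm_eq {α β : ℝ} (hβ : 0 < β) (hβα : β ≤ α) (hα : α < n) (f g : 𝓢(Rn n, ℂ)) :
    fracForm α β f g = ∫ ζ, (((2 * Real.pi * ‖ζ‖) ^ (-α) + (2 * Real.pi * ‖ζ‖) ^ (-β) : ℝ) : ℂ) *
      (𝓕 f ζ * 𝓕⁻ g ζ) := by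
  have h₁ := integrable_rpow_mul_schwartz (hβ.le.trans hβα) hα (mulSchwartz (𝓕 f) (𝓕⁻ g))
  have h₂ := integrable_rpow_mul_schwartz hβ.le (hβα.trans_lt hα) (mulSchwartz (𝓕 f) (𝓕⁻ g))
  simp only [mulSchwartz_apply] at h₁ h₂
  rw [fracForm, rieszForm, rieszForm, ← integral_add h₁ h₂]
  congr with ζ
  push_cast
  ring

theorem continuous_fractionalIntegral {α β : ℝ} (hβ : 0 < β) (hβα : β ≤ α) (hα : α < n)
    (f : 𝓢(Rn n, ℂ)) : Continuous (fractionalIntegral α β f) := by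
  have h := integrable_symbol_mul hβ hβα hα (𝓕 f)
  rw [SchwartzMap.fourier_coe] at h
  have := (continuous_fourier_of_integrable h).comp continuous_neg
  convert this using 1
  funext x
  rw [fractionalIntegral, Real.fourierInv_eq_fourier_neg]
  rfl

theorem exists_norm_fractionalIntegral_le (α β : ℝ) (f : 𝓢(Rn n, ℂ)) :
    ∃ C, ∀ x, ‖fractionalIntegral α β f x‖ ≤ C :=
  ⟨_, fun x => (congrArg norm (Real.fourierInv_eq_fourier_neg _ x)).trans_le
    (norm_fourier_le_integral_norm _ _)⟩

theorem integral_mul_fractionalIntegral {α β : ℝ} (hβ : 0 < β) (hβα : β ≤ α) (hα : α < n)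
    (f g : 𝓢(Rn n, ℂ)) : ∫ x, g x * fractionalIntegral α β f x = fracForm α β f g := by
  have h := integrable_symbol_mul hβ hβα hα (𝓕 f)
  rw [SchwartzMap.fourier_coe] at h
  have := integral_fourierInv_mul_eq_of_integrable h (g.integrable (μ := volume))
  rw [fracForm_eq hβ hβα hα]
  simp only [mul_comm (g _)]
  refine this.trans ?_
  congr with ζ
  rw [SchwartzMap.fourier_coe, SchwartzMap.fourierInv_coe, mul_assoc]

theorem isGivenBy_fractionalIntegral {α β : ℝ} (hβ : 0 < β) (hβα : β ≤ α) (hα : α < n)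
    (f : 𝓢(Rn n, ℂ)) {u : 𝓢'(Rn n, ℂ)} (hu : ∀ g, u g = fracForm α β f g) :
    IsGivenBy u (fractionalIntegral α β f) := by
  intro g
  obtain ⟨C, hC⟩ := exists_norm_fractionalIntegral_le α β f
  refine ⟨(g.integrable (μ := volume)).mul_bdd (c := C)
    (continuous_fractionalIntegral hβ hβα hα f).aestronglyMeasurable
    (Filter.Eventually.of_forall hC), ?_⟩
  rw [hu, integral_mul_fractionalIntegral hβ hβα hα]

/-- The operator is moved onto `g`. Its image is the Fourier transform of an integrable function,
hence bounded and continuous although not Schwartz, which is the generality of the reproducing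
formula. -/
theorem exists_fracForm_eq_integral {α β : ℝ} (hβ : 0 < β) (hβα : β ≤ α) (hα : α < n)
    (g : 𝓢(Rn n, ℂ)) : ∃ h : Rn n → ℂ, Continuous h ∧ (∃ B, ∀ x, ‖h x‖ ≤ B) ∧
      ∀ f : 𝓢(Rn n, ℂ), fracForm α β f g = ∫ s, f s * h s := by
  have hi := integrable_symbol_mul hβ hβα hα (𝓕⁻ g)
  refine ⟨_, continuous_fourier_of_integrable hi, ⟨_, norm_fourier_le_integral_norm _⟩,
    fun f => ?_⟩
  rw [fracForm_eq hβ hβα hα, ← integral_fourier_mul_eq_of_integrable (f.integrable (μ := volume)) hi]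
  congr with ζ
  rw [SchwartzMap.fourier_coe]
  ring

end FractionalIntegral

/-! ### Modulation spaces as subspaces containing the Schwartz functions -/

section Space

variable {n : ℕ}

theorem stft_add (φ : 𝓢(Rn n, ℂ)) (u v : 𝓢'(Rn n, ℂ)) (x ξ : Rn n) :
    stft φ (u + v) x ξ = stft φ u x ξ + stft φ v x ξ := rfl

theorem stft_smul (φ : 𝓢(Rn n, ℂ)) (c : ℂ) (u : 𝓢'(Rn n, ℂ)) (x ξ : Rn n) :
    stft φ (c • u) x ξ = c * stft φ u x ξ := rfl

theorem measurable_enorm_stft (φ : 𝓢(Rn n, ℂ)) (u : 𝓢'(Rn n, ℂ)) :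
    Measurable (Function.uncurry fun x ξ => ‖stft φ u x ξ‖ₑ) :=
  (measurable_stft φ u).enorm

/-- The modulation space as a subspace of the tempered distributions. -/
def modulationSubmodule (φ : 𝓢(Rn n, ℂ)) {p q : ℝ} (hp : 1 ≤ p) (hq : 1 ≤ q) :
    Submodule ℂ 𝓢'(Rn n, ℂ) where
  carrier := modulationSpace φ p q
  zero_mem' := by
    have hp0 : 0 < p := by linarith
    have hq0 : 0 < q := by linarith
    have h : ∀ x ξ, stft φ (0 : 𝓢'(Rn n, ℂ)) x ξ = 0 := fun x ξ => rfl
    simp [modulationSpace, modulationNorm, h, hp0, hq0]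
  add_mem' := by
    intro u v hu hv
    have h : modulationNorm φ p q (u + v) ≤ modulationNorm φ p q u + modulationNorm φ p q v := by
      simp only [modulationNorm_eq_mixedNorm, stft_add]
      refine (mixedNorm_mono (by linarith) (by linarith) fun x ξ => enorm_add_le _ _).trans ?_
      exact mixedNorm_add_le hp hq (measurable_enorm_stft φ u) (measurable_enorm_stft φ v)
    exact h.trans_lt (ENNReal.add_lt_top.2 ⟨hu, hv⟩)
  smul_mem' := by
    intro c u hu
    have h : modulationNorm φ p q (c • u) = ‖c‖ₑ * modulationNorm φ p q u := by
      simp only [modulationNorm_eq_mixedNorm, stft_smul, enorm_mul]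
      exact mixedNorm_const_mul (by linarith) (by linarith) (measurable_enorm_stft φ u) _
    change modulationNorm φ p q (c • u) < ∞
    rw [h]
    exact ENNReal.mul_lt_top enorm_lt_top hu

theorem mixedNorm_wt_mul_wt_ne_top {p q r s : ℝ} (hp : 0 < p) (hq : 0 < q) (hr : n < r * p)
    (hs : n < s * q) : mixedNorm p q (fun x ξ : Rn n => wt r x * wt s ξ) ≠ ∞ := by
  rw [mixedNorm_tensor hp hq (by fun_prop) (by fun_prop)]
  exact ENNReal.mul_ne_top
    (ENNReal.rpow_ne_top_of_nonneg (by positivity) (lintegral_wt_rpow_ne_top hp.le hr))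
    (ENNReal.rpow_ne_top_of_nonneg (by positivity) (lintegral_wt_rpow_ne_top hq.le hs))

theorem mem_modulationSpace_coe (φ f : 𝓢(Rn n, ℂ)) {p q : ℝ} (hp : 1 < p) (hq : 1 < q) :
    (f : 𝓢'(Rn n, ℂ)) ∈ modulationSpace φ p q := by
  obtain ⟨C, hC, h⟩ := exists_norm_stft_le φ f (n + 1)
  have hle : modulationNorm φ p q (f : 𝓢'(Rn n, ℂ)) ≤ ENNReal.ofReal C *
      mixedNorm p q (fun x ξ : Rn n => wt ((n + 1 : ℕ) : ℝ) x * wt ((n + 1 : ℕ) : ℝ) ξ) := by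
    rw [← mixedNorm_const_mul (by linarith) (by linarith) (by fun_prop),
      modulationNorm_eq_mixedNorm]
    refine mixedNorm_mono (by linarith) (by linarith) fun x ξ => ?_
    rw [← ofReal_norm, wt, wt, ← ENNReal.ofReal_mul (by positivity), ← ENNReal.ofReal_mul hC]
    refine ENNReal.ofReal_le_ofReal ((h x ξ).trans_eq ?_)
    ring
  have hn : (0 : ℝ) ≤ n := Nat.cast_nonneg n
  refine hle.trans_lt (ENNReal.mul_lt_top ENNReal.ofReal_lt_top (lt_top_iff_ne_top.2 ?_))
  exact mixedNorm_wt_mul_wt_ne_top (by linarith) (by linarith) (by push_cast; nlinarith)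
    (by push_cast; nlinarith)

end Space

/-! ### Sufficiency: extension of the operator and its norm bound -/

section Extension

variable {n : ℕ}

theorem exists_norm_fracForm_shift_le (φ : 𝓢(Rn n, ℂ)) {α β : ℝ} (hβ : 0 < β) (hβα : β ≤ α)
    (hα : α < n) (N : ℕ) :
    ∃ C : ℝ, 0 ≤ C ∧ ∃ k, ∀ (g : 𝓢(Rn n, ℂ)) (y η : Rn n),
      ‖fracForm α β (timeFrequencyShift y η φ) g‖ ≤
        C * schwartzNorm k g * ((1 + ‖y‖) ^ (-(n - α)) * (1 + ‖η‖) ^ (-(N : ℝ))) := by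
  obtain ⟨C₁, hC₁, k₁, h₁⟩ := exists_norm_rieszForm_shift_le φ (hβ.trans_le hβα) hα N
  obtain ⟨C₂, hC₂, k₂, h₂⟩ := exists_norm_rieszForm_shift_le φ hβ (hβα.trans_lt hα) N
  have hmono : ∀ {k l : ℕ}, k ≤ l → ∀ g : 𝓢(Rn n, ℂ), schwartzNorm k g ≤ schwartzNorm l g := by
    intro k l hkl g
    exact Seminorm.le_def.1 (Finset.sup_mono
      (Finset.Iic_subset_Iic.2 (Prod.mk_le_mk.2 ⟨hkl, hkl⟩))) g
  refine ⟨C₁ + C₂, by positivity, max k₁ k₂, fun g y η => (norm_add_le _ _).trans ?_⟩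
  have hy : (1 + ‖y‖) ^ (-(n - β)) ≤ (1 + ‖y‖) ^ (-(n - α)) :=
    Real.rpow_le_rpow_of_exponent_le (by linarith [norm_nonneg y]) (by linarith)
  calc _ ≤ C₁ * schwartzNorm k₁ g * (1 + ‖η‖) ^ (-(N : ℝ)) * (1 + ‖y‖) ^ (-(n - α)) +
        C₂ * schwartzNorm k₂ g * (1 + ‖η‖) ^ (-(N : ℝ)) * (1 + ‖y‖) ^ (-(n - β)) :=
        add_le_add (h₁ g y η) (h₂ g y η)
    _ ≤ C₁ * schwartzNorm (max k₁ k₂) g * (1 + ‖η‖) ^ (-(N : ℝ)) * (1 + ‖y‖) ^ (-(n - α)) +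
        C₂ * schwartzNorm (max k₁ k₂) g * (1 + ‖η‖) ^ (-(N : ℝ)) * (1 + ‖y‖) ^ (-(n - α)) := by
        gcongr
        · exact hmono (le_max_left _ _) g
        · exact hmono (le_max_right _ _) g
    _ = _ := by ring

/-- The worse factors of the two potentials are kept: the spatial tail comes from `α`, the frequency
gain from `β`. Hence `α` governs the exponents in space and `β` those in frequency. -/
theorem exists_norm_fracForm_shift_shift_le (φ : 𝓢(Rn n, ℂ)) {α β : ℝ} (hβ : 0 < β) (hβα : β ≤ α)
    (hα : α < n) (N : ℕ) :
    ∃ C : ℝ, 0 ≤ C ∧ ∀ x ξ y η : Rn n,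
      ‖fracForm α β (timeFrequencyShift y η φ) (conjSchwartz (timeFrequencyShift x ξ φ))‖ ≤
        C * ((1 + ‖ξ‖) ^ (-β) * (1 + ‖ξ - η‖) ^ (-(N : ℝ)) * (1 + ‖x - y‖) ^ (-(n - α))) := by
  obtain ⟨C₁, hC₁, h₁⟩ := exists_norm_rieszForm_shift_shift_le φ (hβ.trans_le hβα) hα N
  obtain ⟨C₂, hC₂, h₂⟩ := exists_norm_rieszForm_shift_shift_le φ hβ (hβα.trans_lt hα) N
  refine ⟨C₁ + C₂, by positivity, fun x ξ y η => (norm_add_le _ _).trans ?_⟩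
  have hy : (1 + ‖x - y‖) ^ (-(n - β)) ≤ (1 + ‖x - y‖) ^ (-(n - α)) :=
    Real.rpow_le_rpow_of_exponent_le (by linarith [norm_nonneg (x - y)]) (by linarith)
  have hξ : (1 + ‖ξ‖) ^ (-α) ≤ (1 + ‖ξ‖) ^ (-β) :=
    Real.rpow_le_rpow_of_exponent_le (by linarith [norm_nonneg ξ]) (by linarith)
  calc _ ≤ C₁ * (1 + ‖ξ - η‖) ^ (-(N : ℝ)) * (1 + ‖ξ‖) ^ (-α) * (1 + ‖x - y‖) ^ (-(n - α)) +
        C₂ * (1 + ‖ξ - η‖) ^ (-(N : ℝ)) * (1 + ‖ξ‖) ^ (-β) * (1 + ‖x - y‖) ^ (-(n - β)) :=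
        add_le_add (h₁ x ξ y η) (h₂ x ξ y η)
    _ ≤ C₁ * (1 + ‖ξ - η‖) ^ (-(N : ℝ)) * (1 + ‖ξ‖) ^ (-β) * (1 + ‖x - y‖) ^ (-(n - α)) +
        C₂ * (1 + ‖ξ - η‖) ^ (-(N : ℝ)) * (1 + ‖ξ‖) ^ (-β) * (1 + ‖x - y‖) ^ (-(n - α)) := by
        gcongr
    _ = _ := by ring

theorem stronglyMeasurable_fracForm_shift (φ : 𝓢(Rn n, ℂ)) {α β : ℝ} (hβ : 0 < β) (hβα : β ≤ α)
    (hα : α < n) (g : 𝓢(Rn n, ℂ)) : StronglyMeasurable fun z : Rn n × Rn n =>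
      fracForm α β (timeFrequencyShift z.1 z.2 φ) g := by
  obtain ⟨h, hc, -, hh⟩ := exists_fracForm_eq_integral hβ hβα hα g
  simp only [hh]
  refine StronglyMeasurable.integral_prod_right
    (f := fun (z : Rn n × Rn n) s => timeFrequencyShift z.1 z.2 φ s * h s) ?_
  simp only [timeFrequencyShift_apply]
  exact (by fun_prop : Continuous fun w : (Rn n × Rn n) × Rn n =>
        character w.1.2 w.2 * φ (w.2 - w.1.1) * h w.2).stronglyMeasurable

theorem lintegral_prod_swap_of_measurable {F : Rn n → Rn n → ℝ≥0∞}
    (hF : Measurable (Function.uncurry F)) :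
    ∫⁻ z : Rn n × Rn n, F z.1 z.2 = ∫⁻ η, ∫⁻ y, F y η := by
  exact lintegral_prod_symm (μ := volume) (ν := volume) _ hF.aemeasurable

theorem integrable_stft_mul_weight (φ : 𝓢(Rn n, ℂ)) {p q r s : ℝ} (hp : 1 < p) (hq : 1 < q)
    (hr : n < r * p.conjExponent) (hs : n < s * q.conjExponent) {u : 𝓢'(Rn n, ℂ)}
    (hu : u ∈ modulationSpace φ p q) :
    Integrable fun z : Rn n × Rn n =>
      ‖stft φ u z.1 z.2‖ * ((1 + ‖z.1‖) ^ (-r) * (1 + ‖z.2‖) ^ (-s)) := by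
  have hp' := Real.HolderConjugate.conjExponent hp
  have hq' := Real.HolderConjugate.conjExponent hq
  refine ⟨((measurable_stft φ u).norm.mul (by fun_prop)).aestronglyMeasurable, ?_⟩
  rw [hasFiniteIntegral_iff_ofReal (Filter.Eventually.of_forall fun z => by positivity)]
  have e : ∀ z : Rn n × Rn n, ENNReal.ofReal (‖stft φ u z.1 z.2‖ *
      ((1 + ‖z.1‖) ^ (-r) * (1 + ‖z.2‖) ^ (-s)))
      = ‖stft φ u z.1 z.2‖ₑ * (wt r z.1 * wt s z.2) := fun z => by
    rw [ENNReal.ofReal_mul (norm_nonneg _), ENNReal.ofReal_mul (by positivity), ofReal_norm, wt, wt]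
  simp only [e]
  have hm := measurable_enorm_stft φ u
  have hm2 : Measurable (Function.uncurry fun x ξ : Rn n => wt r x * wt s ξ) := by fun_prop
  rw [lintegral_prod_swap_of_measurable (F := fun x ξ => ‖stft φ u x ξ‖ₑ * (wt r x * wt s ξ))
    (hm.mul hm2)]
  refine (lintegral_lintegral_mul_le_mixedNorm hp' hq' hm hm2).trans_lt ?_
  exact ENNReal.mul_lt_top hu (lt_top_iff_ne_top.2
    (mixedNorm_wt_mul_wt_ne_top hp'.symm.pos hq'.symm.pos hr hs))

theorem exists_integrable_stft_mul_fracForm (φ : 𝓢(Rn n, ℂ)) {α β p q : ℝ} (hβ : 0 < β)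
    (hβα : β ≤ α) (hα : α < n) (hp : 1 < p) (hq : 1 < q) (hαp : α / n < 1 / p)
    {u : 𝓢'(Rn n, ℂ)} (hu : u ∈ modulationSpace φ p q) :
    (∀ g, Integrable fun z : Rn n × Rn n =>
      stft φ u z.1 z.2 * fracForm α β (timeFrequencyShift z.1 z.2 φ) g) ∧
    ∃ C : ℝ, 0 ≤ C ∧ ∃ k, ∀ g, ‖∫ z : Rn n × Rn n,
      stft φ u z.1 z.2 * fracForm α β (timeFrequencyShift z.1 z.2 φ) g‖ ≤
        C * schwartzNorm k g := by
  have hp' := Real.HolderConjugate.conjExponent hp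
  have hq' := Real.HolderConjugate.conjExponent hq
  have hn : (0 : ℝ) < n := hβ.trans_le hβα |>.trans hα
  obtain ⟨C, hC, k, h⟩ := exists_norm_fracForm_shift_le φ hβ hβα hα (n + 1)
  -- The hypothesis `α/n < 1/p` says precisely that the weight of order `n - α` lies in the dual
  -- Lebesgue space, so Hölder in mixed norms gives absolute convergence.
  have hr : (n : ℝ) < (n - α) * p.conjExponent := by
    have h1 : p.conjExponent⁻¹ = 1 - 1 / p := by
      rw [one_div, ← hp'.inv_add_inv_eq_one]; ring
    have h2 : (n : ℝ) * p.conjExponent⁻¹ < n - α := by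
      rw [h1]
      have : α < n * (1 / p) := by
        rwa [div_lt_iff₀ hn, mul_comm] at hαp
      linarith
    rwa [← div_eq_mul_inv, div_lt_iff₀ hp'.symm.pos] at h2
  have hs : (n : ℝ) < ((n + 1 : ℕ) : ℝ) * q.conjExponent := by
    push_cast
    nlinarith [hq'.symm.lt]
  have hint := integrable_stft_mul_weight φ hp hq hr hs hu
  have hb : ∀ (g : 𝓢(Rn n, ℂ)) (z : Rn n × Rn n),
      ‖stft φ u z.1 z.2 * fracForm α β (timeFrequencyShift z.1 z.2 φ) g‖ ≤
      C * schwartzNorm k g * (‖stft φ u z.1 z.2‖ *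
        ((1 + ‖z.1‖) ^ (-(n - α)) * (1 + ‖z.2‖) ^ (-((n + 1 : ℕ) : ℝ)))) := by
    intro g z
    rw [norm_mul]
    calc _ ≤ ‖stft φ u z.1 z.2‖ * (C * schwartzNorm k g *
          ((1 + ‖z.1‖) ^ (-(n - α)) * (1 + ‖z.2‖) ^ (-((n + 1 : ℕ) : ℝ)))) := by
          gcongr; exact h g z.1 z.2
      _ = _ := by ring
  refine ⟨fun g => (hint.const_mul _).mono' ((measurable_stft φ u).aestronglyMeasurable.mul
    (stronglyMeasurable_fracForm_shift φ hβ hβα hα g).aestronglyMeasurable)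
    (Filter.Eventually.of_forall (hb g)), C * ∫ z : Rn n × Rn n, ‖stft φ u z.1 z.2‖ *
      ((1 + ‖z.1‖) ^ (-(n - α)) * (1 + ‖z.2‖) ^ (-((n + 1 : ℕ) : ℝ))),
    mul_nonneg hC (integral_nonneg fun z => by positivity), k, fun g => ?_⟩
  refine (norm_integral_le_of_norm_le (hint.const_mul _)
    (Filter.Eventually.of_forall (hb g))).trans_eq ?_
  rw [integral_const_mul]
  exact mul_right_comm _ _ _

theorem fracForm_add_right {α β : ℝ} (hβ : 0 < β) (hβα : β ≤ α) (hα : α < n)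
    (f g h : 𝓢(Rn n, ℂ)) : fracForm α β f (g + h) = fracForm α β f g + fracForm α β f h := by
  obtain ⟨C, hC⟩ := exists_norm_fractionalIntegral_le α β f
  have hi : ∀ g : 𝓢(Rn n, ℂ), Integrable fun x => g x * fractionalIntegral α β f x := fun g =>
    (g.integrable (μ := volume)).mul_bdd (c := C)
      (continuous_fractionalIntegral hβ hβα hα f).aestronglyMeasurable
      (Filter.Eventually.of_forall hC)
  simp only [← integral_mul_fractionalIntegral hβ hβα hα]
  rw [← integral_add (hi g) (hi h)]
  congr with x
  rw [add_apply, add_mul]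

theorem fracForm_smul_right {α β : ℝ} (hβ : 0 < β) (hβα : β ≤ α) (hα : α < n) (c : ℂ)
    (f g : 𝓢(Rn n, ℂ)) : fracForm α β f (c • g) = c * fracForm α β f g := by
  simp only [← integral_mul_fractionalIntegral hβ hβα hα]
  rw [← integral_const_mul]
  congr with x
  rw [smul_apply, smul_eq_mul, mul_assoc]

/-- The continuous extension of `I_{α,β}` to a modulation space. -/
theorem exists_extension (φ : 𝓢(Rn n, ℂ)) {α β p q : ℝ} (hβ : 0 < β)
    (hβα : β ≤ α) (hα : α < n) (hp : 1 < p) (hq : 1 < q) (hαp : α / n < 1 / p) :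
    ∃ T : modulationSubmodule φ hp.le hq.le →ₗ[ℂ] 𝓢'(Rn n, ℂ), ∀ u g,
      T u g = (reproConst φ : ℂ)⁻¹ * ∫ z : Rn n × Rn n,
        stft φ (u : 𝓢'(Rn n, ℂ)) z.1 z.2 * fracForm α β (timeFrequencyShift z.1 z.2 φ) g := by
  have hex : ∀ u : modulationSubmodule φ hp.le hq.le, ∃ v : 𝓢'(Rn n, ℂ), ∀ g,
      v g = (reproConst φ : ℂ)⁻¹ * ∫ z : Rn n × Rn n,
        stft φ (u : 𝓢'(Rn n, ℂ)) z.1 z.2 * fracForm α β (timeFrequencyShift z.1 z.2 φ) g := by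
    rintro ⟨u, hu⟩
    obtain ⟨hi, C, hC, k, hb⟩ :=
      exists_integrable_stft_mul_fracForm φ hβ hβα hα hp hq hαp (show u ∈ modulationSpace φ p q from hu)
    -- The bound by one Schwartz norm of `g` makes this weakly defined functional a tempered
    -- distribution.
    refine ⟨ContinuousLinearMap.toPointwiseConvergenceCLM _ _ _ _
      (SchwartzMap.mkCLMtoNormedSpace (σ := RingHom.id ℂ) (fun g => (reproConst φ : ℂ)⁻¹ *
        ∫ z : Rn n × Rn n, stft φ u z.1 z.2 * fracForm α β (timeFrequencyShift z.1 z.2 φ) g)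
        (fun f g => ?_) (fun c g => ?_) ⟨Finset.Iic (k, k), ‖(reproConst φ : ℂ)⁻¹‖ * C,
          by positivity, fun g => ?_⟩), fun g => rfl⟩
    · rw [← mul_add, ← integral_add (hi f) (hi g)]
      congr with z
      rw [fracForm_add_right hβ hβα hα, mul_add]
    · rw [RingHom.id_apply, smul_eq_mul, mul_left_comm, ← integral_const_mul c]
      congr with z
      rw [fracForm_smul_right hβ hβα hα, mul_left_comm]
    · rw [norm_mul, mul_assoc]
      gcongr
      exact hb g
  choose v hv using hex
  refine ⟨⟨⟨v, fun u w => ?_⟩, fun c u => ?_⟩, hv⟩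
  · refine UniformConvergenceCLM.ext (RingHom.id ℂ) ℂ fun g => ?_
    have hu := (exists_integrable_stft_mul_fracForm φ hβ hβα hα hp hq hαp u.2).1 g
    have hw := (exists_integrable_stft_mul_fracForm φ hβ hβα hα hp hq hαp w.2).1 g
    change v (u + w) g = v u g + v w g
    rw [hv, hv, hv, ← mul_add, ← integral_add hu hw]
    congr with z
    rw [Submodule.coe_add, stft_add, add_mul]
  · refine UniformConvergenceCLM.ext (RingHom.id ℂ) ℂ fun g => ?_
    change v (c • u) g = c * v u g
    rw [hv, hv, mul_left_comm, ← integral_const_mul c]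
    congr with z
    rw [Submodule.coe_smul, stft_smul, mul_assoc]

theorem measurable_lintegral_kernel_mul (β N lam : ℝ) {F : Rn n → Rn n → ℝ≥0∞}
    (hF : Measurable (Function.uncurry F)) :
    Measurable (Function.uncurry fun x ξ : Rn n => ∫⁻ η, ∫⁻ y, wt β ξ *
      wt N (ξ - η) * (wt lam (x - y) * F y η)) := by
  refine Measurable.lintegral_prod_right' (f := fun w : (Rn n × Rn n) × Rn n => ∫⁻ y, wt β w.1.2 *
    wt N (w.1.2 - w.2) * (wt lam (w.1.1 - y) * F y w.2)) ?_
  refine Measurable.lintegral_prod_right' (f := fun w : ((Rn n × Rn n) × Rn n) × Rn n =>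
    wt β w.1.1.2 * wt N (w.1.1.2 - w.1.2) * (wt lam (w.1.1.1 - w.2) * F w.2 w.1.2)) ?_
  have : Measurable fun w : ((Rn n × Rn n) × Rn n) × Rn n => F w.2 w.1.2 :=
    hF.comp (measurable_snd.prodMk (measurable_snd.comp measurable_fst))
  exact Measurable.mul (by fun_prop) (Measurable.mul (by fun_prop) this)

/-- Testing `v` on the conjugated atoms bounds its transform pointwise by the tensor kernel applied
to the transform of `u`, so the estimate on mixed Lebesgue spaces applies. -/
theorem exists_modulationNorm_extension_le (φ : 𝓢(Rn n, ℂ)) {α β p₁ p₂ q₁ q₂ : ℝ} (hβ : 0 < β)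
    (hβα : β ≤ α) (hα : α < n) (hp₁ : 1 < p₁) (hp₂ : 1 < p₂) (hq₁ : 1 < q₁) (hq₂ : 1 < q₂)
    (hp : 1 / p₂ ≤ 1 / p₁ - α / n) (hq : 1 / q₂ < 1 / q₁ + β / n) :
    ∃ C : ℝ≥0, ∀ u v : 𝓢'(Rn n, ℂ), (∀ g, v g = (reproConst φ : ℂ)⁻¹ * ∫ z : Rn n × Rn n,
        stft φ u z.1 z.2 * fracForm α β (timeFrequencyShift z.1 z.2 φ) g) →
      modulationNorm φ p₂ q₂ v ≤ C * modulationNorm φ p₁ q₁ u := by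
  have hα0 : 0 < α := hβ.trans_le hβα
  have hn : (0 : ℝ) < n := hα0.trans hα
  have hp12 : p₁ < p₂ := by
    have : 1 / p₂ < 1 / p₁ := by linarith [div_pos hα0 hn]
    exact (one_div_lt_one_div (by linarith) (by linarith)).1 this
  obtain ⟨C₁, hC₁, h₁⟩ := exists_norm_fracForm_shift_shift_le φ hβ hβα hα (n + 1)
  obtain ⟨C₂, hC₂, h₂⟩ := exists_mixedNorm_kernel_le (by exact_mod_cast hn) hp₁ hp12 hq₁ hq₂ hβ.le
    (N := ((n + 1 : ℕ) : ℝ)) (by push_cast; linarith) hq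
  set lam := n * (1 - (1 / p₁ - 1 / p₂)) with hlam
  -- Since the kernel has no singularity at the origin, decay faster than the critical order `lam`
  -- is harmless; thus an inequality between `p₁` and `p₂` suffices.
  have hlam' : lam ≤ n - α := by
    have : α ≤ n * (1 / p₁ - 1 / p₂) := by
      rw [← div_le_iff₀' hn]; linarith
    rw [hlam]; linarith
  set D : ℝ≥0∞ := ‖(reproConst φ : ℂ)⁻¹‖ₑ * ENNReal.ofReal C₁ with hD
  have hDtop : D ≠ ∞ := by finiteness
  refine ⟨(D * C₂).toNNReal, fun u v hv => ?_⟩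
  rw [ENNReal.coe_toNNReal (by finiteness), mul_assoc]
  have hm := measurable_enorm_stft φ u
  refine le_trans ?_ (mul_le_mul_right (h₂ _ hm) D)
  have hmk := measurable_lintegral_kernel_mul β ((n + 1 : ℕ) : ℝ) lam hm
  rw [← mixedNorm_const_mul (by linarith) (by linarith) hmk, modulationNorm_eq_mixedNorm]
  refine mixedNorm_mono (by linarith) (by linarith) fun x ξ => ?_
  rw [stft, hv, enorm_mul, hD, mul_assoc]
  gcongr
  refine (enorm_integral_le_lintegral_enorm _).trans ?_
  have hF : Measurable (Function.uncurry fun y η : Rn n => wt β ξ * wt ((n + 1 : ℕ) : ℝ) (ξ - η) *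
      (wt lam (x - y) * ‖stft φ u y η‖ₑ)) := by
    have : Measurable fun w : Rn n × Rn n => ‖stft φ u w.1 w.2‖ₑ := hm
    exact Measurable.mul (by fun_prop) (Measurable.mul (by fun_prop) this)
  rw [← lintegral_prod_swap_of_measurable hF, ← lintegral_const_mul' _ _ ENNReal.ofReal_ne_top]
  refine lintegral_mono fun z => ?_
  have h3 : ‖fracForm α β (timeFrequencyShift z.1 z.2 φ)
      (conjSchwartz (timeFrequencyShift x ξ φ))‖ₑ ≤ ENNReal.ofReal C₁ * (wt β ξ *
        wt ((n + 1 : ℕ) : ℝ) (ξ - z.2) * wt (n - α) (x - z.1)) := by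
    rw [← ofReal_norm, wt, wt, wt, ← ENNReal.ofReal_mul (by positivity),
      ← ENNReal.ofReal_mul (by positivity), ← ENNReal.ofReal_mul hC₁]
    exact ENNReal.ofReal_le_ofReal (h₁ x ξ z.1 z.2)
  rw [enorm_mul]
  calc _ ≤ ‖stft φ u z.1 z.2‖ₑ * (ENNReal.ofReal C₁ * (wt β ξ *
        wt ((n + 1 : ℕ) : ℝ) (ξ - z.2) * wt lam (x - z.1))) := by
        gcongr
        exact h3.trans (by gcongr; exact wt_anti hlam' _)
    _ = _ := by ring

theorem fractionalIntegralBounded_of_le {φ : 𝓢(Rn n, ℂ)} (hφ : φ ≠ 0) {α β p₁ p₂ q₁ q₂ : ℝ}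
    (hβ : 0 < β) (hβα : β ≤ α) (hα : α < n) (hp₁ : 1 < p₁) (hp₂ : 1 < p₂) (hq₁ : 1 < q₁)
    (hq₂ : 1 < q₂) (hp : 1 / p₂ ≤ 1 / p₁ - α / n) (hq : 1 / q₂ < 1 / q₁ + β / n) :
    FractionalIntegralBounded φ α β p₁ q₁ p₂ q₂ := by
  have hαp : α / n < 1 / p₁ := by
    have : 0 < 1 / p₂ := by positivity
    linarith
  obtain ⟨T, hT⟩ := exists_extension φ hβ hβα hα hp₁ hq₁ hαp
  obtain ⟨C, hC⟩ := exists_modulationNorm_extension_le φ hβ hβα hα hp₁ hp₂ hq₁ hq₂ hp hq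
  refine ⟨⟨modulationSubmodule φ hp₁.le hq₁.le, T⟩, rfl, fun f =>
    ⟨mem_modulationSpace_coe φ f hp₁ hq₁, ?_⟩, C, fun u => hC u (T u) (hT u)⟩
  refine isGivenBy_fractionalIntegral hβ hβα hα f fun g => ?_
  refine (hT ⟨f, mem_modulationSpace_coe φ f hp₁ hq₁⟩ g).trans ?_
  obtain ⟨h, hc, ⟨B, hB⟩, hh⟩ := exists_fracForm_eq_integral hβ hβα hα g
  simp only [hh]
  rw [integral_stft_mul_eq φ f hc hB, ← mul_assoc, inv_mul_cancel₀, one_mul]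
  exact_mod_cast (reproConst_pos hφ).ne'

end Extension

/-! ### Duality: boundedness as a bilinear inequality -/

section Pairing

variable {n : ℕ}

theorem stft_eq_conj_of_isGivenBy (φ : 𝓢(Rn n, ℂ)) {v : 𝓢'(Rn n, ℂ)} {h : Rn n → ℂ}
    (hv : IsGivenBy v h) (y η : Rn n) :
    ∫ s, timeFrequencyShift y η φ s * conj (h s) = conj (stft φ v y η) := by
  rw [stft, (hv _).2, ← integral_conj]
  congr with s
  rw [map_mul, conjSchwartz_apply, Complex.conj_conj]

/-- The duality of modulation spaces, for a bounded continuous function in one of them and a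
Schwartz function in the other. -/
theorem enorm_le_modulationNorm_mul {φ : 𝓢(Rn n, ℂ)} (hφ : φ ≠ 0) {p q p' q' : ℝ}
    (hp : p.HolderConjugate p') (hq : q.HolderConjugate q') {v : 𝓢'(Rn n, ℂ)} {h : Rn n → ℂ}
    (hv : IsGivenBy v h) (hc : Continuous h) {B : ℝ} (hB : ∀ x, ‖h x‖ ≤ B) (g : 𝓢(Rn n, ℂ)) :
    ‖v g‖ₑ ≤ ENNReal.ofReal (reproConst φ)⁻¹ * (modulationNorm φ p q v *
      modulationNorm φ p' q' (conjSchwartz g : 𝓢'(Rn n, ℂ))) := by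
  have hpos := reproConst_pos hφ
  -- The reproducing formula writes `v g` as a multiple of the inner product of two short-time
  -- Fourier transforms, to which Hölder in mixed norms applies.
  have hrep := integral_stft_mul_eq φ (conjSchwartz g) (h := fun s => conj (h s)) (by fun_prop)
    (B := B) (fun x => by simpa using hB x)
  simp only [stft_eq_conj_of_isGivenBy φ hv] at hrep
  have e1 : ∫ s, conjSchwartz g s * conj (h s) = conj (v g) := by
    rw [(hv g).2, ← integral_conj]
    congr with s
    rw [map_mul, conjSchwartz_apply]
  have e2 : v g = ((reproConst φ)⁻¹ : ℝ) * conj (∫ z : Rn n × Rn n,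
      stft φ (conjSchwartz g : 𝓢'(Rn n, ℂ)) z.1 z.2 * conj (stft φ v z.1 z.2)) := by
    rw [hrep, e1, map_mul, Complex.conj_conj, Complex.conj_ofReal, ← mul_assoc]
    push_cast
    rw [inv_mul_cancel₀ (by exact_mod_cast hpos.ne'), one_mul]
  have hm := measurable_enorm_stft φ v
  have hm2 := measurable_enorm_stft φ (conjSchwartz g : 𝓢'(Rn n, ℂ))
  rw [e2, enorm_mul, ← ofReal_norm, Complex.norm_real, Real.norm_of_nonneg (by positivity)]
  gcongr
  rw [← ofReal_norm, RCLike.norm_conj, ofReal_norm]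
  refine (enorm_integral_le_lintegral_enorm _).trans ?_
  have e3 : ∀ z : Rn n × Rn n, ‖stft φ (conjSchwartz g : 𝓢'(Rn n, ℂ)) z.1 z.2 *
      conj (stft φ v z.1 z.2)‖ₑ
      = ‖stft φ v z.1 z.2‖ₑ * ‖stft φ (conjSchwartz g : 𝓢'(Rn n, ℂ)) z.1 z.2‖ₑ := by
    intro z
    rw [enorm_mul, mul_comm, ← ofReal_norm (conj _), RCLike.norm_conj, ofReal_norm]
  simp only [e3]
  rw [lintegral_prod_swap_of_measurable (F := fun x ξ => ‖stft φ v x ξ‖ₑ *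
    ‖stft φ (conjSchwartz g : 𝓢'(Rn n, ℂ)) x ξ‖ₑ) (hm.mul hm2)]
  exact lintegral_lintegral_mul_le_mixedNorm hp hq hm hm2

/-- All that necessity needs from boundedness; only the values of the operator on Schwartz functions
enter. -/
theorem exists_enorm_fracForm_le {φ : 𝓢(Rn n, ℂ)} (hφ : φ ≠ 0) {α β p₁ p₂ q₁ q₂ : ℝ}
    (hβ : 0 < β) (hβα : β ≤ α) (hα : α < n) (hp₂ : 1 < p₂) (hq₂ : 1 < q₂)
    (hb : FractionalIntegralBounded φ α β p₁ q₁ p₂ q₂) :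
    ∃ C : ℝ≥0∞, C ≠ ∞ ∧ ∀ f g : 𝓢(Rn n, ℂ), ‖fracForm α β f g‖ₑ ≤
      C * (modulationNorm φ p₁ q₁ (f : 𝓢'(Rn n, ℂ)) *
        modulationNorm φ p₂.conjExponent q₂.conjExponent (conjSchwartz g : 𝓢'(Rn n, ℂ))) := by
  obtain ⟨T, -, hT, C, hC⟩ := hb
  refine ⟨ENNReal.ofReal (reproConst φ)⁻¹ * C, by finiteness, fun f g => ?_⟩
  obtain ⟨hf, hfT⟩ := hT f
  obtain ⟨B, hB⟩ := exists_norm_fractionalIntegral_le α β f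
  have h := enorm_le_modulationNorm_mul hφ (Real.HolderConjugate.conjExponent hp₂)
    (Real.HolderConjugate.conjExponent hq₂) hfT (continuous_fractionalIntegral hβ hβα hα f) hB g
  rw [(hfT g).2, integral_mul_fractionalIntegral hβ hβα hα] at h
  refine h.trans ?_
  rw [mul_assoc, ← mul_assoc (C : ℝ≥0∞)]
  gcongr
  exact hC ⟨f, hf⟩

end Pairing

/-! ### Test functions: sums of dilated bumps -/

section Dilation

variable {n : ℕ}

/-- The dilation `ζ ↦ f (t ζ)` of a Schwartz function. -/
def dilate {t : ℝ} (ht : 0 < t) (f : 𝓢(Rn n, ℂ)) : 𝓢(Rn n, ℂ) :=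
  SchwartzMap.compCLMOfContinuousLinearEquiv ℂ
    (ContinuousLinearEquiv.smulLeft (R₁ := ℝ) (M₁ := Rn n) (Units.mk0 t ht.ne')) f

theorem dilate_apply {t : ℝ} (ht : 0 < t) (f : 𝓢(Rn n, ℂ)) (x : Rn n) :
    dilate ht f x = f (t • x) := rfl

theorem fourierInv_dilate_apply {t : ℝ} (ht : 0 < t) (f : 𝓢(Rn n, ℂ)) (x : Rn n) :
    𝓕⁻ (dilate ht f) (t • x) = ((t ^ (-(n : ℝ)) : ℝ) : ℂ) * 𝓕⁻ f x := by
  rw [SchwartzMap.fourierInv_coe, SchwartzMap.fourierInv_coe, Real.fourierInv_eq',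
    Real.fourierInv_eq', ← integral_comp_smul_eq _ ht]
  congr with ζ
  rw [dilate_apply, real_inner_smul_left, real_inner_smul_right]

theorem stft_fourierInv_dilate (φ f : 𝓢(Rn n, ℂ)) {t : ℝ} (ht : 0 < t) (y η : Rn n) :
    stft φ (𝓕⁻ (dilate ht f) : 𝓢(Rn n, ℂ)) y η
      = ∫ v, character (-(t • η)) v * (𝓕⁻ f v * conjSchwartz φ (-y + t • v)) := by
  rw [stft_coe_apply]
  have h := integral_comp_smul_eq (fun s => character (-η) s *
    (𝓕⁻ (dilate ht f) s * conjSchwartz φ (-y + s))) ht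
  simp only [fourierInv_dilate_apply] at h
  have ht' : ((t ^ (-(n : ℝ)) : ℝ) : ℂ) ≠ 0 := by
    exact Complex.ofReal_ne_zero.2 (Real.rpow_pos_of_pos ht _).ne'
  refine mul_left_cancel₀ ht' (h.symm.trans ?_)
  rw [← integral_const_mul]
  congr with v
  rw [← smul_neg, character_smul_left]
  ring

theorem scaleWt_neg (M t : ℝ) (a : Rn n) : scaleWt M t (-a) = scaleWt M t a := by
  simp only [scaleWt, norm_neg, smul_neg]

theorem exists_norm_stft_fourierInv_dilate_le (φ f : 𝓢(Rn n, ℂ)) (N : ℕ) :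
    ∃ C : ℝ, 0 ≤ C ∧ ∀ (t : ℝ) (ht : 0 < t) (y η : Rn n),
      ‖stft φ (𝓕⁻ (dilate ht f) : 𝓢(Rn n, ℂ)) y η‖ ≤
        C * (1 + ‖min t 1 • η‖) ^ (-(N : ℝ)) * scaleWt N t y := by
  obtain ⟨C, hC, h⟩ := exists_norm_scaled_integral_le (𝓕⁻ f) (conjSchwartz φ) N
  refine ⟨C, hC, fun t ht y η => ?_⟩
  rw [stft_fourierInv_dilate, ← scaleWt_neg]
  exact h t ht η (-y)

/-- With `f = 𝓕⁻ P` and `g = 𝓕 Q`, both norms in the bilinear inequality are then of inverse Fourier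
transforms, while the form itself sees the product `P Q`. -/
theorem conjSchwartz_fourier {Q : 𝓢(Rn n, ℂ)} (hQ : ∀ ζ, conj (Q ζ) = Q ζ) :
    conjSchwartz (𝓕 Q) = 𝓕⁻ Q := by
  ext x
  rw [conjSchwartz_apply, SchwartzMap.fourier_coe, SchwartzMap.fourierInv_coe, Real.fourier_eq',
    Real.fourierInv_eq', ← integral_conj]
  congr with ζ
  rw [smul_eq_mul, smul_eq_mul, map_mul, hQ, ← Complex.exp_conj]
  congr 2
  simp only [map_mul, Complex.conj_ofReal, Complex.conj_I]
  push_cast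
  ring

/-- A nonnegative combination of dilated bumps. -/
def bumpSum {t : ℕ → ℝ} (ht : ∀ j, 0 < t j) (a : ℕ → ℝ) (s : Finset ℕ) : 𝓢(Rn n, ℂ) :=
  ∑ j ∈ s, (a j : ℂ) • dilate (ht j) bump

theorem bumpSum_apply {t : ℕ → ℝ} (ht : ∀ j, 0 < t j) (a : ℕ → ℝ) (s : Finset ℕ) (ζ : Rn n) :
    bumpSum ht a s ζ
      = ((∑ j ∈ s, a j * Real.smoothTransition (2 - ‖t j • ζ‖ ^ 2) : ℝ) : ℂ) := by
  rw [bumpSum, sum_apply]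
  push_cast
  refine Finset.sum_congr rfl fun j _ => ?_
  rfl

theorem stft_fourierInv_bumpSum (φ : 𝓢(Rn n, ℂ)) {t : ℕ → ℝ} (ht : ∀ j, 0 < t j) (a : ℕ → ℝ)
    (s : Finset ℕ) (y η : Rn n) :
    stft φ (𝓕⁻ (bumpSum ht a s) : 𝓢(Rn n, ℂ)) y η
      = ∑ j ∈ s, (a j : ℂ) * stft φ (𝓕⁻ (dilate (ht j) bump) : 𝓢(Rn n, ℂ)) y η := by
  rw [bumpSum, FourierTransform.fourierInv_sum, stft, map_sum, sum_apply]
  refine Finset.sum_congr rfl fun j _ => ?_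
  rw [FourierTransform.fourierInv_smul, map_smul]
  rfl

/-- The integral of the symbol `(2π‖ζ‖)^{-γ}` against the square of `bump`. -/
def bumpConst (n : ℕ) (γ : ℝ) : ℝ :=
  ∫ ζ : Rn n, (2 * Real.pi * ‖ζ‖) ^ (-γ) * Real.smoothTransition (2 - ‖ζ‖ ^ 2) ^ 2

theorem integrable_rpow_mul_bump_sq {γ : ℝ} (hγ : 0 ≤ γ) (hγn : γ < n) :
    Integrable fun ζ : Rn n =>
      (2 * Real.pi * ‖ζ‖) ^ (-γ) * Real.smoothTransition (2 - ‖ζ‖ ^ 2) ^ 2 := by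
  refine (integrable_rpow_mul_schwartz hγ hγn (mulSchwartz bump bump)).re.congr
    (Filter.Eventually.of_forall fun ζ => ?_)
  simp only [mulSchwartz_apply, bump_apply]
  rw [← Complex.ofReal_mul, ← Complex.ofReal_mul]
  simp [sq]

theorem bumpConst_pos {γ : ℝ} (hγ : 0 < γ) (hγn : γ < n) : 0 < bumpConst n γ := by
  have hn : 0 < n := by exact_mod_cast hγ.trans hγn
  refine (integral_pos_iff_support_of_nonneg (fun ζ => by positivity)
    (integrable_rpow_mul_bump_sq hγ.le hγn)).2 ?_
  have hsub : Metric.ball (0 : Rn n) 1 \ {0} ⊆ Function.support fun ζ : Rn n =>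
      (2 * Real.pi * ‖ζ‖) ^ (-γ) * Real.smoothTransition (2 - ‖ζ‖ ^ 2) ^ 2 := by
    intro ζ hζ
    have h1 : ‖ζ‖ < 1 := by simpa using hζ.1
    have h0 : 0 < ‖ζ‖ := norm_pos_iff.2 hζ.2
    have h2 : Real.smoothTransition (2 - ‖ζ‖ ^ 2) = 1 :=
      Real.smoothTransition.one_of_one_le (by nlinarith)
    rw [Function.mem_support, h2, one_pow, mul_one]
    positivity
  have : Nonempty (Fin n) := ⟨⟨0, hn⟩⟩
  refine lt_of_lt_of_le ?_ (measure_mono hsub)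
  rw [measure_sdiff_null (measure_singleton _)]
  exact Metric.measure_ball_pos _ _ one_pos

theorem integrable_rpow_mul_dilate_bump_sq {γ : ℝ} (hγ : 0 ≤ γ) (hγn : γ < n) {t : ℝ}
    (ht : 0 < t) : Integrable (fun ζ : Rn n =>
      (2 * Real.pi * ‖ζ‖) ^ (-γ) * Real.smoothTransition (2 - ‖t • ζ‖ ^ 2) ^ 2) ∧
    ∫ ζ : Rn n, (2 * Real.pi * ‖ζ‖) ^ (-γ) * Real.smoothTransition (2 - ‖t • ζ‖ ^ 2) ^ 2
      = t ^ (γ - n) * bumpConst n γ := by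
  have e : ∀ ζ : Rn n, (2 * Real.pi * ‖ζ‖) ^ (-γ) * Real.smoothTransition (2 - ‖t • ζ‖ ^ 2) ^ 2
      = t ^ γ * ((fun z : Rn n => (2 * Real.pi * ‖z‖) ^ (-γ) *
        Real.smoothTransition (2 - ‖z‖ ^ 2) ^ 2) (t • ζ)) := by
    intro ζ
    have : (2 * Real.pi * ‖t • ζ‖) ^ (-γ) = t ^ (-γ) * (2 * Real.pi * ‖ζ‖) ^ (-γ) := by
      rw [norm_smul, Real.norm_of_nonneg ht.le, ← Real.mul_rpow ht.le (by positivity)]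
      ring_nf
    simp only [this]
    have h1 : t ^ γ * t ^ (-γ) = 1 := by rw [← Real.rpow_add ht, add_neg_cancel, Real.rpow_zero]
    linear_combination (-(2 * Real.pi * ‖ζ‖) ^ (-γ) *
      Real.smoothTransition (2 - ‖t • ζ‖ ^ 2) ^ 2) * h1
  have h := integrable_rpow_mul_bump_sq hγ hγn
  refine ⟨?_, ?_⟩
  · rw [integrable_congr (Filter.Eventually.of_forall e)]
    exact (h.comp_smul ht.ne').const_mul _
  · rw [integral_congr_ae (Filter.Eventually.of_forall e), integral_const_mul,
      Measure.integral_comp_smul volume (fun z : Rn n => (2 * Real.pi * ‖z‖) ^ (-γ) *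
        Real.smoothTransition (2 - ‖z‖ ^ 2) ^ 2) t, finrank_euclideanSpace_fin,
      abs_of_pos (by positivity), Real.rpow_sub ht, Real.rpow_natCast, smul_eq_mul, bumpConst]
    ring

/-- Symbol, coefficients and bumps are all nonnegative, so the other potential and the products of
distinct bumps may be dropped; the diagonal terms are computed by scaling. -/
theorem sum_le_norm_fracForm {α β : ℝ} (hβ : 0 < β) (hβα : β ≤ α) (hα : α < n) {γ : ℝ}
    (hγ : γ = α ∨ γ = β) {t : ℕ → ℝ} (ht : ∀ j, 0 < t j) {a b : ℕ → ℝ} (ha : ∀ j, 0 ≤ a j)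
    (hb : ∀ j, 0 ≤ b j) (s : Finset ℕ) :
    ∑ j ∈ s, a j * b j * (t j ^ (γ - n) * bumpConst n γ) ≤
      ‖fracForm α β (𝓕⁻ (bumpSum ht a s) : 𝓢(Rn n, ℂ)) (𝓕 (bumpSum ht b s) : 𝓢(Rn n, ℂ))‖ := by
  have hα0 : 0 < α := hβ.trans_le hβα
  have hγ0 : 0 ≤ γ := by rcases hγ with rfl | rfl <;> positivity
  have hγn : γ < n := by rcases hγ with rfl | rfl <;> linarith
  set P : (ℕ → ℝ) → Rn n → ℝ := fun a ζ =>
    ∑ j ∈ s, a j * Real.smoothTransition (2 - ‖t j • ζ‖ ^ 2) with hP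
  set m : Rn n → ℝ := fun ζ => (2 * Real.pi * ‖ζ‖) ^ (-α) + (2 * Real.pi * ‖ζ‖) ^ (-β) with hm
  have hint : Integrable fun ζ => m ζ * (P a ζ * P b ζ) := by
    refine (integrable_symbol_mul hβ hβα hα (mulSchwartz (bumpSum ht a s) (bumpSum ht b s))).re.congr
      (Filter.Eventually.of_forall fun ζ => ?_)
    simp only [mulSchwartz_apply, bumpSum_apply]
    rw [← Complex.ofReal_mul, ← Complex.ofReal_mul]
    simp [hP, hm]
  have e : fracForm α β (𝓕⁻ (bumpSum ht a s) : 𝓢(Rn n, ℂ)) (𝓕 (bumpSum ht b s) : 𝓢(Rn n, ℂ))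
      = ((∫ ζ, m ζ * (P a ζ * P b ζ) : ℝ) : ℂ) := by
    rw [fracForm_eq hβ hβα hα, ← integral_complex_ofReal]
    congr with ζ
    rw [FourierTransform.fourier_fourierInv_eq (F := 𝓢(Rn n, ℂ)),
      FourierTransform.fourierInv_fourier_eq (F := 𝓢(Rn n, ℂ)), bumpSum_apply, bumpSum_apply]
    push_cast [hP, hm]
    rfl
  rw [e, Complex.norm_real]
  refine le_trans ?_ (le_abs_self _)
  have hi : ∀ j, Integrable fun ζ : Rn n => a j * b j * ((2 * Real.pi * ‖ζ‖) ^ (-γ) *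
      Real.smoothTransition (2 - ‖t j • ζ‖ ^ 2) ^ 2) := fun j =>
    (integrable_rpow_mul_dilate_bump_sq hγ0 hγn (ht j)).1.const_mul _
  calc ∑ j ∈ s, a j * b j * (t j ^ (γ - n) * bumpConst n γ)
      = ∫ ζ : Rn n, ∑ j ∈ s, a j * b j * ((2 * Real.pi * ‖ζ‖) ^ (-γ) *
        Real.smoothTransition (2 - ‖t j • ζ‖ ^ 2) ^ 2) := by
        rw [integral_finsetSum _ fun j _ => hi j]
        refine Finset.sum_congr rfl fun j _ => ?_
        rw [integral_const_mul, (integrable_rpow_mul_dilate_bump_sq hγ0 hγn (ht j)).2]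
    _ ≤ ∫ ζ, m ζ * (P a ζ * P b ζ) := by
        refine integral_mono (integrable_finsetSum _ fun j _ => hi j) hint fun ζ => ?_
        have hS : ∀ j, 0 ≤ Real.smoothTransition (2 - ‖t j • ζ‖ ^ 2) := fun j =>
          Real.smoothTransition.nonneg _
        have hmγ : (2 * Real.pi * ‖ζ‖) ^ (-γ) ≤ m ζ := by
          have h1 : 0 ≤ (2 * Real.pi * ‖ζ‖) ^ (-α) := by positivity
          have h2 : 0 ≤ (2 * Real.pi * ‖ζ‖) ^ (-β) := by positivity
          rcases hγ with rfl | rfl <;> simp only [hm] <;> linarith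
        have h3 : ∑ j ∈ s, (a j * Real.smoothTransition (2 - ‖t j • ζ‖ ^ 2)) *
            (b j * Real.smoothTransition (2 - ‖t j • ζ‖ ^ 2)) ≤ P a ζ * P b ζ := by
          rw [hP, Finset.sum_mul]
          refine Finset.sum_le_sum fun j hj => ?_
          refine mul_le_mul_of_nonneg_left ?_ (mul_nonneg (ha j) (hS j))
          exact Finset.single_le_sum (f := fun j => b j *
            Real.smoothTransition (2 - ‖t j • ζ‖ ^ 2)) (fun i _ => mul_nonneg (hb i) (hS i)) hj
        have h4 : 0 ≤ P a ζ * P b ζ := mul_nonneg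
          (Finset.sum_nonneg fun j _ => mul_nonneg (ha j) (hS j))
          (Finset.sum_nonneg fun j _ => mul_nonneg (hb j) (hS j))
        calc ∑ j ∈ s, a j * b j * ((2 * Real.pi * ‖ζ‖) ^ (-γ) *
              Real.smoothTransition (2 - ‖t j • ζ‖ ^ 2) ^ 2)
            = (2 * Real.pi * ‖ζ‖) ^ (-γ) *
              ∑ j ∈ s, (a j * Real.smoothTransition (2 - ‖t j • ζ‖ ^ 2)) *
                (b j * Real.smoothTransition (2 - ‖t j • ζ‖ ^ 2)) := by
              rw [Finset.mul_sum]
              refine Finset.sum_congr rfl fun j _ => ?_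
              ring
          _ ≤ _ := mul_le_mul hmγ h3 (Finset.sum_nonneg fun j _ =>
              mul_nonneg (mul_nonneg (ha j) (hS j)) (mul_nonneg (hb j) (hS j)))
              (le_trans (by positivity) hmγ)

end Dilation

/-! ### Necessity: one large dilation for space, dyadic sums for frequency -/

section Necessity

variable {n : ℕ}

theorem nonpos_of_forall_natCast_rpow_le {e c : ℝ} {E : ℝ≥0∞} (hc : 0 < c) (hE : E ≠ ∞)
    (h : ∀ J : ℕ, 2 ≤ J → ENNReal.ofReal ((J : ℝ) ^ e * c) ≤ E) : e ≤ 0 := by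
  by_contra! he
  have ht : Filter.Tendsto (fun J : ℕ => (J : ℝ) ^ e) Filter.atTop Filter.atTop :=
    (tendsto_rpow_atTop he).comp tendsto_natCast_atTop_atTop
  obtain ⟨J, hJ2, hJ⟩ := ((Filter.eventually_ge_atTop 2).and
    (ht.eventually_gt_atTop (E.toReal / c))).exists
  have h1 := (ENNReal.ofReal_le_iff_le_toReal hE).1 (h J hJ2)
  rw [div_lt_iff₀ hc] at hJ
  linarith

/-- For `t > 1` the function is spread over the length `t` with height `t^(-n)`, at frequencies of
order one; hence the power depends on `p` only. -/
theorem exists_modulationNorm_dilate_le (φ f : 𝓢(Rn n, ℂ)) {p q : ℝ} (hp : 1 < p) (hq : 1 < q) :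
    ∃ D : ℝ≥0∞, D ≠ ∞ ∧ ∀ (t : ℝ) (ht : 0 < t), 1 < t →
      modulationNorm φ p q (𝓕⁻ (dilate ht f) : 𝓢(Rn n, ℂ)) ≤
        D * ENNReal.ofReal (t ^ (n / p - n)) := by
  obtain ⟨C, hC, h⟩ := exists_norm_stft_fourierInv_dilate_le φ f (n + 1)
  set N : ℝ := ((n + 1 : ℕ) : ℝ) with hN
  have hn0 : (0 : ℝ) ≤ n := Nat.cast_nonneg n
  have hp0 : 0 < p := by linarith
  have hq0 : 0 < q := by linarith
  have hNp : n < N * p := by rw [hN]; push_cast; nlinarith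
  have hNq : n < N * q := by rw [hN]; push_cast; nlinarith
  have hIp := lintegral_wt_rpow_ne_top (n := n) hp0.le hNp
  have hIq := lintegral_wt_rpow_ne_top (n := n) hq0.le hNq
  set Ip := ∫⁻ x : Rn n, wt N x ^ p
  set Iq := ∫⁻ x : Rn n, wt N x ^ q
  refine ⟨ENNReal.ofReal C * (Ip ^ (1 / p) * Iq ^ (1 / q)), ?_, fun t ht ht1 => ?_⟩
  · exact ENNReal.mul_ne_top ENNReal.ofReal_ne_top (ENNReal.mul_ne_top
      (ENNReal.rpow_ne_top_of_nonneg (by positivity) hIp)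
      (ENNReal.rpow_ne_top_of_nonneg (by positivity) hIq))
  have hti : 0 < t⁻¹ := inv_pos.2 ht
  have hmeas : Measurable fun y : Rn n => wt N (t⁻¹ • y) := by fun_prop
  have hle : modulationNorm φ p q (𝓕⁻ (dilate ht f) : 𝓢(Rn n, ℂ)) ≤
      mixedNorm p q (fun y η : Rn n => ENNReal.ofReal (C * t ^ (-(n : ℝ))) *
        (wt N (t⁻¹ • y) * wt N η)) := by
    rw [modulationNorm_eq_mixedNorm]
    refine mixedNorm_mono hp0 hq0 fun y η => ?_
    rw [← ofReal_norm, wt, wt, ← ENNReal.ofReal_mul (by positivity),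
      ← ENNReal.ofReal_mul (by positivity)]
    refine ENNReal.ofReal_le_ofReal ((h t ht y η).trans_eq ?_)
    rw [min_eq_right ht1.le, one_smul, scaleWt, if_neg (not_le.2 ht1)]
    ring
  refine hle.trans ?_
  rw [mixedNorm_const_mul hp0 hq0 (by fun_prop), mixedNorm_tensor hp0 hq0 hmeas (by fun_prop),
    lintegral_comp_smul (f := fun y : Rn n => wt N y ^ p) (by fun_prop) hti,
    ENNReal.mul_rpow_of_nonneg _ _ (by positivity),
    ENNReal.ofReal_rpow_of_nonneg (by positivity) (by positivity), ENNReal.ofReal_mul hC]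
  have e : t ^ (n / p - n) = t ^ (-(n : ℝ)) * ((t⁻¹) ^ (-(n : ℝ))) ^ (1 / p) := by
    rw [Real.inv_rpow ht.le, ← Real.rpow_neg ht.le, neg_neg, ← Real.rpow_mul ht.le,
      ← Real.rpow_add ht]
    ring_nf
  rw [e, ENNReal.ofReal_mul (by positivity)]
  refine le_of_eq ?_
  ring

/-- The boundedness of `I_{α,β}` forces the condition on the integrability in space. -/
theorem one_div_le_of_fractionalIntegralBounded {φ : 𝓢(Rn n, ℂ)} (hφ : φ ≠ 0)
    {α β p₁ p₂ q₁ q₂ : ℝ} (hβ : 0 < β) (hβα : β ≤ α) (hα : α < n) (hp₁ : 1 < p₁) (hp₂ : 1 < p₂)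
    (hq₁ : 1 < q₁) (hq₂ : 1 < q₂) (hb : FractionalIntegralBounded φ α β p₁ q₁ p₂ q₂) :
    1 / p₂ ≤ 1 / p₁ - α / n := by
  have hα0 : 0 < α := hβ.trans_le hβα
  have hn : (0 : ℝ) < n := hα0.trans hα
  have hp' := Real.HolderConjugate.conjExponent hp₂
  have hq' := Real.HolderConjugate.conjExponent hq₂
  obtain ⟨C, hC, h⟩ := exists_enorm_fracForm_le hφ hβ hβα hα hp₂ hq₂ hb
  obtain ⟨D₁, hD₁, h₁⟩ := exists_modulationNorm_dilate_le φ bump hp₁ hq₁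
  obtain ⟨D₂, hD₂, h₂⟩ := exists_modulationNorm_dilate_le φ bump hp'.symm.lt hq'.symm.lt
  -- The power of `J` on the left of the bilinear inequality minus that on the right, for a single
  -- bump dilated by `J`.
  have key : α - n - (n / p₁ - n + (n / p₂.conjExponent - n)) ≤ 0 := by
    refine nonpos_of_forall_natCast_rpow_le (bumpConst_pos hα0 hα)
      (E := C * (D₁ * D₂)) (by finiteness) fun J hJ => ?_
    have hJ1 : (1 : ℝ) < J := by exact_mod_cast (by omega : 1 < J)
    have hJ0 : (0 : ℝ) < J := by linarith
    have hl := sum_le_norm_fracForm hβ hβα hα (Or.inl rfl) (t := fun _ => (J : ℝ))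
      (fun _ => hJ0) (a := fun _ => 1) (b := fun _ => 1) (fun _ => zero_le_one)
      (fun _ => zero_le_one) {0}
    have hone : bumpSum (n := n) (t := fun _ => (J : ℝ)) (fun _ => hJ0) (fun _ => 1) {0}
        = dilate hJ0 bump := by
      simp [bumpSum]
    have hreal : ∀ ζ : Rn n, conj (dilate hJ0 bump ζ) = dilate hJ0 bump ζ := fun ζ => by
      rw [dilate_apply, bump_apply, Complex.conj_ofReal]
    rw [hone, Finset.sum_singleton, one_mul, one_mul] at hl
    have hu := h (𝓕⁻ (dilate hJ0 bump)) (𝓕 (dilate hJ0 bump))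
    rw [conjSchwartz_fourier hreal, ← ofReal_norm] at hu
    have hfin : ENNReal.ofReal ((J : ℝ) ^ (α - n) * bumpConst n α) ≤ C * (D₁ * D₂) *
        ENNReal.ofReal ((J : ℝ) ^ (n / p₁ - n + (n / p₂.conjExponent - n))) := by
      refine (ENNReal.ofReal_le_ofReal hl).trans (hu.trans ?_)
      rw [Real.rpow_add hJ0, ENNReal.ofReal_mul (by positivity)]
      calc _ ≤ C * (D₁ * ENNReal.ofReal ((J : ℝ) ^ (n / p₁ - n)) *
            (D₂ * ENNReal.ofReal ((J : ℝ) ^ (n / p₂.conjExponent - n)))) := by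
            gcongr
            · exact h₁ J hJ0 hJ1
            · exact h₂ J hJ0 hJ1
        _ = _ := by ring
    rw [Real.rpow_sub hJ0, div_mul_eq_mul_div, ENNReal.ofReal_div_of_pos (by positivity)]
    exact ENNReal.div_le_of_le_mul hfin
  have e : 1 / p₂.conjExponent = 1 - 1 / p₂ := by
    rw [one_div, one_div, ← hp'.inv_add_inv_eq_one]; ring
  have h3 : (n : ℝ) / p₂.conjExponent = n * (1 - 1 / p₂) := by rw [← e]; ring
  have h4 : (n : ℝ) / p₁ = n * (1 / p₁) := by ring
  rw [h3, h4] at key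
  have h5 : α / n ≤ 1 / p₁ - 1 / p₂ := by
    rw [div_le_iff₀ hn]
    linarith
  linarith

/-- With `s = 2^(-j) ‖η‖`, each term is `‖η‖^(-d)` times `s^d (1+s)^(-N)`, which decays
geometrically away from `s ~ 1` on both sides because `0 < d < N`. -/
theorem exists_sum_dyadic_le {d N : ℝ} (hd : 0 < d) (hdN : d < N) :
    ∃ C : ℝ≥0∞, C ≠ ∞ ∧ ∀ (J : ℕ) (η : Rn n), η ≠ 0 →
      ∑ j ∈ Finset.range J, ENNReal.ofReal (((2 : ℝ)⁻¹ ^ j) ^ d) * wt N ((2 : ℝ)⁻¹ ^ j • η) ≤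
        C * ENNReal.ofReal (‖η‖ ^ (-d)) := by
  set δ := min d (N - d) with hδ
  obtain ⟨C, hC, h⟩ := exists_tsum_two_rpow_le (lt_min hd (sub_pos.2 hdN) : 0 < δ)
  refine ⟨C, hC, fun J η hη => ?_⟩
  have hr : 0 < ‖η‖ := norm_pos_iff.2 hη
  set x := Real.logb 2 ‖η‖ with hx
  have hterm : ∀ j : ℕ, ENNReal.ofReal (((2 : ℝ)⁻¹ ^ j) ^ d) * wt N ((2 : ℝ)⁻¹ ^ j • η) ≤
      (2 : ℝ≥0∞) ^ (-δ * |x - ((j : ℤ) : ℝ)|) * ENNReal.ofReal (‖η‖ ^ (-d)) := by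
    intro j
    have h2 : ∀ r : ℝ, (2 : ℝ≥0∞) ^ r = ENNReal.ofReal (2 ^ r) := fun r => by
      rw [← ENNReal.ofReal_rpow_of_pos two_pos, ENNReal.ofReal_ofNat]
    rw [h2, wt, ← ENNReal.ofReal_mul (by positivity),
      ← ENNReal.ofReal_mul (by positivity)]
    refine ENNReal.ofReal_le_ofReal ?_
    set s := (2 : ℝ)⁻¹ ^ j * ‖η‖ with hs
    have hs0 : 0 < s := by positivity
    have hsx : s = 2 ^ (x - ((j : ℤ) : ℝ)) := by
      rw [Real.rpow_sub two_pos, hx, Real.rpow_logb two_pos (by norm_num) hr, hs, Int.cast_natCast,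
        Real.rpow_natCast, inv_pow]
      ring
    have hnorm : ‖(2 : ℝ)⁻¹ ^ j • η‖ = s := by
      rw [norm_smul, Real.norm_of_nonneg (by positivity)]
    have hsd : ((2 : ℝ)⁻¹ ^ j) ^ d = s ^ d * ‖η‖ ^ (-d) := by
      rw [hs, Real.mul_rpow (by positivity) hr.le, mul_assoc, ← Real.rpow_add hr, add_neg_cancel,
        Real.rpow_zero, mul_one]
    have hmain : s ^ d * (1 + s) ^ (-N) ≤ 2 ^ (-δ * |x - ((j : ℤ) : ℝ)|) := by
      set y := x - ((j : ℤ) : ℝ)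
      rcases le_total y 0 with hy | hy
      · calc s ^ d * (1 + s) ^ (-N) ≤ s ^ d :=
              mul_le_of_le_one_right (by positivity)
                (Real.rpow_le_one_of_one_le_of_nonpos (by linarith) (by linarith))
          _ = 2 ^ (y * d) := by rw [hsx, ← Real.rpow_mul two_pos.le]
          _ ≤ _ := by
              refine Real.rpow_le_rpow_of_exponent_le one_le_two ?_
              rw [abs_of_nonpos hy]
              nlinarith [min_le_left d (N - d)]
      · calc s ^ d * (1 + s) ^ (-N) ≤ s ^ d * s ^ (-N) := by
              gcongr ?_ * ?_
              exact Real.rpow_le_rpow_of_nonpos hs0 (by linarith) (by linarith)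
          _ = 2 ^ (y * (d - N)) := by
              rw [← Real.rpow_add hs0, hsx, ← Real.rpow_mul two_pos.le, sub_eq_add_neg]
          _ ≤ _ := by
              refine Real.rpow_le_rpow_of_exponent_le one_le_two ?_
              rw [abs_of_nonneg hy]
              nlinarith [min_le_right d (N - d)]
    rw [hnorm, hsd]
    calc s ^ d * ‖η‖ ^ (-d) * (1 + s) ^ (-N) = s ^ d * (1 + s) ^ (-N) * ‖η‖ ^ (-d) := by ring
      _ ≤ _ := by gcongr
  calc _ ≤ ∑ j ∈ Finset.range J, (2 : ℝ≥0∞) ^ (-δ * |x - ((j : ℤ) : ℝ)|) *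
        ENNReal.ofReal (‖η‖ ^ (-d)) := Finset.sum_le_sum fun j _ => hterm j
    _ = (∑ j ∈ Finset.range J, (2 : ℝ≥0∞) ^ (-δ * |x - ((j : ℤ) : ℝ)|)) *
        ENNReal.ofReal (‖η‖ ^ (-d)) := (Finset.sum_mul _ _ _).symm
    _ ≤ _ := by
        gcongr
        refine (ENNReal.sum_le_tsum _).trans (le_trans ?_ (h x))
        exact ENNReal.tsum_comp_le_tsum_of_injective (Nat.cast_injective (R := ℤ))
          (fun l : ℤ => (2 : ℝ≥0∞) ^ (-δ * |x - (l : ℝ)|))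

/-- The pieces are almost disjoint. Writing the power as `S^(q-1) S` and bounding the first factor
by `‖η‖^(-(n/q)(q-1))` leaves an expression linear in the pieces, each having the same integral by
scaling. The triangle inequality alone would give `J^q` in place of `J`. -/
theorem exists_lintegral_sum_dyadic_rpow_le (hn : 0 < n) {q N : ℝ} (hq : 1 < q) (hN : n < N) :
    ∃ D : ℝ≥0∞, D ≠ ∞ ∧ ∀ J : ℕ,
      ∫⁻ η : Rn n, (∑ j ∈ Finset.range J, ENNReal.ofReal (((2 : ℝ)⁻¹ ^ j) ^ (n / q)) *
        wt N ((2 : ℝ)⁻¹ ^ j • η)) ^ q ≤ D * J := by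
  have hnr : (0 : ℝ) < n := by exact_mod_cast hn
  have hq0 : 0 < q := by linarith
  have hd : 0 < n / q := by positivity
  have hdn : n / q < n := div_lt_self hnr hq
  obtain ⟨C, hC, h⟩ := exists_sum_dyadic_le (n := n) hd (hdn.trans hN)
  set b := n / q * (q - 1) with hb
  have hbn : b = n - n / q := by rw [hb]; field_simp
  have hH := integrable_norm_rpow_mul (n := n) (a := b) (K := N) (by rw [hbn]; linarith)
    (by rw [hbn]; linarith) (by rw [hbn]; linarith)
  set H : Rn n → ℝ≥0∞ := fun z => ENNReal.ofReal (‖z‖ ^ (-b)) * wt N z with hHdef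
  have hHm : Measurable H := by
    simp only [hHdef]
    fun_prop
  have hI : ∫⁻ z, H z ≠ ∞ := by
    have e : ∀ z : Rn n, H z = ENNReal.ofReal (‖z‖ ^ (-b) * (1 + ‖z‖) ^ (-N)) := fun z => by
      rw [ENNReal.ofReal_mul (by positivity), ← wt]
    simp only [e]
    exact ((hasFiniteIntegral_iff_ofReal (Filter.Eventually.of_forall fun z => by positivity)).1
      hH.2).ne
  refine ⟨C ^ (q - 1) * ∫⁻ z, H z, ENNReal.mul_ne_top (ENNReal.rpow_ne_top_of_nonneg
    (by linarith) hC) hI, fun J => ?_⟩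
  have hae : ∀ᵐ η : Rn n, η ≠ 0 := by
    have : Nonempty (Fin n) := ⟨⟨0, hn⟩⟩
    simp [ae_iff]
  have hscale : ∀ (j : ℕ) (η : Rn n), ENNReal.ofReal (‖η‖ ^ (-b)) *
      (ENNReal.ofReal (((2 : ℝ)⁻¹ ^ j) ^ (n / q)) * wt N ((2 : ℝ)⁻¹ ^ j • η))
      = ENNReal.ofReal (((2 : ℝ)⁻¹ ^ j) ^ (n : ℝ)) * H ((2 : ℝ)⁻¹ ^ j • η) := by
    intro j η
    have ht : (0 : ℝ) < (2 : ℝ)⁻¹ ^ j := by positivity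
    simp only [hHdef]
    rw [← mul_assoc, ← mul_assoc, ← ENNReal.ofReal_mul (by positivity),
      ← ENNReal.ofReal_mul (by positivity), norm_smul, Real.norm_of_nonneg ht.le,
      Real.mul_rpow ht.le (norm_nonneg _), ← mul_assoc, ← Real.rpow_add ht,
      show (n : ℝ) + -b = n / q by rw [hbn]; ring, mul_comm (‖η‖ ^ (-b))]
  calc _ ≤ ∫⁻ η : Rn n, C ^ (q - 1) * ∑ j ∈ Finset.range J,
        ENNReal.ofReal (((2 : ℝ)⁻¹ ^ j) ^ (n : ℝ)) * H ((2 : ℝ)⁻¹ ^ j • η) := by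
        refine lintegral_mono_ae ?_
        filter_upwards [hae] with η hη
        set S := ∑ j ∈ Finset.range J, ENNReal.ofReal (((2 : ℝ)⁻¹ ^ j) ^ (n / q)) *
          wt N ((2 : ℝ)⁻¹ ^ j • η) with hS
        calc S ^ q = S ^ (q - 1) * S := by
              conv_rhs => rw [← ENNReal.rpow_one S, ← ENNReal.rpow_mul, one_mul,
                ← ENNReal.rpow_add_of_nonneg _ _ (by linarith) zero_le_one, sub_add_cancel]
          _ ≤ (C * ENNReal.ofReal (‖η‖ ^ (-(n / q)))) ^ (q - 1) * S := by
              gcongr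
              exact h J η hη
          _ = C ^ (q - 1) * (ENNReal.ofReal (‖η‖ ^ (-b)) * S) := by
              rw [ENNReal.mul_rpow_of_nonneg _ _ (by linarith),
                ENNReal.ofReal_rpow_of_nonneg (by positivity) (by linarith),
                ← Real.rpow_mul (norm_nonneg _), mul_assoc, hb, neg_mul]
          _ = _ := by
              rw [hS, Finset.mul_sum]
              simp only [hscale]
    _ = C ^ (q - 1) * ∑ j ∈ Finset.range J, ∫⁻ z, H z := by
        have hm : ∀ j : ℕ, Measurable fun η : Rn n =>
            ENNReal.ofReal (((2 : ℝ)⁻¹ ^ j) ^ (n : ℝ)) * H ((2 : ℝ)⁻¹ ^ j • η) := fun j => by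
          fun_prop
        rw [lintegral_const_mul _ (Finset.measurable_fun_sum _ fun j _ => hm j),
          lintegral_finsetSum _ fun j _ => hm j]
        congr 1
        refine Finset.sum_congr rfl fun j _ => ?_
        have ht : (0 : ℝ) < (2 : ℝ)⁻¹ ^ j := by positivity
        rw [lintegral_const_mul _ (by fun_prop), lintegral_comp_smul hHm ht, ← mul_assoc,
          ← ENNReal.ofReal_mul (by positivity), ← Real.rpow_add ht, add_neg_cancel,
          Real.rpow_zero, ENNReal.ofReal_one, one_mul]
    _ = _ := by
        rw [Finset.sum_const, Finset.card_range, nsmul_eq_mul]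
        ring

theorem two_inv_pow_pos (j : ℕ) : (0 : ℝ) < (2 : ℝ)⁻¹ ^ j := by positivity

/-- All scales are at most `1`, so the spatial profile is common to every term and factors out. The
coefficients give each piece an `L^q` contribution of the same size. -/
theorem exists_modulationNorm_bumpSum_le (hn : 0 < n) (φ : 𝓢(Rn n, ℂ)) {p q : ℝ} (hp : 1 < p)
    (hq : 1 < q) :
    ∃ D : ℝ≥0∞, D ≠ ∞ ∧ ∀ J : ℕ,
      modulationNorm φ p q (𝓕⁻ (bumpSum two_inv_pow_pos (fun j => ((2 : ℝ)⁻¹ ^ j) ^ (n / q))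
        (Finset.range J)) : 𝓢(Rn n, ℂ)) ≤ D * ENNReal.ofReal ((J : ℝ) ^ (1 / q)) := by
  obtain ⟨C, hC, h⟩ := exists_norm_stft_fourierInv_dilate_le φ bump (n + 1)
  set N : ℝ := ((n + 1 : ℕ) : ℝ) with hN
  have hn0 : (0 : ℝ) ≤ n := Nat.cast_nonneg n
  have hp0 : 0 < p := by linarith
  have hq0 : 0 < q := by linarith
  have hNn : n < N := by rw [hN]; push_cast; linarith
  have hNp : n < N * p := by rw [hN]; push_cast; nlinarith
  have hIp := lintegral_wt_rpow_ne_top (n := n) hp0.le hNp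
  obtain ⟨D, hD, hsum⟩ := exists_lintegral_sum_dyadic_rpow_le hn hq hNn
  set Ip := ∫⁻ x : Rn n, wt N x ^ p
  refine ⟨ENNReal.ofReal C * (Ip ^ (1 / p) * D ^ (1 / q)), ?_, fun J => ?_⟩
  · exact ENNReal.mul_ne_top ENNReal.ofReal_ne_top (ENNReal.mul_ne_top
      (ENNReal.rpow_ne_top_of_nonneg (by positivity) hIp)
      (ENNReal.rpow_ne_top_of_nonneg (by positivity) hD))
  set S : Rn n → ℝ≥0∞ := fun η => ∑ j ∈ Finset.range J,
    ENNReal.ofReal (((2 : ℝ)⁻¹ ^ j) ^ (n / q)) * wt N ((2 : ℝ)⁻¹ ^ j • η) with hS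
  have hSm : Measurable S := Finset.measurable_fun_sum _ fun j _ => by fun_prop
  have hle : modulationNorm φ p q (𝓕⁻ (bumpSum two_inv_pow_pos
      (fun j => ((2 : ℝ)⁻¹ ^ j) ^ (n / q)) (Finset.range J)) : 𝓢(Rn n, ℂ)) ≤
      mixedNorm p q (fun y η : Rn n => ENNReal.ofReal C * (wt N y * S η)) := by
    rw [modulationNorm_eq_mixedNorm]
    refine mixedNorm_mono hp0 hq0 fun y η => ?_
    rw [stft_fourierInv_bumpSum, hS]
    refine (enorm_sum_le _ _).trans ?_
    rw [Finset.mul_sum, Finset.mul_sum]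
    refine Finset.sum_le_sum fun j _ => ?_
    have ht := two_inv_pow_pos j
    have ht1 : (2 : ℝ)⁻¹ ^ j ≤ 1 := pow_le_one₀ (by norm_num) (by norm_num)
    have hj := h _ ht y η
    rw [min_eq_left ht1, scaleWt, if_pos ht1] at hj
    rw [← ofReal_norm, norm_mul, Complex.norm_real, Real.norm_of_nonneg (by positivity), wt, wt,
      ← ENNReal.ofReal_mul (by positivity), ← ENNReal.ofReal_mul (by positivity),
      ← ENNReal.ofReal_mul (by positivity)]
    refine ENNReal.ofReal_le_ofReal ?_
    calc _ ≤ ((2 : ℝ)⁻¹ ^ j) ^ (n / q) * (C * (1 + ‖(2 : ℝ)⁻¹ ^ j • η‖) ^ (-N) *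
          (1 + ‖y‖) ^ (-N)) := by gcongr
      _ = _ := by ring
  refine hle.trans ?_
  rw [mixedNorm_const_mul hp0 hq0
    (((measurable_wt N).comp measurable_fst).mul (hSm.comp measurable_snd)),
    mixedNorm_tensor hp0 hq0 (by fun_prop) hSm, mul_assoc, mul_assoc,
    ← ENNReal.ofReal_rpow_of_nonneg (by positivity) (by positivity),
    ← ENNReal.mul_rpow_of_nonneg _ _ (by positivity), ENNReal.ofReal_natCast]
  gcongr
  exact hsum J

/-- The boundedness of `I_{α,β}` forces the condition on the integrability in frequency. -/
theorem one_div_lt_of_fractionalIntegralBounded {φ : 𝓢(Rn n, ℂ)} (hφ : φ ≠ 0)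
    {α β p₁ p₂ q₁ q₂ : ℝ} (hβ : 0 < β) (hβα : β ≤ α) (hα : α < n) (hp₁ : 1 < p₁) (hp₂ : 1 < p₂)
    (hq₁ : 1 < q₁) (hq₂ : 1 < q₂) (hb : FractionalIntegralBounded φ α β p₁ q₁ p₂ q₂) :
    1 / q₂ < 1 / q₁ + β / n := by
  by_contra! hcon
  have hβn : β < n := hβα.trans_lt hα
  have hn : (0 : ℝ) < n := hβ.trans hβn
  have hn' : 0 < n := by exact_mod_cast hn
  have hp' := Real.HolderConjugate.conjExponent hp₂
  have hq' := Real.HolderConjugate.conjExponent hq₂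
  obtain ⟨C, hC, h⟩ := exists_enorm_fracForm_le hφ hβ hβα hα hp₂ hq₂ hb
  obtain ⟨D₁, hD₁, h₁⟩ := exists_modulationNorm_bumpSum_le hn' φ hp₁ hq₁
  obtain ⟨D₂, hD₂, h₂⟩ := exists_modulationNorm_bumpSum_le hn' φ hp'.symm.lt hq'.symm.lt
  have e : 1 / q₂.conjExponent = 1 - 1 / q₂ := by
    rw [one_div, one_div, ← hq'.inv_add_inv_eq_one]; ring
  -- This amounts to `1/q₂ ≤ 1/q₁`, incompatible with the negated claim since `β > 0`.
  have key : 1 - (1 / q₁ + 1 / q₂.conjExponent) ≤ 0 := by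
    refine nonpos_of_forall_natCast_rpow_le (bumpConst_pos hβ hβn)
      (E := C * (D₁ * D₂)) (by finiteness) fun J hJ => ?_
    have hJ0 : (0 : ℝ) < J := by exact_mod_cast (by omega : 0 < J)
    have hl := sum_le_norm_fracForm hβ hβα hα (Or.inr rfl) two_inv_pow_pos
      (a := fun j => ((2 : ℝ)⁻¹ ^ j) ^ (n / q₁))
      (b := fun j => ((2 : ℝ)⁻¹ ^ j) ^ (n / q₂.conjExponent)) (fun j => by positivity)
      (fun j => by positivity) (Finset.range J)
    have hlow : (J : ℝ) * bumpConst n β ≤ ∑ j ∈ Finset.range J, ((2 : ℝ)⁻¹ ^ j) ^ (n / q₁) *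
        ((2 : ℝ)⁻¹ ^ j) ^ (n / q₂.conjExponent) *
          (((2 : ℝ)⁻¹ ^ j) ^ (β - n) * bumpConst n β) := by
      have : (J : ℝ) * bumpConst n β = ∑ j ∈ Finset.range J, bumpConst n β := by simp
      rw [this]
      refine Finset.sum_le_sum fun j _ => ?_
      have ht := two_inv_pow_pos j
      have ht1 : (2 : ℝ)⁻¹ ^ j ≤ 1 := pow_le_one₀ (by norm_num) (by norm_num)
      rw [← mul_assoc, ← Real.rpow_add ht, ← Real.rpow_add ht]
      refine le_mul_of_one_le_left (bumpConst_pos hβ hβn).le ?_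
      -- The total exponent is `n/q₁ + β - n/q₂`, nonpositive under the negated claim, so every
      -- diagonal term is at least `bumpConst n β`, also at the endpoint.
      refine Real.one_le_rpow_of_pos_of_le_one_of_nonpos ht ht1 ?_
      have h3 : (n : ℝ) / q₂.conjExponent = n * (1 - 1 / q₂) := by rw [← e]; ring
      have h4 : (n : ℝ) / q₁ = n * (1 / q₁) := by ring
      have h5 : (n : ℝ) * (1 / q₁ + β / n) ≤ n * (1 / q₂) := by gcongr
      have h6 : (n : ℝ) * (β / n) = β := by field_simp
      rw [h3, h4]
      linarith
    have hreal : ∀ ζ : Rn n, conj (bumpSum two_inv_pow_pos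
        (fun j => ((2 : ℝ)⁻¹ ^ j) ^ (n / q₂.conjExponent)) (Finset.range J) ζ)
        = bumpSum two_inv_pow_pos (fun j => ((2 : ℝ)⁻¹ ^ j) ^ (n / q₂.conjExponent))
          (Finset.range J) ζ := fun ζ => by
      rw [bumpSum_apply, Complex.conj_ofReal]
    have hu := h (𝓕⁻ (bumpSum two_inv_pow_pos (fun j => ((2 : ℝ)⁻¹ ^ j) ^ (n / q₁))
      (Finset.range J))) (𝓕 (bumpSum two_inv_pow_pos
        (fun j => ((2 : ℝ)⁻¹ ^ j) ^ (n / q₂.conjExponent)) (Finset.range J)))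
    rw [conjSchwartz_fourier hreal, ← ofReal_norm] at hu
    have hfin : ENNReal.ofReal ((J : ℝ) * bumpConst n β) ≤ C * (D₁ * D₂) *
        ENNReal.ofReal ((J : ℝ) ^ (1 / q₁ + 1 / q₂.conjExponent)) := by
      refine (ENNReal.ofReal_le_ofReal (hlow.trans hl)).trans (hu.trans ?_)
      rw [Real.rpow_add hJ0, ENNReal.ofReal_mul (by positivity)]
      calc _ ≤ C * (D₁ * ENNReal.ofReal ((J : ℝ) ^ (1 / q₁)) *
            (D₂ * ENNReal.ofReal ((J : ℝ) ^ (1 / q₂.conjExponent)))) := by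
            gcongr
            · exact h₁ J
            · exact h₂ J
        _ = _ := by ring
    rw [Real.rpow_sub hJ0, Real.rpow_one, div_mul_eq_mul_div,
      ENNReal.ofReal_div_of_pos (by positivity)]
    exact ENNReal.div_le_of_le_mul hfin
  rw [e] at key
  have : 0 < β / n := by positivity
  linarith

end Necessity

end ModulationSpaces

end

theorem theorem1p2 {n : ℕ} (φ : SchwartzMap (EuclideanSpace ℝ (Fin n)) ℂ) (hφ : φ ≠ 0)
    (α β p₁ p₂ q₁ q₂ : ℝ) (hβ : 0 < β) (hβα : β ≤ α) (hα : α < n)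
    (hp₁ : 1 < p₁) (hp₂ : 1 < p₂) (hq₁ : 1 < q₁) (hq₂ : 1 < q₂) :
    ModulationSpaces.FractionalIntegralBounded φ α β p₁ q₁ p₂ q₂ ↔
      1 / p₂ ≤ 1 / p₁ - α / n ∧ 1 / q₂ < 1 / q₁ + β / n := by
  exact ⟨fun h =>
      ⟨ModulationSpaces.one_div_le_of_fractionalIntegralBounded hφ hβ hβα hα hp₁ hp₂ hq₁ hq₂ h,
      ModulationSpaces.one_div_lt_of_fractionalIntegralBounded hφ hβ hβα hα hp₁ hp₂ hq₁ hq₂ h⟩,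
    fun h => ModulationSpaces.fractionalIntegralBounded_of_le hφ hβ hβα hα hp₁ hp₂ hq₁ hq₂ h.1 h.2⟩
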